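/- Let $\xi_0,\xi_1,\dots$ be i.i.d. complex-valued, non-degenerate (not almost surely constant) random variables with $\mathbb E\log(1+|\xi_0|)<\infty$. Let $a_{k;n}$ ($n\in\mathbb N$, $0\le k\le n$) be deterministic complex numbers for which there is a continuous concave function $g:[0,1]\to\mathbb R$ with finite left derivative at $1$, $g'_-(1)>-\infty$, such that $$\lim_{n\to\infty}\ \sup_{0\le k\le n}\Big|\tfrac1n\log|a_{k;n}|-g\big(\tfrac kn\big)\Big|=0,\qquad \log 0:=-\infty .$$ Put $P_n(z)=\sum_{k=0}^n\xi_k a_{k;n}z^k$. For a non-constant polynomial $P$ let $[\![P]\!]=\frac1{\deg P}\sum_{z:P(z)=0}\delta_z$, with zeros counted with multiplicity, and let $[\![P]\!]=0$ if $P$ is constant. Let $t>0$ and let $\nu_t$ be the limiting zero distribution at time $t$, that is, the (existing and unique) deterministic probability measure on $\mathbb C$ to which $$\Big[\!\!\Big[\exp\Big\{-\frac t{2n}\partial_z^2\Big\}P_n\Big]\!\!\Big],\qquad \exp\Big\{-\frac s2\partial_z^2\Big\}P:=\sum_{j\ge0}\frac1{j!}\Big(-\frac s2\Big)^j\partial_z^{2j}P,$$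 converges weakly in probability as $n\to\infty$ (that is, integrals of every bounded continuous function $\mathbb C\to\mathbb R$ converge in probability). Let $\mathsf{sc}_t$ be the semicircle distribution of variance $t$, with density $\frac{1}{2\pi t}\sqrt{4t-x^2}$ on $[-2\sqrt t,2\sqrt t]\subset\mathbb R\subset\mathbb C$. Then $$t_{\mathrm{Wig}}:=\sup_{\alpha\in(0,1)}\exp\Big(2\cdot\frac{g(\alpha)-g(1)}{1-\alpha}+\frac{\alpha}{1-\alpha}\log\alpha+1\Big)$$ is finite, and $\nu_t=\mathsf{sc}_t$ if and only if $t\ge t_{\mathrm{Wig}}$. If $0<t<t_{\mathrm{Wig}}$, then $\nu_t$ is not concentrated on the real line, i.e. $\nu_t(\mathbb C\setminus\mathbb R)>0$. -/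

import Mathlib

open MeasureTheory ProbabilityTheory Filter Topology Polynomial
open scoped ENNReal BoundedContinuousFunction

namespace HeatZeros

noncomputable section

/-- The heat-flow operator `exp(-(s/2) ∂_z²)` on complex polynomials, as the terminating series
`∑_j (1/j!) (-s/2)^j ∂_z^{2j} p`. All terms with `2 * j > p.natDegree` vanish. -/
def heatFlow (s : ℂ) (p : ℂ[X]) : ℂ[X] :=
  ∑ j ∈ Finset.range (p.natDegree + 1),
    C ((1 / (j.factorial : ℂ)) * (-s / 2) ^ j) * derivative^[2 * j] p

/-- The empirical distribution of the complex zeros of `p`: each zero, counted with multiplicity,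
gets weight `1 / deg p`. It is the zero measure when `p` is constant (there are no roots in the
multiset `p.roots` then). -/
def zeroDistribution (p : ℂ[X]) : Measure ℂ :=
  (p.natDegree : ℝ≥0∞)⁻¹ • (p.roots.map fun z => Measure.dirac z).sum

/-- The random polynomial `P_n(z) = ∑_{k=0}^n ξ_k a_{k;n} z^k`, with `a n k` for `a_{k;n}`. -/
def randomPoly {Ω : Type*} (ξ : ℕ → Ω → ℂ) (a : ℕ → ℕ → ℂ) (n : ℕ) (ω : Ω) : ℂ[X] :=
  ∑ k ∈ Finset.range (n + 1), C (ξ k ω * a n k) * X ^ k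

/-- `ξ_0, ξ_1, …` are i.i.d., non-degenerate complex random variables with
`𝔼 log (1 + |ξ_0|) < ∞`. -/
structure IsAdmissibleNoise {Ω : Type*} [MeasurableSpace Ω] (P : Measure Ω)
    (ξ : ℕ → Ω → ℂ) : Prop where
  measurable : ∀ k, Measurable (ξ k)
  indep : iIndepFun ξ P
  identDistrib : ∀ k, IdentDistrib (ξ k) (ξ 0) P P
  nondegenerate : ¬ ∃ c : ℂ, ∀ᵐ ω ∂P, ξ 0 ω = c
  integrable_log : Integrable (fun ω => Real.log (1 + ‖ξ 0 ω‖)) P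

/-- The deterministic coefficients `a_{k;n}` have exponential profile `g`, i.e.
`sup_{0 ≤ k ≤ n} |(1/n) log |a_{k;n}| - g(k/n)| → 0`, where `g` is continuous and concave on
`[0, 1]` with finite left derivative at `1`. As `log 0 = -∞` in this condition, it forces
`a_{k;n} ≠ 0` for all `k ≤ n` once `n` is large. -/
structure HasExponentialProfile (a : ℕ → ℕ → ℂ) (g : ℝ → ℝ) : Prop where
  continuousOn : ContinuousOn g (Set.Icc 0 1)
  concaveOn : ConcaveOn ℝ (Set.Icc 0 1) g
  leftDeriv_one : DifferentiableWithinAt ℝ g (Set.Iio 1) 1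
  profile : ∀ ε : ℝ, 0 < ε → ∀ᶠ n : ℕ in atTop, ∀ k ≤ n,
    a n k ≠ 0 ∧ |1 / (n : ℝ) * Real.log ‖a n k‖ - g ((k : ℝ) / n)| ≤ ε

/-- The random measures `μ_n` converge weakly to the deterministic measure `ν` in probability:
`∫ f dμ_n → ∫ f dν` in probability for every bounded continuous `f : ℂ → ℝ`. -/
def TendstoWeaklyInProbability {Ω : Type*} [MeasurableSpace Ω] (P : Measure Ω)
    (μ : ℕ → Ω → Measure ℂ) (ν : Measure ℂ) : Prop :=
  ∀ f : ℂ →ᵇ ℝ,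
    TendstoInMeasure P (fun n ω => ∫ z, f z ∂(μ n ω)) atTop (fun _ => ∫ z, f z ∂ν)

/-- `ν` is the limiting zero distribution at time `t` of the random polynomials `P_n`: the limit,
weakly in probability, of the empirical zero distributions of `exp(-(t/(2n)) ∂_z²) P_n`. -/
def IsLimitingZeroDistribution {Ω : Type*} [MeasurableSpace Ω] (P : Measure Ω)
    (ξ : ℕ → Ω → ℂ) (a : ℕ → ℕ → ℂ) (t : ℝ) (ν : ProbabilityMeasure ℂ) : Prop :=
  TendstoWeaklyInProbability P
    (fun n ω => zeroDistribution (heatFlow ((t : ℂ) / (n : ℂ)) (randomPoly ξ a n ω)))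
    (ν : Measure ℂ)

/-- The semicircle distribution of variance `t > 0`, as a measure on `ℂ` carried by the real line:
it has density `√(4t - x²) / (2πt)` on `[-2√t, 2√t]`. -/
def semicircle (t : ℝ) : Measure ℂ :=
  Measure.map (fun x : ℝ => (x : ℂ))
    ((volume.restrict (Set.Icc (-2 * √t) (2 * √t))).withDensity fun x =>
      ENNReal.ofReal (√(4 * t - x ^ 2) / (2 * Real.pi * t)))

/-- The expression whose supremum over `α ∈ (0, 1)` is the collapse time. -/
def wignerTimeFun (g : ℝ → ℝ) (α : ℝ) : ℝ :=
  Real.exp (2 * ((g α - g 1) / (1 - α)) + α / (1 - α) * Real.log α + 1)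

/-- The collapse time `t_Wig`. -/
def wignerTime (g : ℝ → ℝ) : ℝ := sSup (wignerTimeFun g '' Set.Ioo 0 1)

end

end HeatZeros

/-! The heat flow turns each monomial into a Hermite polynomial, so the evolved polynomial is `∑ ξ_k
a_{k;n} He_k(z; t/n)`. Off the real line the ratio of consecutive Hermite polynomials follows `r ↦ z
- c / r` with slowly varying `c = tk/n`. This map contracts the hyperbolic metric of the half-plane,
so the ratio stays close to the fixed point, whose modulus is `jouk c z`. Hence `(1/n) log |He_k(z;
t/n)|` is close to `∫_0^{k/n} log (jouk (tβ) z) dβ`, which is `hermitePot`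
(`eventually_hermite_close`).

A sum of exponentially sized terms with random weights is dominated by its largest terms. The
evolved polynomial therefore has exponential size `U = limitPot t g`, the maximum over `α` of `g α +
hermitePot t α z`. The upper bound uses the logarithmic moment of the noise. The lower bound is an
Erdős–Littlewood–Offord estimate (`IsAdmissibleNoise.exists_anticoncentration`), which needs only
non-degeneracy.

Zeros are recovered from `U` without distributional Laplacians: a measure is tied to its potential
through circle averages (`IsRieszMeasure`), and circle averages determine the masses of discs
(`IsRieszMeasure.unique`). Compactness (`exists_limit_isRieszMeasure`) then gives convergence of the
zero distributions to the unique measure with potential `U`.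

The semicircle law has potential `V = hermitePot t 1`, since it is a mixture of arcsine laws whose
potentials are the functions `log jouk` (`exists_isRieszMeasure_semicircle`). The increment of
`hermitePot` from `α` to `1` is smallest at `z = 0`, and `t ≥ t_Wig` says exactly that `α = 1` is a
maximiser there. It is then a maximiser at every `z`, so `U = g 1 + V`. If `t < t_Wig`, then `U > g
1 + V` near `0`, with equality at some point high on the imaginary axis. Were the limit carried by
the real line, `U - g 1 - V ≥ 0` would have the mean value property in the upper half-plane and
vanish at one of its points, hence vanish there identically: a contradiction. -/

namespace HeatZeros
noncomputable section

/-! ### The truncated logarithmic kernel -/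

/-- The logarithmic kernel truncated at radius `r`. -/
def logKer (r : ℝ) (w : ℂ) : ℝ := Real.log (max r ‖w‖)

lemma continuous_logKer {r : ℝ} (hr : 0 < r) : Continuous (logKer r) :=
  (continuous_const.max continuous_norm).log fun w => (lt_max_of_lt_left hr).ne'

lemma logKer_of_le {r : ℝ} {w : ℂ} (h : r ≤ ‖w‖) : logKer r w = Real.log ‖w‖ := by
  simp [logKer, max_eq_right h]

lemma logKer_of_ge {r : ℝ} {w : ℂ} (h : ‖w‖ ≤ r) : logKer r w = Real.log r := by
  simp [logKer, max_eq_left h]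

lemma logKer_mono {r s : ℝ} (hr : 0 < r) (h : r ≤ s) (w : ℂ) : logKer r w ≤ logKer s w :=
  Real.log_le_log (lt_max_of_lt_left hr) (max_le_max_right _ h)

lemma logKer_neg (r : ℝ) (w : ℂ) : logKer r (-w) = logKer r w := by simp [logKer]

lemma log_norm_le_logKer {r : ℝ} {w : ℂ} (hw : w ≠ 0) : Real.log ‖w‖ ≤ logKer r w :=
  Real.log_le_log (norm_pos_iff.2 hw) (le_max_right _ _)

lemma log_sub_log_le {x y r : ℝ} (hr : 0 < r) (hx : r ≤ x) (hy : r ≤ y) :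
    |Real.log x - Real.log y| ≤ |x - y| / r := by
  have key : ∀ x y : ℝ, r ≤ x → r ≤ y → Real.log x - Real.log y ≤ |x - y| / r := by
    intro x y hx hy
    have hx0 := hr.trans_le hx
    have hy0 := hr.trans_le hy
    rw [← Real.log_div hx0.ne' hy0.ne']
    calc Real.log (x / y) ≤ x / y - 1 := Real.log_le_sub_one_of_pos (by positivity)
      _ = (x - y) / y := by field_simp
      _ ≤ |x - y| / y := by gcongr; exact le_abs_self _
      _ ≤ |x - y| / r := by gcongr
  rw [abs_le]
  constructor
  · have := key y x hy hx
    rw [abs_sub_comm] at this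
    linarith
  · exact key x y hx hy

lemma abs_logKer_sub_le {r : ℝ} (hr : 0 < r) (v w : ℂ) :
    |logKer r v - logKer r w| ≤ ‖v - w‖ / r := by
  refine (log_sub_log_le hr (le_max_left _ _) (le_max_left _ _)).trans ?_
  gcongr
  refine (abs_max_sub_max_le_max _ _ _ _).trans ?_
  simp [abs_norm_sub_norm_le]

/-- A bound for the regularised kernel `logKer r (z - w) - logKer 1 w`. -/
def kerBound (r a : ℝ) : ℝ :=
  Real.log (max r 1 + a) + Real.log (1 / r + 1 + a / r)

/-- Each of `max r ‖z - w‖` and `max 1 ‖w‖` is at most a constant times the other, uniformly in `w`.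
Subtracting `logKer 1 w` thus makes the kernel bounded: potentials exist for every finite measure,
whatever its tail, and the kernel is a legitimate test function for weak convergence. -/
lemma abs_logKer_sub_logKer_one_le {r a : ℝ} (hr : 0 < r) {z : ℂ} (hz : ‖z‖ ≤ a) (w : ℂ) :
    |logKer r (z - w) - logKer 1 w| ≤ kerBound r a := by
  have ha : 0 ≤ a := (norm_nonneg z).trans hz
  have h1 : (1 : ℝ) ≤ max 1 ‖w‖ := le_max_left _ _
  have h2 : ‖w‖ ≤ max 1 ‖w‖ := le_max_right _ _
  have h3 : r ≤ max r ‖z - w‖ := le_max_left _ _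
  have h4 : ‖z - w‖ ≤ max r ‖z - w‖ := le_max_right _ _
  have h5 : ‖z - w‖ ≤ ‖z‖ + ‖w‖ := norm_sub_le _ _
  have h6 : ‖w‖ ≤ ‖z - w‖ + ‖z‖ := by
    have := norm_sub_norm_le w z
    rw [norm_sub_rev] at this
    linarith
  have m1 : (1 : ℝ) ≤ max r 1 := le_max_right _ _
  have m2 : r ≤ max r 1 := le_max_left _ _
  have u1 : logKer r (z - w) ≤ Real.log (max r 1 + a) + logKer 1 w := by
    unfold logKer
    rw [← Real.log_mul (by positivity) (by positivity)]
    refine Real.log_le_log (by positivity) (max_le ?_ ?_)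
    · nlinarith
    · nlinarith
  have hr' : 0 < max r ‖z - w‖ := by positivity
  have u2 : logKer 1 w ≤ Real.log (1 / r + 1 + a / r) + logKer r (z - w) := by
    unfold logKer
    rw [← Real.log_mul (by positivity) (by positivity)]
    have e1 : 1 ≤ 1 / r * max r ‖z - w‖ := by
      rw [one_div, ← div_eq_inv_mul, one_le_div hr]; exact h3
    have e2 : a ≤ a / r * max r ‖z - w‖ := by
      rw [div_mul_eq_mul_div, le_div_iff₀ hr]; gcongr
    refine Real.log_le_log (by positivity) (max_le ?_ ?_)
    · nlinarith
    · nlinarith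
  have p1 : 0 ≤ Real.log (max r 1 + a) := Real.log_nonneg (by linarith)
  have p2 : 0 ≤ Real.log (1 / r + 1 + a / r) := Real.log_nonneg (by
    have : 0 ≤ 1 / r := by positivity
    have : 0 ≤ a / r := by positivity
    linarith)
  unfold kerBound
  rw [abs_le]
  constructor <;> linarith

/-- Jensen's formula. It is the reason for truncating: averaging the logarithmic kernel over a
circle of radius `R` truncates it at `R`. -/
lemma circleAverage_log_norm_sub {R : ℝ} (hR : 0 < R) (z w : ℂ) :
    Real.circleAverage (fun ζ => Real.log ‖ζ - w‖) z R = logKer R (z - w) := by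
  rw [circleAverage_log_norm_sub_const_eq_log_radius_add_posLog hR.ne']
  have h : ‖((R : ℂ))⁻¹ * (z - w)‖ = ‖z - w‖ / R := by
    rw [norm_mul, norm_inv, Complex.norm_real, Real.norm_of_nonneg hR.le, inv_mul_eq_div]
  rcases le_total ‖z - w‖ R with h1 | h1
  · rw [logKer_of_ge h1, Real.posLog_eq_zero_iff _ |>.2, add_zero]
    rw [abs_of_nonneg (by positivity), inv_mul_eq_div]
    exact (div_le_one hR).2 h1
  · rw [logKer_of_le h1, Real.posLog_eq_log, inv_mul_eq_div, Real.log_div (by linarith) hR.ne']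
    · ring
    · rw [abs_of_nonneg (by positivity), inv_mul_eq_div]
      exact (one_le_div hR).2 h1

/-! ### Measures with a given potential -/

/-- The truncated and renormalised logarithmic potential of `ν`. -/
def truncPotential (ν : Measure ℂ) (r : ℝ) (z : ℂ) : ℝ :=
  ∫ w, (logKer r (z - w) - logKer 1 w) ∂ν

/-- `ν` has potential `U` (up to the constant `L`), expressed through circle averages. -/
def IsRieszMeasure (U : ℂ → ℝ) (ν : Measure ℂ) (L : ℝ) : Prop :=
  ∀ z : ℂ, ∀ R : ℝ, 0 < R → Real.circleAverage U z R = L + truncPotential ν R z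

lemma continuous_ker {r : ℝ} (hr : 0 < r) :
    Continuous fun p : ℂ × ℂ => logKer r (p.1 - p.2) - logKer 1 p.2 :=
  ((continuous_logKer hr).comp (continuous_fst.sub continuous_snd)).sub
    ((continuous_logKer one_pos).comp continuous_snd)

lemma continuous_ker_right {r : ℝ} (hr : 0 < r) (z : ℂ) :
    Continuous fun w : ℂ => logKer r (z - w) - logKer 1 w :=
  (continuous_ker hr).comp (Continuous.prodMk_right z)

lemma integrable_ker (ν : Measure ℂ) [IsFiniteMeasure ν] {r : ℝ} (hr : 0 < r) (z : ℂ) :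
    Integrable (fun w => logKer r (z - w) - logKer 1 w) ν :=
  Integrable.of_bound (continuous_ker_right hr z).aestronglyMeasurable (kerBound r ‖z‖)
    (ae_of_all _ fun w => abs_logKer_sub_logKer_one_le hr le_rfl w)

lemma truncPotential_mono (ν : Measure ℂ) [IsFiniteMeasure ν] {r s : ℝ} (hr : 0 < r) (h : r ≤ s)
    (z : ℂ) : truncPotential ν r z ≤ truncPotential ν s z :=
  integral_mono (integrable_ker ν hr z) (integrable_ker ν (hr.trans_le h) z) fun w =>
    sub_le_sub_right (logKer_mono hr h _) _

lemma abs_truncPotential_sub_le (ν : Measure ℂ) [IsProbabilityMeasure ν] {r : ℝ} (hr : 0 < r)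
    (z z' : ℂ) : |truncPotential ν r z - truncPotential ν r z'| ≤ ‖z - z'‖ / r := by
  unfold truncPotential
  rw [← integral_sub (integrable_ker ν hr z) (integrable_ker ν hr z'), ← Real.norm_eq_abs]
  refine (norm_integral_le_of_norm_le_const (C := ‖z - z'‖ / r) (ae_of_all _ fun w => ?_)).trans ?_
  · rw [Real.norm_eq_abs]
    have := abs_logKer_sub_le hr (z - w) (z' - w)
    simpa using this
  · simp

lemma continuous_truncPotential (ν : Measure ℂ) [IsProbabilityMeasure ν] {r : ℝ} (hr : 0 < r) :
    Continuous (truncPotential ν r) := by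
  refine (LipschitzWith.of_dist_le_mul (K := ⟨1 / r, by positivity⟩) fun z z' => ?_).continuous
  rw [Real.dist_eq, dist_eq_norm]
  refine (abs_truncPotential_sub_le ν hr z z').trans (le_of_eq ?_)
  change _ = 1 / r * _
  ring

lemma integral_annulus_kernel (ν : Measure ℂ) [IsFiniteMeasure ν] {r s : ℝ} (hr : 0 < r)
    (hs : 0 < s) (z : ℂ) :
    ∫ w, (logKer s (z - w) - logKer r (z - w)) ∂ν =
      truncPotential ν s z - truncPotential ν r z := by
  unfold truncPotential
  rw [← integral_sub (integrable_ker ν hs z) (integrable_ker ν hr z)]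
  congr 1
  ext w
  ring

/-- The integrand `(logKer (R s) - logKer R) / log s`, evaluated at `z - w`, equals `1` on the disc
of radius `R`, vanishes outside radius `R s`, and lies between `0` and `1`. As `s` decreases to `1`
it tends to the indicator of the closed disc. -/
lemma tendsto_measureReal_closedBall (ν : Measure ℂ) [IsFiniteMeasure ν] {R : ℝ} (hR : 0 < R)
    (z : ℂ) :
    Tendsto (fun k : ℕ => (truncPotential ν (R * (1 + 1 / (k + 1))) z - truncPotential ν R z) /
      Real.log (1 + 1 / (k + 1))) atTop (𝓝 (ν.real (Metric.closedBall z R))) := by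
  have hpos : ∀ k : ℕ, (0 : ℝ) < 1 / (k + 1) := fun k => by positivity
  have hlog : ∀ k : ℕ, 0 < Real.log (1 + 1 / ((k : ℝ) + 1)) := fun k =>
    Real.log_pos (by linarith [hpos k])
  have hRk : ∀ k : ℕ, R ≤ R * (1 + 1 / ((k : ℝ) + 1)) := fun k => by nlinarith [hpos k]
  have e : ∀ k : ℕ, (truncPotential ν (R * (1 + 1 / (k + 1))) z - truncPotential ν R z) /
      Real.log (1 + 1 / (k + 1)) = ∫ w, (logKer (R * (1 + 1 / ((k : ℝ) + 1))) (z - w) -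
        logKer R (z - w)) / Real.log (1 + 1 / ((k : ℝ) + 1)) ∂ν := by
    intro k
    rw [integral_div, integral_annulus_kernel ν hR (hR.trans_le (hRk k))]
  simp_rw [e]
  rw [← integral_indicator_one Metric.isClosed_closedBall.measurableSet]
  refine tendsto_integral_of_dominated_convergence (fun _ => 1) ?_ (integrable_const _) ?_ ?_
  · intro k
    refine Continuous.aestronglyMeasurable (Continuous.div_const (Continuous.sub ?_ ?_) _)
    · exact (continuous_logKer (hR.trans_le (hRk k))).comp (continuous_const.sub continuous_id)
    · exact (continuous_logKer hR).comp (continuous_const.sub continuous_id)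
  · intro k
    refine ae_of_all _ fun w => ?_
    have h0 : 0 ≤ logKer (R * (1 + 1 / ((k : ℝ) + 1))) (z - w) - logKer R (z - w) :=
      sub_nonneg.2 (logKer_mono hR (hRk k) _)
    rw [Real.norm_eq_abs, abs_of_nonneg (div_nonneg h0 (hlog k).le), div_le_one (hlog k)]
    rw [sub_le_iff_le_add]
    unfold logKer
    rw [← Real.log_mul (by linarith [hpos k]) (lt_max_of_lt_left hR).ne']
    refine Real.log_le_log (lt_max_of_lt_left (hR.trans_le (hRk k))) (max_le ?_ ?_)
    · rw [mul_comm]; gcongr; exact le_max_left _ _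
    · have := le_max_right R ‖z - w‖
      nlinarith [hpos k, norm_nonneg (z - w)]
  · refine ae_of_all _ fun w => ?_
    by_cases hw : w ∈ Metric.closedBall z R
    · have hw' : ‖z - w‖ ≤ R := by rw [← dist_eq_norm']; exact hw
      rw [Set.indicator_of_mem hw]
      refine tendsto_const_nhds.congr fun k => ?_
      rw [logKer_of_ge (hw'.trans (hRk k)), logKer_of_ge hw',
        Real.log_mul hR.ne' (by linarith [hpos k]), add_sub_cancel_left, div_self (hlog k).ne']
      rfl
    · have hw' : R < ‖z - w‖ := by rw [← dist_eq_norm']; exact not_le.1 hw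
      rw [Set.indicator_of_notMem hw]
      have hlim : Tendsto (fun k : ℕ => R * (1 + 1 / ((k : ℝ) + 1))) atTop (𝓝 (R * (1 + 0))) :=
        (tendsto_one_div_add_atTop_nhds_zero_nat.const_add 1).const_mul R
      rw [add_zero, mul_one] at hlim
      refine tendsto_const_nhds.congr' ?_
      filter_upwards [hlim.eventually_lt_const hw'] with k hk
      rw [logKer_of_le hk.le, logKer_of_le hw'.le]
      simp

/-- By Besicovitch differentiation the density of `ν` with respect to `μ` is the limit of ratios of
masses of small balls, so it is `1`. The absolutely continuous part of `ν` is therefore `μ` itself.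
-/
lemma le_of_closedBall_eq {μ ν : Measure ℂ} [IsFiniteMeasure μ] [IsFiniteMeasure ν]
    (h : ∀ z : ℂ, ∀ R : ℝ, 0 < R → μ (Metric.closedBall z R) = ν (Metric.closedBall z R)) :
    μ ≤ ν := by
  have h1 : ν.rnDeriv μ =ᵐ[μ] fun _ => 1 := by
    filter_upwards [Besicovitch.ae_tendsto_rnDeriv ν μ, Besicovitch.ae_tendsto_rnDeriv μ μ,
      Measure.rnDeriv_self μ] with x h1 h2 h3
    rw [← h3]
    refine tendsto_nhds_unique h1 (h2.congr' ?_)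
    filter_upwards [self_mem_nhdsWithin] with r hr
    rw [h x r hr]
  calc μ = μ.withDensity (fun _ => 1) := by simp
    _ = μ.withDensity (ν.rnDeriv μ) := (withDensity_congr_ae h1).symm
    _ ≤ ν := Measure.withDensity_rnDeriv_le ν μ

/-- Only differences of circle averages at two radii enter the mass of a disc, so the constants `L`
and `L'` are irrelevant. -/
theorem IsRieszMeasure.unique {U : ℂ → ℝ} {μ ν : Measure ℂ} [IsFiniteMeasure μ]
    [IsFiniteMeasure ν] {L L' : ℝ} (hμ : IsRieszMeasure U μ L) (hν : IsRieszMeasure U ν L') :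
    μ = ν := by
  have h : ∀ z : ℂ, ∀ R : ℝ, 0 < R → μ (Metric.closedBall z R) = ν (Metric.closedBall z R) := by
    intro z R hR
    have h1 := tendsto_measureReal_closedBall μ hR z
    have h2 := tendsto_measureReal_closedBall ν hR z
    rw [← measureReal_eq_measureReal_iff]
    refine tendsto_nhds_unique h1 (h2.congr fun k => ?_)
    have hk : 0 < R * (1 + 1 / ((k : ℝ) + 1)) := by positivity
    have a1 := hμ z R hR
    have a2 := hν z R hR
    have a3 := hμ z _ hk
    have a4 := hν z _ hk
    congr 1
    linarith
  exact le_antisymm (le_of_closedBall_eq h) (le_of_closedBall_eq fun z R hR => (h z R hR).symm)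

end
end HeatZeros

namespace HeatZeros
noncomputable section

/-! ### Limits of circle averages -/

lemma ae_circleMap_notMem {S : Set ℂ} (hS : S.Countable) (z : ℂ) {R : ℝ} (hR : R ≠ 0) :
    ∀ᵐ θ : ℝ, circleMap z R θ ∉ S :=
  (hS.preimage_circleMap z hR).ae_notMem volume

lemma tendsto_circleAverage_of_dominated {f : ℕ → ℂ → ℝ} {g b : ℂ → ℝ} {z : ℂ} {R : ℝ}
    (hf : ∀ k, CircleIntegrable (f k) z R) (hb : CircleIntegrable b z R)
    (hbound : ∀ k, ∀ᵐ θ : ℝ, |f k (circleMap z R θ)| ≤ b (circleMap z R θ))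
    (hlim : ∀ᵐ θ : ℝ, Tendsto (fun k => f k (circleMap z R θ)) atTop (𝓝 (g (circleMap z R θ)))) :
    Tendsto (fun k => Real.circleAverage (f k) z R) atTop (𝓝 (Real.circleAverage g z R)) := by
  unfold Real.circleAverage
  refine Tendsto.const_smul ?_ _
  refine intervalIntegral.tendsto_integral_filter_of_dominated_convergence
    (fun θ => b (circleMap z R θ)) (Eventually.of_forall fun k => ?_)
    (Eventually.of_forall fun k => ?_) hb ?_
  · rw [Set.uIoc_of_le Real.two_pi_pos.le]
    exact (hf k).1.aestronglyMeasurable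
  · filter_upwards [hbound k] with θ h _
    exact h
  · filter_upwards [hlim] with θ h _
    exact h

lemma circleIntegrable_of_continuous {f : ℂ → ℝ} (hf : Continuous f) (z : ℂ) (R : ℝ) :
    CircleIntegrable f z R :=
  (hf.comp (continuous_circleMap z R)).intervalIntegrable _ _

lemma tendsto_logKer_nhdsGT {w : ℂ} (hw : w ≠ 0) {r : ℕ → ℝ} (hr : Tendsto r atTop (𝓝 0)) :
    Tendsto (fun k => logKer (r k) w) atTop (𝓝 (Real.log ‖w‖)) := by
  refine tendsto_const_nhds.congr' ?_
  filter_upwards [hr.eventually_lt_const (norm_pos_iff.2 hw)] with k hk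
  rw [logKer_of_le hk.le]

lemma continuous_logKer_sub {r : ℝ} (hr : 0 < r) (w : ℂ) :
    Continuous fun ζ : ℂ => logKer r (ζ - w) :=
  (continuous_logKer hr).comp (continuous_id.sub continuous_const)

lemma tendsto_circleAverage_logKer (z w : ℂ) {R : ℝ} (hR : 0 < R) {r : ℕ → ℝ} (hr0 : ∀ k, 0 < r k)
    (hr1 : ∀ k, r k ≤ 1) (hr : Tendsto r atTop (𝓝 0)) :
    Tendsto (fun k => Real.circleAverage (fun ζ => logKer (r k) (ζ - w)) z R) atTop
      (𝓝 (logKer R (z - w))) := by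
  rw [← circleAverage_log_norm_sub hR]
  refine tendsto_circleAverage_of_dominated
    (b := fun ζ => |Real.log ‖ζ - w‖| + |logKer 1 (ζ - w)|) (fun k => ?_) ?_ (fun k => ?_) ?_
  · exact circleIntegrable_of_continuous (continuous_logKer_sub (hr0 k) w) _ _
  · exact CircleIntegrable.add (circleIntegrable_log_norm_sub_const R).abs
      (circleIntegrable_of_continuous (continuous_logKer_sub one_pos w).abs _ _)
  · filter_upwards [ae_circleMap_notMem (Set.countable_singleton w) z hR.ne'] with θ hθ
    have h1 := log_norm_le_logKer (r := r k) (sub_ne_zero.2 hθ)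
    have h2 := logKer_mono (hr0 k) (hr1 k) (circleMap z R θ - w)
    rw [abs_le]
    constructor
    · linarith [neg_abs_le (Real.log ‖circleMap z R θ - w‖),
        abs_nonneg (logKer 1 (circleMap z R θ - w))]
    · linarith [le_abs_self (logKer 1 (circleMap z R θ - w)),
        abs_nonneg (Real.log ‖circleMap z R θ - w‖)]
  · filter_upwards [ae_circleMap_notMem (Set.countable_singleton w) z hR.ne'] with θ hθ
    exact tendsto_logKer_nhdsGT (sub_ne_zero.2 hθ) hr

lemma circleAverage_truncPotential (ν : Measure ℂ) [IsProbabilityMeasure ν] {r : ℝ} (hr : 0 < r)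
    (z : ℂ) (R : ℝ) :
    Real.circleAverage (truncPotential ν r) z R =
      ∫ w, (Real.circleAverage (fun ζ => logKer r (ζ - w)) z R - logKer 1 w) ∂ν := by
  have hsub : ∀ w, Real.circleAverage (fun ζ => logKer r (ζ - w)) z R - logKer 1 w =
      Real.circleAverage (fun ζ => logKer r (ζ - w) - logKer 1 w) z R := by
    intro w
    rw [Real.circleAverage_fun_sub
      (circleIntegrable_of_continuous (continuous_logKer_sub hr w) _ _)
      (circleIntegrable_const _ _ _), Real.circleAverage_const]
  simp_rw [hsub]
  unfold Real.circleAverage truncPotential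
  simp_rw [smul_eq_mul, integral_const_mul,
    intervalIntegral.integral_of_le Real.two_pi_pos.le]
  congr 1
  refine integral_integral_swap ?_
  refine Integrable.of_bound (C := kerBound r (‖z‖ + |R|)) ?_ (ae_of_all _ fun p => ?_)
  · refine Continuous.aestronglyMeasurable ?_
    exact (continuous_ker hr).comp
      (((continuous_circleMap z R).comp continuous_fst).prodMk continuous_snd)
  · refine abs_logKer_sub_logKer_one_le hr ?_ _
    refine (norm_le_norm_add_norm_sub' _ z).trans ?_
    gcongr
    rw [norm_sub_rev, ← dist_eq_norm, dist_comm]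
    exact (circleMap_mem_closedBall z (abs_nonneg R) p.1 |> fun h => by
      simp [circleMap, dist_eq_norm])

/-- It suffices to know `U` as the pointwise limit of its truncated potentials. Averaging these over
a circle, exchanging integrals and letting the truncation radius tend to `0` gives the potential
truncated at `R`, by Jensen's formula. -/
lemma isRieszMeasure_of_tendsto {U : ℂ → ℝ} (hU : Continuous U) {ν : Measure ℂ}
    [IsProbabilityMeasure ν] {L : ℝ}
    (h : ∀ z, Tendsto (fun k : ℕ => L + truncPotential ν (1 / ((k : ℝ) + 1)) z) atTop (𝓝 (U z))) :
    IsRieszMeasure U ν L := by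
  intro z R hR
  set r : ℕ → ℝ := fun k => 1 / ((k : ℝ) + 1) with hrdef
  have hr0 : ∀ k, 0 < r k := fun k => by positivity
  have hr1 : ∀ k, r k ≤ 1 := fun k => by
    rw [hrdef]; exact (div_le_one (by positivity)).2 (by linarith [(Nat.cast_nonneg k : (0:ℝ) ≤ k)])
  have hranti : Antitone r := fun a b hab => by
    simp only [hrdef]; gcongr
  have hr : Tendsto r atTop (𝓝 0) := tendsto_one_div_add_atTop_nhds_zero_nat
  -- The truncations decrease with the radius, so they all lie between the limit `U` and the
  -- truncation at radius `1`. This sandwich supplies the dominating function.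
  have hlow : ∀ k z, U z ≤ L + truncPotential ν (r k) z := by
    intro k z
    refine le_of_tendsto (h z) ?_
    filter_upwards [eventually_ge_atTop k] with j hj
    linarith [truncPotential_mono ν (hr0 j) (hranti hj) z]
  have lim1 : Tendsto (fun k => Real.circleAverage (fun ζ => L + truncPotential ν (r k) ζ) z R)
      atTop (𝓝 (Real.circleAverage U z R)) := by
    refine tendsto_circleAverage_of_dominated
      (b := fun ζ => |U ζ| + |L + truncPotential ν 1 ζ|) (fun k => ?_) ?_ (fun k => ?_) ?_
    · exact circleIntegrable_of_continuous
        (continuous_const.add (continuous_truncPotential ν (hr0 k))) _ _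
    · exact circleIntegrable_of_continuous (hU.abs.add
        (continuous_const.add (continuous_truncPotential ν one_pos)).abs) _ _
    · refine ae_of_all _ fun θ => ?_
      have h1 := hlow k (circleMap z R θ)
      have h2 := truncPotential_mono ν (hr0 k) (hr1 k) (circleMap z R θ)
      rw [abs_le]
      constructor
      · linarith [neg_abs_le (U (circleMap z R θ)),
          abs_nonneg (L + truncPotential ν 1 (circleMap z R θ))]
      · linarith [le_abs_self (L + truncPotential ν 1 (circleMap z R θ)),
          abs_nonneg (U (circleMap z R θ))]
    · exact ae_of_all _ fun θ => h _
  have e : ∀ k, Real.circleAverage (fun ζ => L + truncPotential ν (r k) ζ) z R =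
      L + ∫ w, (Real.circleAverage (fun ζ => logKer (r k) (ζ - w)) z R - logKer 1 w) ∂ν := by
    intro k
    rw [Real.circleAverage_fun_add (circleIntegrable_const _ _ _)
      (circleIntegrable_of_continuous (continuous_truncPotential ν (hr0 k)) _ _),
      Real.circleAverage_const, circleAverage_truncPotential ν (hr0 k)]
  simp_rw [e] at lim1
  refine tendsto_nhds_unique lim1 (Tendsto.const_add L ?_)
  have hint : ∀ s : ℝ, 0 < s → ∀ w, Real.circleAverage (fun ζ => logKer s (ζ - w)) z R -
      logKer 1 w = Real.circleAverage (fun ζ => logKer s (ζ - w) - logKer 1 w) z R := by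
    intro s hs w
    rw [Real.circleAverage_fun_sub
      (circleIntegrable_of_continuous (continuous_logKer_sub hs w) _ _)
      (circleIntegrable_const _ _ _), Real.circleAverage_const]
  refine tendsto_integral_of_dominated_convergence
    (fun _ => kerBound R ‖z‖ + kerBound 1 (‖z‖ + |R|)) (fun k => ?_) (integrable_const _)
    (fun k => ae_of_all _ fun w => ?_) (ae_of_all _ fun w => ?_)
  · refine Continuous.aestronglyMeasurable ?_
    simp_rw [hint _ (hr0 k)]
    unfold Real.circleAverage
    refine Continuous.const_smul (intervalIntegral.continuous_parametric_intervalIntegral_of_continuous' (f := fun w θ =>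
      logKer (r k) (circleMap z R θ - w) - logKer 1 w) ?_ 0 (2 * Real.pi)) ((2 * Real.pi)⁻¹)
    exact (continuous_ker (hr0 k)).comp
      (((continuous_circleMap z R).comp continuous_snd).prodMk continuous_fst)
  · have b1 : logKer R (z - w) ≤ Real.circleAverage (fun ζ => logKer (r k) (ζ - w)) z R := by
      refine le_of_tendsto (tendsto_circleAverage_logKer z w hR hr0 hr1 hr) ?_
      filter_upwards [eventually_ge_atTop k] with j hj
      exact Real.circleAverage_mono
        (circleIntegrable_of_continuous (continuous_logKer_sub (hr0 j) w) _ _)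
        (circleIntegrable_of_continuous (continuous_logKer_sub (hr0 k) w) _ _)
        fun ζ _ => logKer_mono (hr0 j) (hranti hj) _
    have b2 : Real.circleAverage (fun ζ => logKer (r k) (ζ - w)) z R ≤
        Real.circleAverage (fun ζ => logKer 1 (ζ - w)) z R :=
      Real.circleAverage_mono
        (circleIntegrable_of_continuous (continuous_logKer_sub (hr0 k) w) _ _)
        (circleIntegrable_of_continuous (continuous_logKer_sub one_pos w) _ _)
        fun ζ _ => logKer_mono (hr0 k) (hr1 k) _
    have b3 : Real.circleAverage (fun ζ => logKer 1 (ζ - w)) z R - logKer 1 w ≤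
        kerBound 1 (‖z‖ + |R|) := by
      rw [hint 1 one_pos]
      refine Real.circleAverage_mono_on_of_le_circle
        (circleIntegrable_of_continuous ((continuous_logKer_sub one_pos w).sub continuous_const) _ _)
        fun ζ hζ => ?_
      refine (le_abs_self _).trans (abs_logKer_sub_logKer_one_le one_pos ?_ _)
      refine (norm_le_norm_add_norm_sub' _ z).trans ?_
      gcongr
      rw [norm_sub_rev]
      exact (mem_sphere_iff_norm.1 hζ).le.trans_eq' (norm_sub_rev _ _)
    have b4 := abs_le.1 (abs_logKer_sub_logKer_one_le hR (le_refl ‖z‖) w)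
    have b5 := (abs_nonneg _).trans (abs_logKer_sub_logKer_one_le hR (le_refl ‖z‖) w)
    have b6 : 0 ≤ kerBound 1 (‖z‖ + |R|) :=
      (abs_nonneg _).trans (abs_logKer_sub_logKer_one_le (z := z) one_pos
        (by linarith [abs_nonneg R]) w)
    rw [Real.norm_eq_abs, abs_le]
    constructor <;> linarith [b4.1, b4.2]
  · exact (tendsto_circleAverage_logKer z w hR hr0 hr1 hr).sub_const _

end
end HeatZeros

namespace HeatZeros
noncomputable section

/-! ### Zeros of polynomials and circle averages -/

lemma eval_multiset_prod_ne_zero {s : Multiset ℂ} {ζ : ℂ} (h : ζ ∉ s) :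
    ((s.map fun w => X - C w).prod).eval ζ ≠ 0 := by
  rw [eval_multiset_prod, Multiset.map_map]
  refine Multiset.prod_ne_zero ?_
  simp only [Multiset.mem_map, Function.comp_apply, eval_sub, eval_X, eval_C, not_exists, not_and]
  intro w hw h0
  rw [sub_eq_zero] at h0
  exact h (h0 ▸ hw)

lemma circleIntegrable_log_norm_eval (p : ℂ[X]) (z : ℂ) (R : ℝ) :
    CircleIntegrable (fun ζ => Real.log ‖p.eval ζ‖) z R :=
  MeromorphicOn.circleIntegrable_log_norm fun x _ =>
    ((p.differentiable.analyticAt x)).meromorphicAt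

lemma circleAverage_log_norm_prod (s : Multiset ℂ) (z : ℂ) {R : ℝ} (hR : 0 < R) :
    Real.circleAverage (fun ζ => Real.log ‖((s.map fun w => X - C w).prod).eval ζ‖) z R =
      (s.map fun w => logKer R (z - w)).sum := by
  induction s using Multiset.induction_on with
  | empty => simp [Real.circleAverage_const]
  | cons a s ih =>
    rw [Multiset.map_cons, Multiset.map_cons, Multiset.sum_cons, ← ih, Multiset.prod_cons,
      ← circleAverage_log_norm_sub hR, ← Real.circleAverage_fun_add
        (circleIntegrable_log_norm_sub_const R) (circleIntegrable_log_norm_eval _ _ _)]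
    unfold Real.circleAverage
    congr 1
    refine intervalIntegral.integral_congr_ae ?_
    have hc : ((a ::ₘ s).toFinset : Set ℂ).Countable := Finset.countable_toSet _
    filter_upwards [ae_circleMap_notMem hc z hR.ne'] with θ hθ _
    simp only [Finset.mem_coe, Multiset.mem_toFinset, Multiset.mem_cons, not_or] at hθ
    rw [eval_mul, norm_mul, Real.log_mul]
    · simp
    · simpa [sub_eq_zero] using hθ.1
    · exact norm_ne_zero_iff.2 (eval_multiset_prod_ne_zero hθ.2)

lemma eq_C_mul_prod_roots (p : ℂ[X]) :
    p = C p.leadingCoeff * (p.roots.map fun w => X - C w).prod :=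
  (IsAlgClosed.splits p).eq_prod_roots

lemma circleAverage_log_norm_eval {p : ℂ[X]} (hp : p ≠ 0) (z : ℂ) {R : ℝ} (hR : 0 < R) :
    Real.circleAverage (fun ζ => Real.log ‖p.eval ζ‖) z R =
      Real.log ‖p.leadingCoeff‖ + (p.roots.map fun w => logKer R (z - w)).sum := by
  rw [← circleAverage_log_norm_prod _ _ hR,
    ← Real.circleAverage_const (Real.log ‖p.leadingCoeff‖) z R,
    ← Real.circleAverage_fun_add (circleIntegrable_const _ _ _)
      (circleIntegrable_log_norm_eval _ _ _)]
  unfold Real.circleAverage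
  congr 1
  refine intervalIntegral.integral_congr_ae ?_
  have hc : (p.roots.toFinset : Set ℂ).Countable := Finset.countable_toSet _
  filter_upwards [ae_circleMap_notMem hc z hR.ne'] with θ hθ _
  simp only [Finset.mem_coe, Multiset.mem_toFinset] at hθ
  conv_lhs => rw [eq_C_mul_prod_roots p]
  rw [eval_mul, eval_C, norm_mul, Real.log_mul]
  · exact norm_ne_zero_iff.2 (leadingCoeff_ne_zero.2 hp)
  · exact norm_ne_zero_iff.2 (eval_multiset_prod_ne_zero hθ)

/-- The sub-mean value inequality, read off the factorisation: each factor satisfies `log ‖z - w‖ ≤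
logKer R (z - w)`. -/
lemma log_norm_eval_le_circleAverage (p : ℂ[X]) {z : ℂ} (hz : p.eval z ≠ 0) {R : ℝ} (hR : 0 < R) :
    Real.log ‖p.eval z‖ ≤ Real.circleAverage (fun ζ => Real.log ‖p.eval ζ‖) z R := by
  have hp : p ≠ 0 := fun h => by simp [h] at hz
  rw [circleAverage_log_norm_eval hp z hR]
  have key : ∀ s : Multiset ℂ, z ∉ s →
      Real.log ‖((s.map fun w => X - C w).prod).eval z‖ ≤
        (s.map fun w => logKer R (z - w)).sum := by
    intro s
    induction s using Multiset.induction_on with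
    | empty => simp
    | cons a s ih =>
      intro h
      simp only [Multiset.mem_cons, not_or] at h
      rw [Multiset.map_cons, Multiset.map_cons, Multiset.sum_cons, Multiset.prod_cons, eval_mul,
        norm_mul, Real.log_mul]
      · have := log_norm_le_logKer (r := R) (sub_ne_zero.2 h.1)
        have := ih h.2
        simp only [eval_sub, eval_X, eval_C]
        linarith
      · simpa [sub_eq_zero] using h.1
      · exact norm_ne_zero_iff.2 (eval_multiset_prod_ne_zero h.2)
  have hr : z ∉ p.roots := fun h => hz (isRoot_of_mem_roots h)
  conv_lhs => rw [eq_C_mul_prod_roots p]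
  rw [eval_mul, eval_C, norm_mul, Real.log_mul]
  · linarith [key _ hr]
  · exact norm_ne_zero_iff.2 (leadingCoeff_ne_zero.2 hp)
  · exact norm_ne_zero_iff.2 (eval_multiset_prod_ne_zero hr)

/-! ### The zero distribution -/

lemma integral_sum_dirac (s : Multiset ℂ) (f : ℂ → ℝ) :
    Integrable f (s.map fun z => Measure.dirac z).sum ∧
      ∫ z, f z ∂(s.map fun z => Measure.dirac z).sum = (s.map f).sum := by
  induction s using Multiset.induction_on with
  | empty => simp
  | cons a s ih =>
    have ha : Integrable f (Measure.dirac a) := integrable_dirac (by simp)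
    rw [Multiset.map_cons, Multiset.sum_cons, Multiset.map_cons, Multiset.sum_cons]
    refine ⟨ha.add_measure ih.1, ?_⟩
    rw [integral_add_measure ha ih.1, ih.2, integral_dirac]

lemma integral_zeroDistribution (p : ℂ[X]) (f : ℂ → ℝ) :
    ∫ z, f z ∂(zeroDistribution p) = (p.natDegree : ℝ)⁻¹ * (p.roots.map f).sum := by
  unfold zeroDistribution
  rw [integral_smul_measure, (integral_sum_dirac _ _).2]
  simp

lemma isProbabilityMeasure_zeroDistribution {p : ℂ[X]} (hp : 0 < p.natDegree) :
    IsProbabilityMeasure (zeroDistribution p) := by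
  constructor
  have key : ∀ s : Multiset ℂ, (s.map fun z => Measure.dirac z).sum Set.univ = s.card := by
    intro s
    induction s using Multiset.induction_on with
    | empty => simp
    | cons a s ih =>
      rw [Multiset.map_cons, Multiset.sum_cons, Measure.add_apply, ih]
      simp [add_comm]
  unfold zeroDistribution
  rw [Measure.smul_apply, key, ← (IsAlgClosed.splits p).natDegree_eq_card_roots, smul_eq_mul]
  exact ENNReal.inv_mul_cancel (by exact_mod_cast hp.ne') (by simp)

lemma multiset_sum_le_card_mul (s : Multiset ℂ) {f : ℂ → ℝ} {c : ℝ} (h : ∀ w, f w ≤ c) :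
    (s.map f).sum ≤ s.card * c := by
  have := Multiset.sum_le_card_nsmul (s.map f) c (by simpa using fun w _ => h w)
  simpa using this

lemma card_mul_le_multiset_sum (s : Multiset ℂ) {f : ℂ → ℝ} {c : ℝ} (h : ∀ w, c ≤ f w) :
    s.card * c ≤ (s.map f).sum := by
  have := Multiset.card_nsmul_le_sum (s := s.map f) (a := c) (by simpa using fun w _ => h w)
  simpa using this

/-- Comparison with the unit circle eliminates the leading coefficient, on which no control is
assumed. -/
lemma circleAverage_log_norm_eval_sub {p : ℂ[X]} (hp : p ≠ 0) (z : ℂ) {R : ℝ} (hR : 0 < R) :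
    Real.circleAverage (fun ζ => Real.log ‖p.eval ζ‖) z R =
      Real.circleAverage (fun ζ => Real.log ‖p.eval ζ‖) 0 1 +
        (p.roots.map fun w => logKer R (z - w) - logKer 1 w).sum := by
  rw [circleAverage_log_norm_eval hp z hR, circleAverage_log_norm_eval hp 0 one_pos,
    Multiset.sum_map_sub]
  simp [logKer_neg]

/-- A continuous substitute for the indicator of the disc of radius `ρ`. -/
def discBump (ρ : ℝ) (w : ℂ) : ℝ := (logKer ρ w - logKer 1 w) / Real.log ρ

lemma discBump_nonneg {ρ : ℝ} (hρ : 1 < ρ) (w : ℂ) : 0 ≤ discBump ρ w :=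
  div_nonneg (sub_nonneg.2 (logKer_mono one_pos hρ.le w)) (Real.log_pos hρ).le

lemma discBump_le_indicator {ρ : ℝ} (hρ : 1 < ρ) (w : ℂ) :
    discBump ρ w ≤ ({w : ℂ | ρ < ‖w‖}ᶜ).indicator 1 w := by
  by_cases h : ρ < ‖w‖
  · rw [Set.indicator_of_notMem (by simpa using h), discBump, logKer_of_le h.le,
      logKer_of_le (hρ.trans h).le]
    simp
  · rw [Set.indicator_of_mem (by simpa using h), discBump, logKer_of_ge (not_lt.1 h),
      Pi.one_apply, div_le_one (Real.log_pos hρ), sub_le_self_iff]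
    exact Real.log_nonneg (le_max_left _ _)

lemma discBump_le_one {ρ : ℝ} (hρ : 1 < ρ) (w : ℂ) : discBump ρ w ≤ 1 :=
  (discBump_le_indicator hρ w).trans (Set.indicator_le_self' (by simp) w)

lemma continuous_discBump {ρ : ℝ} (hρ : 1 < ρ) : Continuous (discBump ρ) :=
  ((continuous_logKer (one_pos.trans hρ)).sub (continuous_logKer one_pos)).div_const _

lemma zeroDistribution_norm_gt_le {p : ℂ[X]} (hp : 0 < p.natDegree) {ρ : ℝ} (hρ : 1 < ρ) :
    zeroDistribution p {w | ρ < ‖w‖} ≤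
      ENNReal.ofReal (1 - (p.natDegree : ℝ)⁻¹ * (p.roots.map (discBump ρ)).sum) := by
  have := isProbabilityMeasure_zeroDistribution hp
  have hm : MeasurableSet {w : ℂ | ρ < ‖w‖} := measurableSet_lt measurable_const measurable_norm
  rw [← ENNReal.ofReal_toReal (measure_ne_top (zeroDistribution p) {w | ρ < ‖w‖})]
  refine ENNReal.ofReal_le_ofReal ?_
  rw [← integral_zeroDistribution]
  have h1 : ∫ w, discBump ρ w ∂(zeroDistribution p) ≤
      (zeroDistribution p).real {w | ρ < ‖w‖}ᶜ := by
    rw [← integral_indicator_one hm.compl]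
    refine integral_mono ?_ ((integrable_const 1).indicator hm.compl) (discBump_le_indicator hρ)
    refine Integrable.of_bound (continuous_discBump hρ).aestronglyMeasurable 1
      (ae_of_all _ fun w => ?_)
    rw [Real.norm_eq_abs, abs_of_nonneg (discBump_nonneg hρ w)]
    exact discBump_le_one hρ w
  have h2 := probReal_compl_eq_one_sub (μ := zeroDistribution p) hm
  change (zeroDistribution p).real _ ≤ _
  linarith

end
end HeatZeros

namespace HeatZeros
noncomputable section

/-! ### Limits of zero distributions from limits of logarithmic potentials -/

lemma tendsto_circleAverage_radius_zero {U : ℂ → ℝ} (hU : Continuous U) (z : ℂ) :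
    Tendsto (fun k : ℕ => Real.circleAverage U z (1 / ((k : ℝ) + 1))) atTop (𝓝 (U z)) := by
  have h := (Real.Continuous.circleAverage (c := z) hU).tendsto 0
  rw [Real.circleAverage_zero] at h
  exact h.comp tendsto_one_div_add_atTop_nhds_zero_nat

/-- The bounded continuous function `w ↦ logKer r (z - w) - logKer 1 w`. -/
def kerBCF {r : ℝ} (hr : 0 < r) (z : ℂ) : ℂ →ᵇ ℝ :=
  BoundedContinuousFunction.ofNormedAddCommGroup (fun w => logKer r (z - w) - logKer 1 w)
    (continuous_ker_right hr z) (kerBound r ‖z‖)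
    fun w => abs_logKer_sub_logKer_one_le hr le_rfl w

/-- Growth of `U` prevents zeros from escaping. Passing from the unit circle to a circle of radius
`ρ` raises the average by about `log ρ` times the number of zeros in the disc of radius `ρ`. The
hypotheses force a rise of at least `N (log ρ - O(1))`, so all but a fraction `O(1 / log ρ)` of the
`N` possible zeros lie in the disc. -/
lemma eventually_le_sum_discBump {U : ℂ → ℝ} {S : Set ℂ}
    {q : ℕ → ℂ[X]} {N : ℕ → ℕ} (hN : Tendsto N atTop atTop) (hdeg : ∀ m, (q m).natDegree ≤ N m)
    (low : ∀ z ∈ S, ∀ R : ℝ, 0 < R → ∀ ε : ℝ, 0 < ε → ∀ᶠ m in atTop, q m ≠ 0 ∧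
      N m * (U z - ε) ≤ Real.circleAverage (fun ζ => Real.log ‖(q m).eval ζ‖) z R)
    (up : ∀ z : ℂ, ∀ R : ℝ, 0 < R → ∀ ε : ℝ, 0 < ε → ∀ᶠ m in atTop,
      Real.circleAverage (fun ζ => Real.log ‖(q m).eval ζ‖) z R ≤
        N m * (Real.circleAverage U z R + ε))
    (grow : ∃ C : ℝ, ∀ ρ : ℝ, 1 < ρ → ∃ z ∈ S, ‖z‖ ≤ ρ ∧ Real.log ρ - C ≤ U z) :
    ∃ C : ℝ, ∀ ρ : ℝ, 1 < ρ → ∀ᶠ m in atTop,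
      1 - C / Real.log ρ ≤ ((q m).roots.map (discBump ρ)).sum / N m := by
  obtain ⟨C, hC⟩ := grow
  -- `C` comes from the growth of `U`, the first `1` from the lower bound at `z`, `log 2` from
  -- replacing `logKer ρ (z - w)` by `logKer ρ w`, and the bracket from the upper bound on the unit
  -- circle.
  refine ⟨C + 1 + Real.log 2 + (Real.circleAverage U 0 1 + 1), fun ρ hρ => ?_⟩
  obtain ⟨z, hzS, hzρ, hzU⟩ := hC ρ hρ
  have hρ0 : 0 < ρ := one_pos.trans hρ
  filter_upwards [low z hzS ρ hρ0 1 one_pos, up 0 1 one_pos 1 one_pos, hN.eventually_gt_atTop 0]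
    with m ⟨hq, h1⟩ h2 hNm
  have hN0 : (0 : ℝ) < N m := by exact_mod_cast hNm
  rw [circleAverage_log_norm_eval_sub hq z hρ0] at h1
  have hker : ∀ w : ℂ, logKer ρ (z - w) - logKer 1 w - Real.log ρ * discBump ρ w ≤ Real.log 2 := by
    intro w
    rw [discBump, mul_div_cancel₀ _ (Real.log_pos hρ).ne']
    have : logKer ρ (z - w) ≤ Real.log 2 + logKer ρ w := by
      unfold logKer
      rw [← Real.log_mul two_ne_zero (lt_max_of_lt_left hρ0).ne']
      refine Real.log_le_log (lt_max_of_lt_left hρ0) (max_le ?_ ?_)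
      · linarith [le_max_left ρ ‖w‖]
      · linarith [norm_sub_le z w, le_max_left ρ ‖w‖, le_max_right ρ ‖w‖]
    linarith
  have hs := multiset_sum_le_card_mul (q m).roots hker
  rw [Multiset.sum_map_sub, Multiset.sum_map_mul_left] at hs
  have hcard : ((q m).roots.card : ℝ) ≤ N m := by
    exact_mod_cast (card_roots' (q m)).trans (hdeg m)
  have hl2 : 0 ≤ Real.log 2 := Real.log_nonneg one_le_two
  have hlρ := Real.log_pos hρ
  have hs' : ((q m).roots.card : ℝ) * Real.log 2 ≤ N m * Real.log 2 := by gcongr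
  have hU' : N m * (Real.log ρ - C - 1) ≤ N m * (U z - 1) := by gcongr
  have e : (1 - (C + 1 + Real.log 2 + (Real.circleAverage U 0 1 + 1)) / Real.log ρ) =
      (Real.log ρ - (C + 1 + Real.log 2 + (Real.circleAverage U 0 1 + 1))) / Real.log ρ := by
    field_simp
  rw [e, div_le_div_iff₀ hlρ hN0]
  nlinarith

/-- The degree may be smaller than `N`, but it is at least the sum of the values of `discBump` at
the roots. Letting `ρ` grow shows that the loss is `o(N)`. -/
lemma tendsto_natDegree_div {q : ℕ → ℂ[X]} {N : ℕ → ℕ} (hN : Tendsto N atTop atTop)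
    (hdeg : ∀ m, (q m).natDegree ≤ N m)
    (hbump : ∃ C : ℝ, ∀ ρ : ℝ, 1 < ρ → ∀ᶠ m in atTop,
      1 - C / Real.log ρ ≤ ((q m).roots.map (discBump ρ)).sum / N m) :
    Tendsto (fun m => ((q m).natDegree : ℝ) / N m) atTop (𝓝 1) := by
  obtain ⟨C, hC⟩ := hbump
  rw [tendsto_order]
  constructor
  · intro a ha
    have hlim : Tendsto (fun ρ : ℝ => 1 - C / Real.log ρ) atTop (𝓝 (1 - 0)) :=
      (tendsto_const_nhds.div_atTop Real.tendsto_log_atTop).const_sub 1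
    rw [sub_zero] at hlim
    obtain ⟨ρ, h1, h2⟩ := ((hlim.eventually_const_lt ha).and (eventually_gt_atTop 1)).exists
    filter_upwards [hC ρ h2, hN.eventually_gt_atTop 0] with m h3 hNm
    have hN0 : (0 : ℝ) < N m := by exact_mod_cast hNm
    refine h1.trans_le (h3.trans ?_)
    gcongr
    have := multiset_sum_le_card_mul (q m).roots (discBump_le_one h2)
    rw [← (IsAlgClosed.splits (q m)).natDegree_eq_card_roots] at this
    linarith
  · intro a ha
    filter_upwards with m
    refine lt_of_le_of_lt (div_le_one_of_le₀ ?_ (Nat.cast_nonneg _)) ha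
    exact_mod_cast hdeg m

/-- Prokhorov's theorem. An ultrafilter replaces the extraction of subsequences, so several limits
can be taken along it at once. -/
lemma exists_ultrafilter_limit {q : ℕ → ℂ[X]} {N : ℕ → ℕ} (hN : Tendsto N atTop atTop)
    (hdeg : ∀ m, (q m).natDegree ≤ N m)
    (hbump : ∃ C : ℝ, ∀ ρ : ℝ, 1 < ρ → ∀ᶠ m in atTop,
      1 - C / Real.log ρ ≤ ((q m).roots.map (discBump ρ)).sum / N m)
    (F : Ultrafilter ℕ) (hF : (F : Filter ℕ) ≤ atTop) :
    ∃ ν : ProbabilityMeasure ℂ, ∀ f : ℂ →ᵇ ℝ,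
      Tendsto (fun m => ∫ z, f z ∂(zeroDistribution (q m))) F (𝓝 (∫ z, f z ∂(ν : Measure ℂ))) := by
  classical
  have hratio := tendsto_natDegree_div hN hdeg hbump
  have hpos : ∀ᶠ m in atTop, 0 < (q m).natDegree := by
    filter_upwards [hratio.eventually_const_lt one_pos] with m hm
    by_contra h
    simp [Nat.eq_zero_of_not_pos h] at hm
  -- Constant polynomials have no probability measure of zeros; the Dirac mass is a filler, used
  -- only at indices that are eventually avoided.
  let μ : ℕ → ProbabilityMeasure ℂ := fun m =>
    if h : 0 < (q m).natDegree then ⟨zeroDistribution (q m), isProbabilityMeasure_zeroDistribution h⟩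
    else ⟨Measure.dirac 0, inferInstance⟩
  have hμ : ∀ m, 0 < (q m).natDegree → (μ m : Measure ℂ) = zeroDistribution (q m) := by
    intro m h
    simp [μ, h]
  obtain ⟨C, hC⟩ := hbump
  have htight : IsTightMeasureSet (Set.range fun m => (μ m : Measure ℂ)) := by
    refine isTightMeasureSet_range_of_tendsto_limsup_measure_norm_gt ?_
    have hlim : Tendsto (fun ρ : ℝ => ENNReal.ofReal (C / Real.log ρ)) atTop (𝓝 0) := by
      rw [← ENNReal.ofReal_zero]
      exact ENNReal.tendsto_ofReal (tendsto_const_nhds.div_atTop Real.tendsto_log_atTop)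
    refine tendsto_of_tendsto_of_tendsto_of_le_of_le' tendsto_const_nhds hlim
      (Eventually.of_forall fun _ => zero_le) ?_
    filter_upwards [eventually_gt_atTop 1] with ρ hρ
    refine limsup_le_of_le (by isBoundedDefault) ?_
    filter_upwards [hC ρ hρ, hpos, hN.eventually_gt_atTop 0] with m h1 h2 hNm
    rw [hμ m h2]
    refine (zeroDistribution_norm_gt_le h2 hρ).trans (ENNReal.ofReal_le_ofReal ?_)
    have hd : (0 : ℝ) < (q m).natDegree := by exact_mod_cast h2
    have hdN : ((q m).natDegree : ℝ) ≤ N m := by exact_mod_cast hdeg m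
    have hs0 : 0 ≤ ((q m).roots.map (discBump ρ)).sum := by
      have := card_mul_le_multiset_sum (q m).roots (discBump_nonneg hρ)
      simpa using this
    have : ((q m).roots.map (discBump ρ)).sum / N m ≤
        ((q m).roots.map (discBump ρ)).sum / (q m).natDegree := by gcongr
    rw [inv_mul_eq_div]
    linarith
  have hcomp : IsCompact (closure (Set.range μ)) := by
    refine isCompact_closure_of_isTightMeasureSet ?_
    convert htight using 1
    ext ν
    simp
  obtain ⟨ν, -, hν⟩ := hcomp.ultrafilter_le_nhds (F.map μ) (by
    rw [le_principal_iff]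
    exact Filter.mem_of_superset (Filter.range_mem_map) subset_closure)
  refine ⟨ν, fun f => ?_⟩
  have ht : Tendsto μ F (𝓝 ν) := hν
  refine ((ProbabilityMeasure.tendsto_iff_forall_integral_tendsto.1 ht) f).congr' ?_
  filter_upwards [hF hpos] with m hm
  rw [hμ m hm]

/-- The deterministic core. Normalised circle averages converge along the ultrafilter to `L +
truncPotential ν R z`. The hypotheses place this limit between `U z` and the circle average of `U`,
and both ends meet as `R` tends to `0`. Pointwise lower bounds on a dense set and upper bounds in
circle mean are enough. -/
theorem exists_limit_isRieszMeasure {U : ℂ → ℝ} (hU : Continuous U) {S : Set ℂ} (hS : Dense S)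
    {q : ℕ → ℂ[X]} {N : ℕ → ℕ} (hN : Tendsto N atTop atTop) (hdeg : ∀ m, (q m).natDegree ≤ N m)
    (low : ∀ z ∈ S, ∀ ε : ℝ, 0 < ε → ∀ᶠ m in atTop,
      Real.exp (N m * (U z - ε)) ≤ ‖(q m).eval z‖)
    (up : ∀ z : ℂ, ∀ R : ℝ, 0 < R → ∀ ε : ℝ, 0 < ε → ∀ᶠ m in atTop,
      Real.circleAverage (fun ζ => Real.log ‖(q m).eval ζ‖) z R ≤
        N m * (Real.circleAverage U z R + ε))
    (grow : ∃ C : ℝ, ∀ ρ : ℝ, 1 < ρ → ∃ z ∈ S, ‖z‖ ≤ ρ ∧ Real.log ρ - C ≤ U z)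
    (F : Ultrafilter ℕ) (hF : (F : Filter ℕ) ≤ atTop) :
    ∃ ν : ProbabilityMeasure ℂ, (∃ L : ℝ, IsRieszMeasure U (ν : Measure ℂ) L) ∧ ∀ f : ℂ →ᵇ ℝ,
      Tendsto (fun m => ∫ z, f z ∂(zeroDistribution (q m))) F
        (𝓝 (∫ z, f z ∂(ν : Measure ℂ))) := by
  have low' : ∀ z ∈ S, ∀ R : ℝ, 0 < R → ∀ ε : ℝ, 0 < ε → ∀ᶠ m in atTop, q m ≠ 0 ∧
      N m * (U z - ε) ≤ Real.circleAverage (fun ζ => Real.log ‖(q m).eval ζ‖) z R := by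
    intro z hz R hR ε hε
    filter_upwards [low z hz ε hε] with m hm
    have h0 : 0 < ‖(q m).eval z‖ := (Real.exp_pos _).trans_le hm
    refine ⟨fun h => by simp [h] at h0, ?_⟩
    refine le_trans ?_ (log_norm_eval_le_circleAverage (q m) (norm_pos_iff.1 h0) hR)
    exact (Real.le_log_iff_exp_le h0).2 hm
  have hbump := eventually_le_sum_discBump hN hdeg low' up grow
  have hratio := tendsto_natDegree_div hN hdeg hbump
  obtain ⟨ν, hν⟩ := exists_ultrafilter_limit hN hdeg hbump F hF
  have hpos : ∀ᶠ m in atTop, (0 : ℝ) < (q m).natDegree ∧ (0 : ℝ) < N m ∧ q m ≠ 0 := by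
    filter_upwards [hratio.eventually_const_lt one_pos, hN.eventually_gt_atTop 0] with m hm h2
    have h1 : 0 < (q m).natDegree := by
      by_contra h
      simp [Nat.eq_zero_of_not_pos h] at hm
    refine ⟨by exact_mod_cast h1, by exact_mod_cast h2, ?_⟩
    intro h
    simp [h] at h1
  have hsum : ∀ f : ℂ →ᵇ ℝ, Tendsto (fun m => ((q m).roots.map f).sum / N m) F
      (𝓝 (∫ z, f z ∂(ν : Measure ℂ))) := by
    intro f
    have h := (hratio.mono_left hF).mul (hν f)
    rw [one_mul] at h
    refine h.congr' ?_
    filter_upwards [hF hpos] with m ⟨h1, h2, _⟩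
    rw [integral_zeroDistribution]
    field_simp
  set A : ℕ → ℝ → ℂ → ℝ := fun m R z =>
    Real.circleAverage (fun ζ => Real.log ‖(q m).eval ζ‖) z R / N m with hA
  have hAlow : ∀ z ∈ S, ∀ R : ℝ, 0 < R → ∀ ε : ℝ, 0 < ε → ∀ᶠ m in atTop, U z - ε ≤ A m R z := by
    intro z hz R hR ε hε
    filter_upwards [low' z hz R hR ε hε, hpos] with m h1 ⟨_, h2, _⟩
    rw [hA, le_div_iff₀' h2]
    exact h1.2
  have hAup : ∀ z : ℂ, ∀ R : ℝ, 0 < R → ∀ ε : ℝ, 0 < ε → ∀ᶠ m in atTop,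
      A m R z ≤ Real.circleAverage U z R + ε := by
    intro z R hR ε hε
    filter_upwards [up z R hR ε hε, hpos] with m h1 ⟨_, h2, _⟩
    rw [hA, div_le_iff₀' h2]
    exact h1
  have hAeq : ∀ z : ℂ, ∀ R : ℝ, ∀ hR : 0 < R, ∀ᶠ m in atTop,
      A m R z = A m 1 0 + ((q m).roots.map (kerBCF hR z)).sum / N m := by
    intro z R hR
    filter_upwards [hpos] with m ⟨_, _, h3⟩
    rw [hA]
    simp only
    rw [circleAverage_log_norm_eval_sub h3 z hR, add_div]
    rfl
  -- The averages over the unit circle are bounded above by `up`. They are bounded below by `low` at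
  -- a single point `z₀` of `S`, corrected by the convergent kernel sum, hence they have a limit.
  obtain ⟨L, hL⟩ : ∃ L, Tendsto (fun m => A m 1 0) F (𝓝 L) := by
    obtain ⟨z₀, hz₀⟩ := hS.nonempty
    have hc := hsum (kerBCF one_pos z₀)
    have hb : ∀ᶠ m in (F : Filter ℕ), A m 1 0 ∈ Set.Icc
        (U z₀ - 1 - (∫ z, (kerBCF one_pos z₀) z ∂(ν : Measure ℂ) + 1))
        (Real.circleAverage U 0 1 + 1) := by
      filter_upwards [hF (hAlow z₀ hz₀ 1 one_pos 1 one_pos), hF (hAup 0 1 one_pos 1 one_pos),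
        hF (hAeq z₀ 1 one_pos), hc.eventually_lt_const (lt_add_one _)] with m h1 h2 h3 h4
      exact ⟨by linarith, h2⟩
    obtain ⟨L, -, hL⟩ := isCompact_Icc.ultrafilter_le_nhds (F.map fun m => A m 1 0)
      (le_principal_iff.2 hb)
    exact ⟨L, hL⟩
  have hAlim : ∀ z : ℂ, ∀ R : ℝ, 0 < R →
      Tendsto (fun m => A m R z) F (𝓝 (L + truncPotential ν R z)) := by
    intro z R hR
    refine (hL.add (hsum (kerBCF hR z))).congr' ?_
    filter_upwards [hF (hAeq z R hR)] with m hm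
    exact hm.symm
  refine ⟨ν, ⟨L, isRieszMeasure_of_tendsto hU fun z => ?_⟩, hν⟩
  -- The inequality is known on `S` and extends by density, as both sides are continuous in `z` for
  -- fixed `R`.
  have hge : ∀ R : ℝ, 0 < R → ∀ z, U z ≤ L + truncPotential ν R z := by
    intro R hR
    have hcl : IsClosed {z | U z ≤ L + truncPotential ν R z} :=
      isClosed_le hU (continuous_const.add (continuous_truncPotential _ hR))
    have hsub : S ⊆ {z | U z ≤ L + truncPotential ν R z} := by
      intro z hz
      rw [Set.mem_ofPred_eq]
      refine le_of_forall_pos_sub_le fun ε hε => ?_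
      exact ge_of_tendsto (hAlim z R hR) (hF (hAlow z hz R hR ε hε))
    intro z
    have := hcl.closure_subset_iff.2 hsub
    rw [hS.closure_eq] at this
    exact this (Set.mem_univ z)
  have hle : ∀ R : ℝ, 0 < R → L + truncPotential ν R z ≤ Real.circleAverage U z R := by
    intro R hR
    refine le_of_forall_pos_le_add fun ε hε => ?_
    exact le_of_tendsto (hAlim z R hR) (hF (hAup z R hR ε hε))
  refine tendsto_of_tendsto_of_tendsto_of_le_of_le tendsto_const_nhds
    (tendsto_circleAverage_radius_zero hU z) (fun k => ?_) (fun k => ?_)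
  · exact hge _ (by positivity) z
  · exact hle _ (by positivity)

end
end HeatZeros

namespace HeatZeros
noncomputable section

/-! ### Hermite polynomials and the heat flow -/

/-- The monic Hermite polynomials of variance `s`, `exp(-(s/2) ∂²) X^k`. -/
def hermitePoly (s : ℂ) : ℕ → ℂ[X]
  | 0 => 1
  | 1 => X
  | k + 2 => X * hermitePoly s (k + 1) - C (s * (k + 1)) * hermitePoly s k

/-- Partial sums of the series for `exp(-(s/2) ∂²)`. -/
def heatSum (s : ℂ) (M : ℕ) (p : ℂ[X]) : ℂ[X] :=
  ∑ j ∈ Finset.range M, C ((1 / (j.factorial : ℂ)) * (-s / 2) ^ j) * derivative^[2 * j] p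

/-- The cutoff in `heatFlow` depends on the degree, which hides linearity. A common cutoff `M`
restores it. -/
lemma heatFlow_eq_heatSum (s : ℂ) {p : ℂ[X]} {M : ℕ} (h : p.natDegree < M) :
    heatFlow s p = heatSum s M p := by
  unfold heatFlow heatSum
  refine Finset.sum_subset (Finset.range_subset_range.2 h) fun j _ hj => ?_
  rw [Finset.mem_range, not_lt] at hj
  rw [iterate_derivative_eq_zero (by omega), mul_zero]

lemma iterate_derivative_X_mul' (p : ℂ[X]) (k : ℕ) :
    derivative^[k] (X * p) = X * derivative^[k] p + (k : ℂ[X]) * derivative^[k - 1] p := by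
  induction k with
  | zero => simp
  | succ k ih =>
    rw [Function.iterate_succ_apply', ih, derivative_add, derivative_mul, derivative_X,
      derivative_natCast_mul]
    rcases k with _ | k
    · simp; ring
    · rw [Nat.add_sub_cancel, Nat.add_sub_cancel, ← Function.iterate_succ_apply' derivative,
        ← Function.iterate_succ_apply' derivative]
      push_cast
      ring

/-- The commutation relation `exp(-(s/2)∂²) X = (X - s∂) exp(-(s/2)∂²)`. The shift `j ↦ j + 1` in
the commutator term lowers the cutoff by one. -/
lemma heatSum_X_mul (s : ℂ) (M : ℕ) (p : ℂ[X]) :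
    heatSum s (M + 1) (X * p) = X * heatSum s (M + 1) p - C s * heatSum s M (derivative p) := by
  unfold heatSum
  have h : ∀ j ∈ Finset.range (M + 1),
      C ((1 / (j.factorial : ℂ)) * (-s / 2) ^ j) * derivative^[2 * j] (X * p) =
        X * (C ((1 / (j.factorial : ℂ)) * (-s / 2) ^ j) * derivative^[2 * j] p) +
        C ((1 / (j.factorial : ℂ)) * (-s / 2) ^ j * (2 * j : ℕ)) *
          derivative^[2 * j - 1] p := by
    intro j _
    rw [iterate_derivative_X_mul']
    simp only [map_mul, map_natCast]
    ring
  rw [Finset.sum_congr rfl h, Finset.sum_add_distrib, ← Finset.mul_sum, sub_eq_add_neg]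
  congr 1
  rw [Finset.sum_range_succ', Finset.mul_sum, ← Finset.sum_neg_distrib]
  simp only [mul_zero, Nat.cast_zero, map_zero, zero_mul, add_zero]
  refine Finset.sum_congr rfl fun j _ => ?_
  have e : 2 * (j + 1) - 1 = (2 * j) + 1 := by omega
  rw [e, Function.iterate_succ_apply, ← mul_assoc, ← neg_mul, ← C_mul, ← C_neg]
  congr 2
  rw [Nat.factorial_succ]
  have : (j.factorial : ℂ) ≠ 0 := by exact_mod_cast j.factorial_ne_zero
  have : ((j : ℂ) + 1) ≠ 0 := by exact_mod_cast j.succ_ne_zero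
  push_cast
  field_simp
  ring

/-- Since `∂ X^(k+1) = (k+1) X^k`, the commutation relation becomes the three-term recurrence of the
Hermite polynomials. -/
lemma heatSum_X_pow (s : ℂ) : ∀ k M : ℕ, k < M → heatSum s M (X ^ k) = hermitePoly s k := by
  intro k
  induction k using Nat.strong_induction_on with
  | _ k ih =>
    intro M hM
    match k, ih, hM with
    | 0, _, hM =>
      rw [← heatFlow_eq_heatSum s (by simpa using hM)]
      simp [heatFlow, hermitePoly]
    | 1, _, hM =>
      rw [← heatFlow_eq_heatSum s (by simpa using hM)]
      simp [heatFlow, hermitePoly, Finset.sum_range_succ]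
    | k + 2, ih, hM =>
      obtain ⟨M, rfl⟩ : ∃ M', M = M' + 1 := ⟨M - 1, by omega⟩
      rw [pow_succ' X (k + 1), heatSum_X_mul, ih (k + 1) (by omega) (M + 1) (by omega)]
      have h := ih k (by omega) M (by omega)
      have e : heatSum s M (derivative (X ^ (k + 1))) =
          C ((k : ℂ) + 1) * heatSum s M (X ^ k) := by
        rw [derivative_X_pow, Nat.add_sub_cancel]
        unfold heatSum
        rw [Finset.mul_sum]
        refine Finset.sum_congr rfl fun j _ => ?_
        rw [iterate_derivative_C_mul]
        push_cast
        ring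
      rw [e, h, hermitePoly, C_mul]
      ring

lemma heatSum_sum (s : ℂ) (M n : ℕ) (c : ℕ → ℂ) :
    heatSum s M (∑ k ∈ Finset.range n, C (c k) * X ^ k) =
      ∑ k ∈ Finset.range n, C (c k) * heatSum s M (X ^ k) := by
  unfold heatSum
  simp_rw [Finset.mul_sum]
  rw [Finset.sum_comm]
  refine Finset.sum_congr rfl fun j _ => ?_
  rw [iterate_derivative_sum, Finset.mul_sum]
  refine Finset.sum_congr rfl fun k _ => ?_
  rw [iterate_derivative_C_mul]
  ring

lemma natDegree_sum_C_mul_X_pow_le (n : ℕ) (c : ℕ → ℂ) :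
    (∑ k ∈ Finset.range (n + 1), C (c k) * X ^ k).natDegree ≤ n :=
  natDegree_sum_le_of_forall_le _ _ fun k hk =>
    (natDegree_C_mul_X_pow_le _ _).trans (Nat.lt_succ_iff.1 (Finset.mem_range.1 hk))

lemma heatFlow_sum (s : ℂ) (n : ℕ) (c : ℕ → ℂ) :
    heatFlow s (∑ k ∈ Finset.range (n + 1), C (c k) * X ^ k) =
      ∑ k ∈ Finset.range (n + 1), C (c k) * hermitePoly s k := by
  rw [heatFlow_eq_heatSum s (Nat.lt_succ_of_le (natDegree_sum_C_mul_X_pow_le n c)), heatSum_sum]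
  exact Finset.sum_congr rfl fun k hk => by rw [heatSum_X_pow s k _ (Finset.mem_range.1 hk)]

lemma natDegree_heatFlow_le (s : ℂ) (p : ℂ[X]) : (heatFlow s p).natDegree ≤ p.natDegree := by
  unfold heatFlow
  refine natDegree_sum_le_of_forall_le _ _ fun j _ => ?_
  refine (natDegree_C_mul_le _ _).trans ?_
  exact (natDegree_iterate_derivative _ _).trans (Nat.sub_le _ _)

lemma hermitePoly_eval_neg (s z : ℂ) (k : ℕ) :
    (hermitePoly s k).eval (-z) = (-1) ^ k * (hermitePoly s k).eval z := by
  induction k using Nat.twoStepInduction with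
  | zero => simp [hermitePoly]
  | one => simp [hermitePoly]
  | more k ih1 ih2 =>
    simp only [hermitePoly, eval_sub, eval_mul, eval_X, eval_C, ih1, ih2]
    ring

/-- A crude bound that also holds on the real axis, where the sharp asymptotics are not available.
It only serves to dominate circle averages. -/
lemma norm_hermitePoly_eval_le {s t : ℝ} (hs : 0 ≤ s) (z : ℂ) (n : ℕ)
    (hst : s * n ≤ t) : ∀ k ≤ n, ‖(hermitePoly s k).eval z‖ ≤ (‖z‖ + t + 1) ^ k := by
  have ht0 : 0 ≤ t := le_trans (by positivity) hst
  intro k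
  induction k using Nat.twoStepInduction with
  | zero => simp [hermitePoly]
  | one =>
    intro _
    simp only [hermitePoly, eval_X, pow_one]
    linarith
  | more k ih1 ih2 =>
    intro hk
    have h1 := ih1 (by omega)
    have h2 := ih2 (by omega)
    have hk' : s * ((k : ℝ) + 1) ≤ t := by
      refine le_trans ?_ hst
      gcongr
      exact_mod_cast (by omega : k + 1 ≤ n)
    simp only [hermitePoly, eval_sub, eval_mul, eval_X, eval_C]
    refine (norm_sub_le _ _).trans ?_
    rw [norm_mul, norm_mul]
    have e : ‖(s : ℂ) * ((k : ℂ) + 1)‖ = s * (k + 1) := by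
      rw [show (s : ℂ) * ((k : ℂ) + 1) = ((s * (k + 1) : ℝ) : ℂ) by push_cast; ring,
        Complex.norm_real, Real.norm_of_nonneg (by positivity)]
    rw [e]
    set B := ‖z‖ + t + 1 with hB
    have hB1 : 1 ≤ B := by linarith [norm_nonneg z]
    calc ‖z‖ * ‖(hermitePoly s (k + 1)).eval z‖ + s * (k + 1) * ‖(hermitePoly s k).eval z‖
        ≤ ‖z‖ * B ^ (k + 1) + t * B ^ k := by gcongr
      _ ≤ B ^ (k + 2) := by
          have : 0 ≤ B ^ k := by positivity
          have e2 : B ^ (k + 2) - (‖z‖ * B ^ (k + 1) + t * B ^ k) =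
              B ^ k * (t * (B - 1) + B) := by rw [hB]; ring
          have : 0 ≤ B ^ k * (t * (B - 1) + B) := by
            have : 0 ≤ t * (B - 1) := mul_nonneg ht0 (by linarith)
            positivity
          linarith

end
end HeatZeros

namespace HeatZeros
noncomputable section

/-! ### The Joukowsky-type radius -/

/-- The modulus of the larger root of `r² - z r + c = 0`, for `c ≥ 0`. -/
def jouk (c : ℝ) (z : ℂ) : ℝ :=
  ((‖z - 2 * √c‖ + ‖z + 2 * √c‖) / 2 +
    √(((‖z - 2 * √c‖ + ‖z + 2 * √c‖) / 2) ^ 2 - 4 * c)) / 2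

/-- With `z = r + c / r` one has `z ∓ 2√c = (r ∓ √c)² / r`, and the parallelogram law gives `|r| + c
/ |r|` for half the sum of the distances to the foci `±2√c`. Solving for `|r|` yields the formula in
`jouk`, which is jointly continuous in `(c, z)` and requires no choice of branch. -/
lemma jouk_eq_norm {c : ℝ} (hc : 0 ≤ c) {r : ℂ} (hr : r ≠ 0) (h : c ≤ ‖r‖ ^ 2) :
    jouk c (r + c / r) = ‖r‖ := by
  have hsq : ((√c : ℝ) : ℂ) ^ 2 = c := by rw [← Complex.ofReal_pow, Real.sq_sqrt hc]
  have hn : 0 < ‖r‖ := norm_pos_iff.2 hr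
  have e1 : r + c / r - 2 * √c = (r - √c) ^ 2 / r := by
    rw [← hsq]; field_simp; ring
  have e2 : r + c / r + 2 * √c = (r + √c) ^ 2 / r := by
    rw [← hsq]; field_simp; ring
  have hpar : ‖r - √c‖ ^ 2 + ‖r + √c‖ ^ 2 = 2 * (‖r‖ ^ 2 + c) := by
    have := parallelogram_law_with_norm ℝ r (√c : ℂ)
    have hs : ‖((√c : ℝ) : ℂ)‖ * ‖((√c : ℝ) : ℂ)‖ = c := by
      rw [Complex.norm_real, Real.norm_of_nonneg (Real.sqrt_nonneg _), Real.mul_self_sqrt hc]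
    nlinarith
  have ea : (‖r + c / r - 2 * √c‖ + ‖r + c / r + 2 * √c‖) / 2 = ‖r‖ + c / ‖r‖ := by
    rw [e1, e2, norm_div, norm_div, norm_pow, norm_pow, ← add_div, hpar]
    field_simp
  have hd : 0 ≤ ‖r‖ - c / ‖r‖ := by
    rw [sub_nonneg, div_le_iff₀ hn]
    nlinarith
  unfold jouk
  rw [ea]
  have e3 : (‖r‖ + c / ‖r‖) ^ 2 - 4 * c = (‖r‖ - c / ‖r‖) ^ 2 := by
    field_simp; ring
  rw [e3, Real.sqrt_sq hd]
  ring

lemma exists_jouk_root {c : ℝ} (hc : 0 < c) (z : ℂ) :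
    ∃ r : ℂ, r ≠ 0 ∧ c ≤ ‖r‖ ^ 2 ∧ z = r + c / r := by
  obtain ⟨w, hw⟩ := IsAlgClosed.exists_pow_nat_eq (z ^ 2 - 4 * c) two_pos
  have hprod : ((z + w) / 2) * ((z - w) / 2) = c := by
    linear_combination (-1 / 4 : ℂ) * hw
  have hc' : (c : ℂ) ≠ 0 := by exact_mod_cast hc.ne'
  have key : ∀ r r' : ℂ, r * r' = c → r + r' = z → ‖r'‖ ≤ ‖r‖ →
      r ≠ 0 ∧ c ≤ ‖r‖ ^ 2 ∧ z = r + c / r := by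
    intro r r' h1 h2 h3
    have hr : r ≠ 0 := by rintro rfl; simp at h1; exact hc' h1.symm
    refine ⟨hr, ?_, ?_⟩
    · have : c = ‖r‖ * ‖r'‖ := by
        rw [← norm_mul, h1, Complex.norm_real, Real.norm_of_nonneg hc.le]
      rw [this, sq]
      gcongr
    · rw [← h1, mul_div_cancel_left₀ _ hr, h2]
  rcases le_total ‖(z - w) / 2‖ ‖(z + w) / 2‖ with h | h
  · exact ⟨_, key _ _ hprod (by ring) h⟩
  · exact ⟨_, key _ _ (by rw [mul_comm]; exact hprod) (by ring) h⟩

lemma jouk_semiaxis (c : ℝ) (z : ℂ) : ‖z‖ ≤ (‖z - 2 * √c‖ + ‖z + 2 * √c‖) / 2 := by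
  have := norm_add_le (z - 2 * √c) (z + 2 * √c)
  rw [show z - 2 * √c + (z + 2 * √c) = 2 * z by ring, norm_mul] at this
  simp at this
  linarith

lemma half_norm_le_jouk (c : ℝ) (z : ℂ) : ‖z‖ / 2 ≤ jouk c z := by
  unfold jouk
  have := jouk_semiaxis c z
  have := Real.sqrt_nonneg (((‖z - 2 * √c‖ + ‖z + 2 * √c‖) / 2) ^ 2 - 4 * c)
  linarith

lemma sqrt_le_jouk {c : ℝ} (z : ℂ) : √c ≤ jouk c z := by
  unfold jouk
  have h : 2 * √c ≤ (‖z - 2 * √c‖ + ‖z + 2 * √c‖) / 2 := by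
    have := norm_sub_le (z + 2 * √c) (z - 2 * √c)
    rw [show z + 2 * √c - (z - 2 * √c) = ((4 * √c : ℝ) : ℂ) by push_cast; ring,
      Complex.norm_real, Real.norm_of_nonneg (by positivity)] at this
    linarith
  have := Real.sqrt_nonneg (((‖z - 2 * √c‖ + ‖z + 2 * √c‖) / 2) ^ 2 - 4 * c)
  linarith

lemma jouk_le {c : ℝ} (hc : 0 ≤ c) (z : ℂ) : jouk c z ≤ ‖z‖ + 2 * √c := by
  unfold jouk
  have hs : ‖(2 * √c : ℂ)‖ = 2 * √c := by
    rw [show (2 * √c : ℂ) = ((2 * √c : ℝ) : ℂ) by push_cast; ring,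
      Complex.norm_real, Real.norm_of_nonneg (by positivity)]
  have h1 := norm_sub_le z (2 * √c)
  have h2 := norm_add_le z (2 * √c)
  rw [hs] at h1 h2
  set a := (‖z - 2 * √c‖ + ‖z + 2 * √c‖) / 2 with ha
  have ha0 : 0 ≤ a := by positivity
  have : √(a ^ 2 - 4 * c) ≤ a := by
    rw [Real.sqrt_le_left ha0]
    linarith
  linarith

lemma jouk_zero {c : ℝ} (hc : 0 ≤ c) : jouk c 0 = √c := by
  unfold jouk
  have hs : ‖(2 * √c : ℂ)‖ = 2 * √c := by
    rw [show (2 * √c : ℂ) = ((2 * √c : ℝ) : ℂ) by push_cast; ring,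
      Complex.norm_real, Real.norm_of_nonneg (by positivity)]
  rw [zero_sub, zero_add, norm_neg, hs]
  have : ((2 * √c + 2 * √c) / 2) ^ 2 - 4 * c = 0 := by
    have := Real.sq_sqrt hc
    nlinarith
  rw [this]
  simp

lemma jouk_neg (c : ℝ) (z : ℂ) : jouk c (-z) = jouk c z := by
  unfold jouk
  rw [show -z - 2 * √c = -(z + 2 * √c) by ring, show -z + 2 * √c = -(z - 2 * √c) by ring,
    norm_neg, norm_neg, add_comm ‖z + 2 * √c‖]

lemma continuous_jouk : Continuous fun p : ℝ × ℂ => jouk p.1 p.2 := by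
  unfold jouk
  have : Continuous fun p : ℝ × ℂ => ((√p.1 : ℝ) : ℂ) :=
    Complex.continuous_ofReal.comp (Real.continuous_sqrt.comp continuous_fst)
  fun_prop

/-- A bound uniform in `c`: high on the imaginary axis every `log (jouk c z)` is large, and this is
what makes `α = 1` optimal there. -/
lemma le_jouk_of_re_eq_zero {c : ℝ} {y : ℝ} (hy : 0 ≤ y) :
    y ≤ jouk c ((y : ℂ) * Complex.I) := by
  unfold jouk
  by_cases hc : 0 ≤ c
  · have hsq := Real.sq_sqrt hc
    have e : ∀ σ : ℝ, ‖(y : ℂ) * Complex.I + σ * (2 * √c)‖ = √(σ ^ 2 * (4 * c) + y ^ 2) := by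
      intro σ
      rw [Complex.norm_def, Complex.normSq_apply]
      congr 1
      simp
      nlinarith
    have e1 := e (-1)
    have e2 := e 1
    rw [show (y : ℂ) * Complex.I + ((-1 : ℝ) : ℂ) * (2 * √c) = (y : ℂ) * Complex.I - 2 * √c by
      push_cast; ring] at e1
    rw [show (y : ℂ) * Complex.I + ((1 : ℝ) : ℂ) * (2 * √c) = (y : ℂ) * Complex.I + 2 * √c by
      push_cast; ring] at e2
    rw [e1, e2]
    have h0 : (0 : ℝ) ≤ 4 * c + y ^ 2 := by positivity
    have : ((√((-1) ^ 2 * (4 * c) + y ^ 2) + √(1 ^ 2 * (4 * c) + y ^ 2)) / 2) ^ 2 - 4 * c =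
        y ^ 2 := by
      norm_num
      rw [Real.sq_sqrt h0]
      ring
    rw [this, Real.sqrt_sq hy]
    have : y ≤ √(4 * c + y ^ 2) := Real.le_sqrt_of_sq_le (by linarith)
    norm_num
    linarith
  · have : √c = 0 := Real.sqrt_eq_zero_of_nonpos (by linarith)
    rw [this]
    have h1 : ‖(y : ℂ) * Complex.I‖ = y := by simp [abs_of_nonneg hy]
    simp only [Complex.ofReal_zero, mul_zero, sub_zero, add_zero, h1]
    have : y ≤ √(((y + y) / 2) ^ 2 - 4 * c) := Real.le_sqrt_of_sq_le (by nlinarith)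
    linarith

/-! ### The root in the upper half-plane -/

/-- A square root with non-negative real part. -/
def csqrt (w : ℂ) : ℂ := Complex.exp (Complex.log w / 2)

/-- The root of `r² - z r + c = 0` in the upper half-plane, for `Im z > 0` and `c ≥ 0`. -/
def upperRoot (z : ℂ) (c : ℝ) : ℂ := (z + Complex.I * csqrt (4 * c - z ^ 2)) / 2

lemma csqrt_sq {w : ℂ} (hw : w ≠ 0) : csqrt w ^ 2 = w := by
  unfold csqrt
  rw [← Complex.exp_nat_mul]
  rw [show ((2 : ℕ) : ℂ) * (Complex.log w / 2) = Complex.log w by push_cast; ring,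
    Complex.exp_log hw]

lemma csqrt_re_nonneg (w : ℂ) : 0 ≤ (csqrt w).re := by
  unfold csqrt
  rw [Complex.exp_re]
  refine mul_nonneg (Real.exp_pos _).le (Real.cos_nonneg_of_mem_Icc ?_)
  have h1 := Complex.neg_pi_lt_arg w
  have h2 := Complex.arg_le_pi w
  have : (Complex.log w / 2).im = w.arg / 2 := by
    rw [show (2 : ℂ) = ((2 : ℝ) : ℂ) by norm_num, Complex.div_ofReal_im, Complex.log_im]
  rw [this]
  constructor <;> linarith

/-- The discriminant avoids the branch cut for `z` in the upper half-plane, so the chosen root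
depends continuously on `c` down to and including `c = 0`. -/
lemma discriminant_mem_slitPlane {z : ℂ} (hz : 0 < z.im) {c : ℝ} (hc : 0 ≤ c) :
    (4 * c - z ^ 2 : ℂ) ∈ Complex.slitPlane := by
  rw [Complex.mem_slitPlane_iff]
  by_cases hx : z.re = 0
  · left
    simp [sq, hx]
    nlinarith
  · right
    simp [sq]
    intro h
    have : z.re * z.im = 0 := by linarith
    rcases mul_eq_zero.1 this with h | h
    · exact hx h
    · exact hz.ne' h

lemma continuousOn_upperRoot {z : ℂ} (hz : 0 < z.im) : ContinuousOn (upperRoot z) (Set.Ici 0) := by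
  unfold upperRoot csqrt
  refine ContinuousOn.div_const (continuousOn_const.add (continuousOn_const.mul ?_)) _
  refine ContinuousOn.cexp (ContinuousOn.div_const (ContinuousOn.clog ?_ ?_) _)
  · fun_prop
  · intro c hc
    exact discriminant_mem_slitPlane hz hc

lemma upperRoot_im_pos {z : ℂ} (hz : 0 < z.im) (c : ℝ) : 0 < (upperRoot z c).im := by
  unfold upperRoot
  have := csqrt_re_nonneg (4 * c - z ^ 2)
  rw [show (2 : ℂ) = ((2 : ℝ) : ℂ) by norm_num, Complex.div_ofReal_im]
  simp only [Complex.add_im, Complex.mul_im, Complex.I_re, Complex.I_im]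
  linarith

lemma ne_zero_of_im_pos {h : ℂ} (hh : 0 < h.im) : h ≠ 0 := by
  rintro rfl
  simp at hh

/-- The root is the fixed point, in the upper half-plane, of the step `h ↦ z - c / h` of the Hermite
ratio recursion. -/
lemma upperRoot_fixed {z : ℂ} (hz : 0 < z.im) {c : ℝ} (hc : 0 ≤ c) :
    z - c / upperRoot z c = upperRoot z c := by
  have h0 := ne_zero_of_im_pos (upperRoot_im_pos hz c)
  have hs := csqrt_sq (Complex.slitPlane_ne_zero (discriminant_mem_slitPlane hz hc))
  have hq : upperRoot z c ^ 2 - z * upperRoot z c + c = 0 := by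
    unfold upperRoot
    linear_combination (-1 / 4 : ℂ) * hs + (1 / 4 : ℂ) * csqrt (4 * c - z ^ 2) ^ 2 * Complex.I_sq
  field_simp
  linear_combination -hq

lemma im_sub_div {z h : ℂ} (c : ℝ) (hh : h ≠ 0) :
    (z - c / h).im = z.im + c * h.im / ‖h‖ ^ 2 := by
  rw [Complex.sub_im, Complex.div_im, Complex.sq_norm]
  simp

lemma le_im_sub_div {z h : ℂ} {c : ℝ} (hc : 0 ≤ c) (hh : 0 < h.im) :
    z.im ≤ (z - c / h).im := by
  rw [im_sub_div c (ne_zero_of_im_pos hh)]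
  have : 0 ≤ c * h.im / ‖h‖ ^ 2 := by positivity
  linarith

lemma le_im_upperRoot {z : ℂ} (hz : 0 < z.im) {c : ℝ} (hc : 0 ≤ c) : z.im ≤ (upperRoot z c).im := by
  have := le_im_sub_div (z := z) hc (upperRoot_im_pos hz c)
  rwa [upperRoot_fixed hz hc] at this

lemma jouk_eq_norm_upperRoot {z : ℂ} (hz : 0 < z.im) {c : ℝ} (hc : 0 ≤ c) :
    jouk c z = ‖upperRoot z c‖ := by
  have him := upperRoot_im_pos hz c
  have h0 := ne_zero_of_im_pos him
  have hfix := upperRoot_fixed hz hc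
  have hn : 0 < ‖upperRoot z c‖ := norm_pos_iff.2 h0
  rw [← jouk_eq_norm hc h0]
  · congr 1
    linear_combination hfix
  · have hi := congrArg Complex.im hfix
    rw [im_sub_div c h0] at hi
    have h1 : c * (upperRoot z c).im / ‖upperRoot z c‖ ^ 2 < (upperRoot z c).im := by linarith
    rw [div_lt_iff₀ (by positivity), mul_comm] at h1
    exact (lt_of_mul_lt_mul_left h1 him.le).le

/-- One step of the recursion for ratios contracts the hyperbolic distance. -/
lemma ratio_step {z h r : ℂ} (hz : 0 < z.im) (hh : z.im ≤ h.im) (hr : z.im ≤ r.im) {c t : ℝ}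
    (hc : 0 ≤ c) (hct : c ≤ t) :
    ‖(z - c / h) - (z - c / r)‖ ^ 2 * (h.im * r.im) ≤
      (t / z.im / (z.im + t / z.im)) * ‖h - r‖ ^ 2 * ((z - c / h).im * (z - c / r).im) := by
  have hh0 : 0 < h.im := hz.trans_le hh
  have hr0 : 0 < r.im := hz.trans_le hr
  have nh := ne_zero_of_im_pos hh0
  have nr := ne_zero_of_im_pos hr0
  have ph : 0 < ‖h‖ := norm_pos_iff.2 nh
  have pr : 0 < ‖r‖ := norm_pos_iff.2 nr
  rw [im_sub_div c nh, im_sub_div c nr]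
  have e : (z - c / h) - (z - c / r) = c * (h - r) / (h * r) := by field_simp; ring
  rw [e, norm_div, norm_mul, norm_mul, Complex.norm_real, Real.norm_of_nonneg hc]
  set p := c * h.im / ‖h‖ ^ 2 with hp
  set p' := c * r.im / ‖r‖ ^ 2 with hp'
  -- The step raises the two imaginary parts by `p` and `p'` above `z.im`, and the left-hand side is
  -- exactly `‖h - r‖² p p'`. The contraction factor thus reduces to `p / (z.im + p)`, which
  -- increases with `p ≤ t / z.im`.
  have e2 : (c * ‖h - r‖ / (‖h‖ * ‖r‖)) ^ 2 * (h.im * r.im) = ‖h - r‖ ^ 2 * (p * p') := by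
    rw [hp, hp']; field_simp
  rw [e2]
  set A := t / z.im with hA
  have hp0 : 0 ≤ p := by positivity
  have hp0' : 0 ≤ p' := by positivity
  have ht0 : 0 ≤ t := hc.trans hct
  have hA0 : 0 ≤ A := by positivity
  have hpA : p ≤ A := by
    rw [hp, hA, div_le_div_iff₀ (by positivity) hz]
    have h1 : h.im ≤ ‖h‖ := (le_abs_self _).trans (Complex.abs_im_le_norm h)
    calc c * h.im * z.im ≤ t * ‖h‖ * ‖h‖ := by
          gcongr
          exact hh.trans h1
      _ = t * ‖h‖ ^ 2 := by ring
  have k1 : p ≤ A / (z.im + A) * (z.im + p) := by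
    rw [div_mul_eq_mul_div, le_div_iff₀ (by positivity)]
    nlinarith
  have k2 : p' ≤ z.im + p' := by linarith
  have hκ : 0 ≤ A / (z.im + A) := by positivity
  calc ‖h - r‖ ^ 2 * (p * p') ≤ ‖h - r‖ ^ 2 * ((A / (z.im + A) * (z.im + p)) * (z.im + p')) := by
        gcongr
    _ = _ := by ring

lemma add_sq_le_weighted (a b η : ℝ) (hη : 0 < η) :
    (a + b) ^ 2 ≤ (1 + η) * a ^ 2 + (1 + 1 / η) * b ^ 2 := by
  have : (1 + η) * a ^ 2 + (1 + 1 / η) * b ^ 2 - (a + b) ^ 2 = (η * a - b) ^ 2 / η := by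
    field_simp; ring
  have : 0 ≤ (η * a - b) ^ 2 / η := by positivity
  linarith

lemma le_of_affine_recursion {x : ℕ → ℝ} {q b : ℝ} {n : ℕ} (hq0 : 0 ≤ q) (hq : q < 1) (hb : 0 ≤ b)
    (h0 : x 0 ≤ 0) (h : ∀ k < n, x (k + 1) ≤ q * x k + b) : ∀ k ≤ n, x k ≤ b / (1 - q) := by
  intro k
  have h1 : 0 < 1 - q := by linarith
  induction k with
  | zero =>
    intro _
    exact h0.trans (by positivity)
  | succ k ih =>
    intro hk
    refine (h k hk).trans ?_
    have := ih (by omega)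
    calc q * x k + b ≤ q * (b / (1 - q)) + b := by gcongr
      _ = b / (1 - q) := by field_simp; ring

end
end HeatZeros

namespace HeatZeros
noncomputable section

/-! ### Asymptotics of Hermite polynomials off the real line -/

/-- Ratios of consecutive Hermite polynomials. -/
def hermiteRatio (s : ℝ) (z : ℂ) (k : ℕ) : ℂ :=
  (hermitePoly s (k + 1)).eval z / (hermitePoly s k).eval z

/-- Non-vanishing and location must be proved together: a ratio with positive imaginary part is
non-zero, so the next Hermite value is non-zero and the next ratio makes sense. -/
lemma hermiteRatio_spec {s : ℝ} (hs : 0 ≤ s) {z : ℂ} (hz : 0 < z.im) (k : ℕ) :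
    (hermitePoly s k).eval z ≠ 0 ∧ z.im ≤ (hermiteRatio s z k).im ∧
      hermiteRatio s z (k + 1) = z - (s * (k + 1) : ℝ) / hermiteRatio s z k := by
  have step : ∀ k, (hermitePoly s k).eval z ≠ 0 → z.im ≤ (hermiteRatio s z k).im →
      (hermitePoly s (k + 1)).eval z ≠ 0 ∧
        hermiteRatio s z (k + 1) = z - (s * (k + 1) : ℝ) / hermiteRatio s z k := by
    intro k h1 h2
    have h3 : hermiteRatio s z k ≠ 0 := ne_zero_of_im_pos (hz.trans_le h2)
    have h4 : (hermitePoly s (k + 1)).eval z ≠ 0 := by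
      intro h
      exact h3 (by simp [hermiteRatio, h])
    refine ⟨h4, ?_⟩
    unfold hermiteRatio
    rw [hermitePoly]
    simp only [eval_sub, eval_mul, eval_X, eval_C]
    push_cast
    field_simp
  have main : ∀ k, (hermitePoly s k).eval z ≠ 0 ∧ z.im ≤ (hermiteRatio s z k).im := by
    intro k
    induction k with
    | zero => simp [hermitePoly, hermiteRatio]
    | succ k ih =>
      obtain ⟨h1, h2⟩ := step k ih.1 ih.2
      refine ⟨h1, ?_⟩
      rw [h2]
      exact le_im_sub_div (by positivity) (hz.trans_le ih.2)
  exact ⟨(main k).1, (main k).2, (step k (main k).1 (main k).2).2⟩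

lemma norm_sub_div_le {z h : ℂ} (hz : 0 < z.im) (hh : z.im ≤ h.im) {c t : ℝ} (hc : 0 ≤ c)
    (hct : c ≤ t) : ‖z - c / h‖ ≤ ‖z‖ + t / z.im := by
  refine (norm_sub_le _ _).trans ?_
  rw [norm_div, Complex.norm_real, Real.norm_of_nonneg hc]
  have h1 : z.im ≤ ‖h‖ := hh.trans ((le_abs_self _).trans (Complex.abs_im_le_norm h))
  have : 0 ≤ t := hc.trans hct
  gcongr

lemma eventually_upperRoot_sub_le {z : ℂ} (hz : 0 < z.im) {t : ℝ} (ht : 0 < t) {δ : ℝ}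
    (hδ : 0 < δ) : ∀ᶠ n : ℕ in atTop, 0 < n ∧ ∀ x ∈ Set.Icc 0 t, ∀ y ∈ Set.Icc 0 t,
      |x - y| ≤ t / n → ‖upperRoot z x - upperRoot z y‖ ≤ δ := by
  have huc := isCompact_Icc.uniformContinuousOn_of_continuous
    ((continuousOn_upperRoot hz).mono (Set.Icc_subset_Ici_self : Set.Icc 0 t ⊆ _))
  obtain ⟨d, hd, h⟩ := Metric.uniformContinuousOn_iff.1 huc δ hδ
  have hlim : Tendsto (fun n : ℕ => t / (n : ℝ)) atTop (𝓝 0) :=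
    tendsto_const_nhds.div_atTop tendsto_natCast_atTop_atTop
  filter_upwards [hlim.eventually_lt_const hd, eventually_gt_atTop 0] with n h1 h2
  refine ⟨h2, fun x hx y hy hxy => ?_⟩
  have := h x hx y hy (by rw [Real.dist_eq]; exact hxy.trans_lt h1)
  rw [dist_eq_norm] at this
  exact this.le

lemma natCast_mul_div_mem_Icc {t : ℝ} (ht : 0 < t) {n k : ℕ} (hn : 0 < n) (hk : k ≤ n) :
    t / n * k ∈ Set.Icc 0 t := by
  have h0 : (0 : ℝ) < n := by exact_mod_cast hn
  have h1 : (k : ℝ) ≤ n := by exact_mod_cast hk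
  refine ⟨by positivity, ?_⟩
  rw [div_mul_eq_mul_div, div_le_iff₀ h0]
  gcongr

/-- The ratios track a moving fixed point. Each step contracts by a factor below `1`, while the
target moves by at most `δ`. The resulting affine recursion keeps the error of order `δ`, uniformly
in `k ≤ n`. -/
lemma hermiteRatio_sub_sq_le {z : ℂ} (hz : 0 < z.im) {t : ℝ} (ht : 0 < t) {η δ : ℝ} (hη : 0 < η)
    (hδ : 0 ≤ δ) (hδη : δ ≤ η * z.im) {q : ℝ} (hq1 : q < 1)
    (hq : t / z.im / (z.im + t / z.im) * (1 + η) ^ 2 ≤ q) {n : ℕ} (hn : 0 < n)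
    (hR : ∀ x ∈ Set.Icc 0 t, ∀ y ∈ Set.Icc 0 t,
      |x - y| ≤ t / n → ‖upperRoot z x - upperRoot z y‖ ≤ δ) :
    ∀ k ≤ n, ‖hermiteRatio (t / n) z k - upperRoot z (t / n * k)‖ ^ 2 ≤
      (1 + 1 / η) * δ ^ 2 / z.im ^ 2 / (1 - q) * (‖z‖ + t / z.im) ^ 2 := by
  have h0 : (0 : ℝ) < n := by exact_mod_cast hn
  set s := t / (n : ℝ) with hs
  have hs0 : 0 ≤ s := by positivity
  set r := hermiteRatio s z with hr
  set R := fun k : ℕ => upperRoot z (s * k) with hRdef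
  set κ := t / z.im / (z.im + t / z.im) with hκ
  have hκ0 : 0 ≤ κ := by positivity
  have hκ1 : κ ≤ 1 := div_le_one_of_le₀ (by linarith) (by positivity)
  have him : ∀ k, z.im ≤ (r k).im := fun k => (hermiteRatio_spec hs0 hz k).2.1
  have hRim : ∀ k, z.im ≤ (R k).im := fun k => le_im_upperRoot hz (by positivity)
  have him0 : ∀ k, 0 < (r k).im := fun k => hz.trans_le (him k)
  have hRim0 : ∀ k, 0 < (R k).im := fun k => hz.trans_le (hRim k)
  -- `D k` is an increasing function of the hyperbolic distance between the ratio and the current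
  -- fixed point; `D 0 = 0` because both equal `z`.
  set D : ℕ → ℝ := fun k => ‖r k - R k‖ ^ 2 / ((r k).im * (R k).im) with hD
  set b := (1 + 1 / η) * δ ^ 2 / z.im ^ 2 with hb
  have hb0 : 0 ≤ b := by positivity
  have hD0 : D 0 = 0 := by
    have h1 : r 0 = z := by simp [hr, hermiteRatio, hermitePoly]
    have h2 : R 0 = z := by
      have := upperRoot_fixed hz le_rfl
      simp only [hRdef, Nat.cast_zero, mul_zero]
      rw [← this]
      simp
    simp [hD, h1, h2]
  have hrec : ∀ k < n, D (k + 1) ≤ q * D k + b := by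
    intro k hk
    have hmem := natCast_mul_div_mem_Icc ht hn hk
    have hmem' := natCast_mul_div_mem_Icc ht hn hk.le
    have hclose : ‖R k - R (k + 1)‖ ≤ δ := by
      refine hR _ hmem' _ hmem ?_
      rw [← mul_sub, abs_mul, abs_of_nonneg hs0]
      push_cast
      simp
    have hst := ratio_step hz (him k) (hRim (k + 1)) hmem.1 hmem.2
    have e1 : r (k + 1) = z - ((s * ((k + 1 : ℕ) : ℝ) : ℝ) : ℂ) / r k := by
      rw [hr, (hermiteRatio_spec hs0 hz k).2.2]
      push_cast
      rfl
    have e2 : z - ((s * ((k + 1 : ℕ) : ℝ) : ℝ) : ℂ) / R (k + 1) = R (k + 1) :=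
      upperRoot_fixed hz hmem.1
    rw [e2, ← e1] at hst
    have st1 : D (k + 1) ≤ κ * (‖r k - R (k + 1)‖ ^ 2 / ((r k).im * (R (k + 1)).im)) := by
      rw [hD]
      simp only
      rw [mul_div_assoc', div_le_div_iff₀ (mul_pos (him0 _) (hRim0 _))
        (mul_pos (him0 _) (hRim0 _))]
      exact hst
    have st2 : ‖r k - R (k + 1)‖ ^ 2 ≤ (1 + η) * ‖r k - R k‖ ^ 2 + (1 + 1 / η) * δ ^ 2 := by
      have : ‖r k - R (k + 1)‖ ≤ ‖r k - R k‖ + δ := by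
        have := norm_add_le (r k - R k) (R k - R (k + 1))
        rw [sub_add_sub_cancel] at this
        linarith
      calc ‖r k - R (k + 1)‖ ^ 2 ≤ (‖r k - R k‖ + δ) ^ 2 := by gcongr
        _ ≤ _ := add_sq_le_weighted _ _ _ hη
    have st3 : (R k).im ≤ (1 + η) * (R (k + 1)).im := by
      have h1 : (R k - R (k + 1)).im ≤ δ :=
        ((le_abs_self _).trans (Complex.abs_im_le_norm _)).trans hclose
      rw [Complex.sub_im] at h1
      have : η * z.im ≤ η * (R (k + 1)).im := by gcongr; exact hRim _
      linarith
    have st4 : ‖r k - R k‖ ^ 2 / ((r k).im * (R (k + 1)).im) ≤ (1 + η) * D k := by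
      rw [hD]
      simp only
      rw [mul_div_assoc', div_le_div_iff₀ (mul_pos (him0 _) (hRim0 _))
        (mul_pos (him0 _) (hRim0 _))]
      have := him0 k
      calc ‖r k - R k‖ ^ 2 * ((r k).im * (R k).im)
          ≤ ‖r k - R k‖ ^ 2 * ((r k).im * ((1 + η) * (R (k + 1)).im)) := by gcongr
        _ = _ := by ring
    have st5 : (1 + 1 / η) * δ ^ 2 / ((r k).im * (R (k + 1)).im) ≤ b := by
      rw [hb]
      gcongr
      rw [sq]
      exact mul_le_mul (him k) (hRim _) hz.le (him0 k).le
    have hDk : 0 ≤ D k := div_nonneg (sq_nonneg _) (mul_pos (him0 _) (hRim0 _)).le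
    calc D (k + 1) ≤ κ * (‖r k - R (k + 1)‖ ^ 2 / ((r k).im * (R (k + 1)).im)) := st1
      _ ≤ κ * (((1 + η) * ‖r k - R k‖ ^ 2 + (1 + 1 / η) * δ ^ 2) /
            ((r k).im * (R (k + 1)).im)) := by
          have := (mul_pos (him0 k) (hRim0 (k + 1)))
          gcongr
      _ = κ * ((1 + η) * (‖r k - R k‖ ^ 2 / ((r k).im * (R (k + 1)).im)) +
            (1 + 1 / η) * δ ^ 2 / ((r k).im * (R (k + 1)).im)) := by ring
      _ ≤ κ * ((1 + η) * ((1 + η) * D k) + b) := by gcongr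
      _ = (κ * (1 + η) ^ 2) * D k + κ * b := by ring
      _ ≤ q * D k + 1 * b := by gcongr
      _ = q * D k + b := by ring
  have hq0 : 0 ≤ q := le_trans (by positivity) hq
  have hDle := le_of_affine_recursion hq0 hq1 hb0 hD0.le hrec
  intro k hk
  have hB : ∀ k ≤ n, (r k).im ≤ ‖z‖ + t / z.im := by
    intro k hk
    refine ((le_abs_self _).trans (Complex.abs_im_le_norm _)).trans ?_
    rcases k with _ | k
    · have h1 : r 0 = z := by simp [hr, hermiteRatio, hermitePoly]
      rw [h1]
      have : 0 ≤ t / z.im := by positivity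
      linarith
    · rw [hr, (hermiteRatio_spec hs0 hz k).2.2]
      have hmem := natCast_mul_div_mem_Icc ht hn hk
      push_cast at hmem
      exact norm_sub_div_le hz (him k) hmem.1 hmem.2
  have hB' : (R k).im ≤ ‖z‖ + t / z.im := by
    refine ((le_abs_self _).trans (Complex.abs_im_le_norm _)).trans ?_
    have hmem := natCast_mul_div_mem_Icc ht hn hk
    rw [hRdef]
    simp only
    rw [← upperRoot_fixed hz hmem.1]
    exact norm_sub_div_le hz (hRim k) hmem.1 hmem.2
  have h3 := hDle k hk
  rw [hD] at h3
  simp only at h3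
  rw [div_le_iff₀ (mul_pos (him0 _) (hRim0 _))] at h3
  refine h3.trans ?_
  have : 0 ≤ b / (1 - q) := div_nonneg hb0 (by linarith)
  refine mul_le_mul_of_nonneg_left ?_ this
  rw [sq]
  exact mul_le_mul (hB k hk) hB' (hRim0 k).le ((him0 k).le.trans (hB k hk))

lemma eventually_hermiteRatio_close {z : ℂ} (hz : 0 < z.im) {t : ℝ} (ht : 0 < t) {ε : ℝ}
    (hε : 0 < ε) : ∀ᶠ n : ℕ in atTop, 0 < n ∧ ∀ k < n, ∀ x ∈ Set.Icc 0 t,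
      |t / n * k - x| ≤ t / n → ‖hermiteRatio (t / n) z k - upperRoot z x‖ ≤ ε := by
  set κ := t / z.im / (z.im + t / z.im) with hκ
  have hκ0 : 0 ≤ κ := by positivity
  have hκ1 : κ < 1 := (div_lt_one (by positivity)).2 (by linarith)
  -- Small enough that `κ (1 + η)² ≤ κ + 3η` stays below the midpoint `(1 + κ) / 2`.
  set η := (1 - κ) / 8 with hη
  have hη0 : 0 < η := by rw [hη]; linarith
  set q := (1 + κ) / 2 with hq
  have hq1 : q < 1 := by rw [hq]; linarith
  have hκq : κ * (1 + η) ^ 2 ≤ q := by 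
    have h1 : (1 + η) ^ 2 ≤ 1 + 3 * η := by rw [hη]; nlinarith
    have h2 : κ * (1 + η) ^ 2 ≤ κ * (1 + 3 * η) := by gcongr
    have h3 : κ * η ≤ 1 * η := by gcongr
    rw [hq]
    rw [hη] at *
    linarith
  set K := (1 + 1 / η) / z.im ^ 2 / (1 - q) * (‖z‖ + t / z.im) ^ 2 with hK
  have h1q : 0 < 1 - q := by linarith
  have hK0 : 0 ≤ K := by positivity
  -- The three entries serve the hypothesis `δ ≤ η * z.im`, the passage from `t / n * k` to `x`, and
  -- the estimate `K δ² ≤ (ε/2)²`.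
  set δ := min (η * z.im) (min (ε / 2) (ε / 2 / (K + 1))) with hδ
  have hδ0 : 0 < δ := by rw [hδ]; positivity
  filter_upwards [eventually_upperRoot_sub_le hz ht hδ0] with n ⟨hn, hR⟩
  refine ⟨hn, fun k hk x hx hkx => ?_⟩
  have h1 := hermiteRatio_sub_sq_le hz ht hη0 hδ0.le (min_le_left _ _) hq1 hκq hn hR k hk.le
  have hδ2 : δ ≤ ε / 2 / (K + 1) := (min_le_right _ _).trans (min_le_right _ _)
  have hδ3 : δ ≤ ε / 2 := (min_le_right _ _).trans (min_le_left _ _)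
  have h2 : ‖hermiteRatio (t / n) z k - upperRoot z (t / n * k)‖ ≤ ε / 2 := by
    refine le_of_sq_le_sq ?_ (by positivity)
    refine h1.trans ?_
    have e : (1 + 1 / η) * δ ^ 2 / z.im ^ 2 / (1 - q) * (‖z‖ + t / z.im) ^ 2 = K * δ ^ 2 := by
      rw [hK]; ring
    rw [e]
    calc K * δ ^ 2 ≤ K * (ε / 2 / (K + 1)) ^ 2 := by gcongr
      _ = (ε / 2) ^ 2 * (K / (K + 1) ^ 2) := by field_simp
      _ ≤ (ε / 2) ^ 2 * 1 := by
          gcongr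
          rw [div_le_one (by positivity)]
          nlinarith
      _ = (ε / 2) ^ 2 := mul_one _
  have h3 := hR _ (natCast_mul_div_mem_Icc ht hn hk.le) x hx hkx
  have := norm_add_le (hermiteRatio (t / n) z k - upperRoot z (t / n * k))
    (upperRoot z (t / n * k) - upperRoot z x)
  rw [sub_add_sub_cancel] at this
  linarith

/-- The limit of `(1/n) log |He_k(z; t/n)|` as `k/n → α`. -/
def hermitePot (t α : ℝ) (z : ℂ) : ℝ := ∫ β in (0 : ℝ)..α, Real.log (jouk (t * β) z)

lemma hermitePot_neg (t α : ℝ) (z : ℂ) : hermitePot t α (-z) = hermitePot t α z := by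
  unfold hermitePot
  simp_rw [jouk_neg]

lemma log_norm_hermitePoly_eval {s : ℝ} (hs : 0 ≤ s) {z : ℂ} (hz : 0 < z.im) (k : ℕ) :
    Real.log ‖(hermitePoly s k).eval z‖ =
      ∑ j ∈ Finset.range k, Real.log ‖hermiteRatio s z j‖ := by
  induction k with
  | zero => simp [hermitePoly]
  | succ k ih =>
    rw [Finset.sum_range_succ, ← ih, hermiteRatio, norm_div, Real.log_div]
    · ring
    · exact norm_ne_zero_iff.2 (hermiteRatio_spec hs hz _).1
    · exact norm_ne_zero_iff.2 (hermiteRatio_spec hs hz _).1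

lemma continuousOn_log_norm_upperRoot {z : ℂ} (hz : 0 < z.im) :
    ContinuousOn (fun c => Real.log ‖upperRoot z c‖) (Set.Ici 0) :=
  (continuousOn_upperRoot hz).norm.log fun c _ =>
    norm_ne_zero_iff.2 (ne_zero_of_im_pos (upperRoot_im_pos hz c))

/-- The logarithm of the Hermite value telescopes into a sum over ratios, each compared with the
integral of `log ‖upperRoot z (tβ)‖` over a cell of length `1 / n`. -/
lemma eventually_hermite_close_of_im_pos {z : ℂ} (hz : 0 < z.im) {t : ℝ} (ht : 0 < t) {ε : ℝ}
    (hε : 0 < ε) : ∀ᶠ n : ℕ in atTop, ∀ k ≤ n, (hermitePoly (t / n : ℝ) k).eval z ≠ 0 ∧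
      |1 / (n : ℝ) * Real.log ‖(hermitePoly (t / n : ℝ) k).eval z‖ - hermitePot t (k / n) z| ≤
        ε := by
  -- All moduli involved are at least `z.im`, where the logarithm is Lipschitz with constant `1 /
  -- z.im`; hence the precision `ε * z.im`.
  filter_upwards [eventually_hermiteRatio_close hz ht (ε := ε * z.im) (by positivity)]
    with n ⟨hn, h⟩ k hk
  have h0 : (0 : ℝ) < n := by exact_mod_cast hn
  have hs0 : 0 ≤ t / (n : ℝ) := by positivity
  refine ⟨(hermiteRatio_spec hs0 hz k).1, ?_⟩
  set f : ℝ → ℝ := fun β => Real.log ‖upperRoot z (t * β)‖ with hf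
  have hfc : ContinuousOn f (Set.Ici 0) := by
    refine (continuousOn_log_norm_upperRoot hz).comp (by fun_prop) ?_
    intro β hβ
    exact mul_nonneg ht.le hβ
  have hpot : hermitePot t (k / n) z = ∫ β in (0 : ℝ)..(k / n), f β := by
    unfold hermitePot
    refine intervalIntegral.integral_congr fun β hβ => ?_
    rw [Set.uIcc_of_le (by positivity)] at hβ
    simp only [hf]
    rw [jouk_eq_norm_upperRoot hz (mul_nonneg ht.le hβ.1)]
  have hint : ∀ j : ℕ, IntervalIntegrable f volume ((j : ℝ) / n) (((j + 1 : ℕ) : ℝ) / n) := by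
    intro j
    refine ContinuousOn.intervalIntegrable (hfc.mono ?_)
    rw [Set.uIcc_of_le (by push_cast; gcongr; linarith)]
    exact fun x hx => le_trans (by positivity) hx.1
  have hsum : hermitePot t (k / n) z =
      ∑ j ∈ Finset.range k, ∫ β in ((j : ℝ) / n)..(((j + 1 : ℕ) : ℝ) / n), f β := by
    rw [hpot, intervalIntegral.sum_integral_adjacent_intervals (a := fun j : ℕ => (j : ℝ) / n)
      fun j _ => hint j]
    simp
  rw [hsum, log_norm_hermitePoly_eval hs0 hz, Finset.mul_sum, ← Finset.sum_sub_distrib]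
  have hterm : ∀ j ∈ Finset.range k, |1 / (n : ℝ) * Real.log ‖hermiteRatio (t / n) z j‖ -
      ∫ β in ((j : ℝ) / n)..(((j + 1 : ℕ) : ℝ) / n), f β| ≤ ε / n := by
    intro j hj
    have hjn : j < n := (Finset.mem_range.1 hj).trans_le hk
    have hle : (j : ℝ) / n ≤ ((j + 1 : ℕ) : ℝ) / n := by push_cast; gcongr; linarith
    have e : 1 / (n : ℝ) * Real.log ‖hermiteRatio (t / n) z j‖ =
        ∫ _ in ((j : ℝ) / n)..(((j + 1 : ℕ) : ℝ) / n), Real.log ‖hermiteRatio (t / n) z j‖ := by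
      rw [intervalIntegral.integral_const, smul_eq_mul]
      push_cast
      ring
    rw [e, ← intervalIntegral.integral_sub intervalIntegrable_const (hint j), ← Real.norm_eq_abs]
    refine (intervalIntegral.norm_integral_le_of_norm_le_const (C := ε) fun β hβ => ?_).trans ?_
    · rw [Set.uIoc_of_le hle] at hβ
      have hβ0 : 0 ≤ β := le_trans (by positivity) hβ.1.le
      have hβ1 : β ≤ 1 := by
        refine hβ.2.trans (div_le_one_of_le₀ ?_ h0.le)
        exact_mod_cast hjn
      have hx : t * β ∈ Set.Icc 0 t := ⟨by positivity, by nlinarith⟩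
      have hjβ : |t / n * j - t * β| ≤ t / n := by
        have h1 := hβ.1.le
        have h2 := hβ.2
        rw [div_le_iff₀ h0] at h1
        rw [le_div_iff₀ h0] at h2
        push_cast at h2
        have e3 : t / n * j - t * β = t / n * (j - β * n) := by field_simp
        rw [e3, abs_mul, abs_of_nonneg hs0]
        have : |(j : ℝ) - β * n| ≤ 1 := abs_le.2 ⟨by linarith, by linarith⟩
        nlinarith
      have h2 := h j hjn _ hx hjβ
      have i1 : z.im ≤ ‖hermiteRatio (t / n) z j‖ :=
        (hermiteRatio_spec hs0 hz j).2.1.trans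
          ((le_abs_self _).trans (Complex.abs_im_le_norm _))
      have i2 : z.im ≤ ‖upperRoot z (t * β)‖ :=
        (le_im_upperRoot hz hx.1).trans ((le_abs_self _).trans (Complex.abs_im_le_norm _))
      rw [Real.norm_eq_abs, hf]
      refine (log_sub_log_le hz i1 i2).trans ?_
      rw [div_le_iff₀ hz]
      exact (abs_norm_sub_norm_le _ _).trans h2
    · rw [abs_of_nonneg (by linarith)]
      push_cast
      apply le_of_eq
      field_simp
      ring
  calc |∑ j ∈ Finset.range k, _| ≤ ∑ j ∈ Finset.range k, _ := Finset.abs_sum_le_sum_abs _ _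
    _ ≤ ∑ j ∈ Finset.range k, ε / n := Finset.sum_le_sum hterm
    _ = k * (ε / n) := by simp
    _ ≤ n * (ε / n) := by
        have : (k : ℝ) ≤ n := by exact_mod_cast hk
        gcongr
    _ = ε := by field_simp

lemma eventually_hermite_close {z : ℂ} (hz : z.im ≠ 0) {t : ℝ} (ht : 0 < t) {ε : ℝ}
    (hε : 0 < ε) : ∀ᶠ n : ℕ in atTop, ∀ k ≤ n, (hermitePoly (t / n : ℝ) k).eval z ≠ 0 ∧
      |1 / (n : ℝ) * Real.log ‖(hermitePoly (t / n : ℝ) k).eval z‖ - hermitePot t (k / n) z| ≤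
        ε := by
  rcases hz.lt_or_gt with h | h
  · have h' : 0 < (-z).im := by simpa using h
    filter_upwards [eventually_hermite_close_of_im_pos h' ht hε] with n hn k hk
    have := hn k hk
    rw [hermitePoly_eval_neg, hermitePot_neg, norm_mul, norm_pow, norm_neg, norm_one, one_pow,
      one_mul] at this
    exact ⟨fun h0 => this.1 (by rw [h0, mul_zero]), this.2⟩
  · exact eventually_hermite_close_of_im_pos h ht hε

end
end HeatZeros

namespace HeatZeros
noncomputable section

/-! ### The limiting potential -/

lemma jouk_pos {c : ℝ} (hc : 0 < c) (z : ℂ) : 0 < jouk c z :=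
  (Real.sqrt_pos.2 hc).trans_le (sqrt_le_jouk z)

lemma half_log_le_log_jouk {c : ℝ} (hc : 0 < c) (z : ℂ) :
    Real.log c / 2 ≤ Real.log (jouk c z) := by
  rw [← Real.log_sqrt hc.le]
  exact Real.log_le_log (Real.sqrt_pos.2 hc) (sqrt_le_jouk z)

/-- As `jouk c z ≥ √c`, the only possible singularity is that of `log β` at `0`, integrable and
locally uniform in `z`, even for `z` on the real line. -/
lemma abs_log_jouk_le {t : ℝ} (ht : 0 < t) {β : ℝ} (h0 : 0 < β) (h1 : β ≤ 1) (z : ℂ) :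
    |Real.log (jouk (t * β) z)| ≤ |Real.log β| + (|Real.log t| + (‖z‖ + 2 * √t)) := by
  have hc : 0 < t * β := mul_pos ht h0
  have l1 := half_log_le_log_jouk hc z
  rw [Real.log_mul ht.ne' h0.ne'] at l1
  have l2 : Real.log (jouk (t * β) z) ≤ ‖z‖ + 2 * √t := by
    have := Real.log_le_sub_one_of_pos (jouk_pos hc z)
    have h2 := jouk_le hc.le z
    have h3 : √(t * β) ≤ √t := Real.sqrt_le_sqrt (by nlinarith)
    linarith
  have := neg_abs_le (Real.log t)
  have := neg_abs_le (Real.log β)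
  have := abs_nonneg (Real.log t)
  have := abs_nonneg (Real.log β)
  have : 0 ≤ ‖z‖ + 2 * √t := by positivity
  rw [abs_le]
  constructor <;> linarith

lemma intervalIntegrable_logBound (C a b : ℝ) :
    IntervalIntegrable (fun β => |Real.log β| + C) volume a b :=
  intervalIntegral.intervalIntegrable_log'.abs.add intervalIntegrable_const

lemma measurable_log_jouk (t : ℝ) (z : ℂ) : Measurable fun β => Real.log (jouk (t * β) z) :=
  Real.measurable_log.comp (continuous_jouk.comp
    ((continuous_const.mul continuous_id).prodMk continuous_const)).measurable

lemma intervalIntegrable_log_jouk {t : ℝ} (ht : 0 < t) (z : ℂ) {a b : ℝ}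
    (ha : a ∈ Set.Icc (0 : ℝ) 1) (hb : b ∈ Set.Icc (0 : ℝ) 1) :
    IntervalIntegrable (fun β => Real.log (jouk (t * β) z)) volume a b := by
  refine (intervalIntegrable_logBound (|Real.log t| + (‖z‖ + 2 * √t)) a b).mono_fun
    (measurable_log_jouk t z).aestronglyMeasurable ?_
  rw [Filter.EventuallyLE, ae_restrict_iff' measurableSet_uIoc]
  refine ae_of_all _ fun β hβ => ?_
  rw [Set.uIoc, Set.mem_Ioc] at hβ
  have h0 : 0 < β := (le_min ha.1 hb.1).trans_lt hβ.1
  have h1 : β ≤ 1 := hβ.2.trans (max_le ha.2 hb.2)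
  rw [Real.norm_eq_abs]
  exact (abs_log_jouk_le ht h0 h1 z).trans (le_abs_self _)

lemma hermitePot_sub {t : ℝ} (ht : 0 < t) (z : ℂ) {a b : ℝ}
    (ha : a ∈ Set.Icc (0 : ℝ) 1) (hb : b ∈ Set.Icc (0 : ℝ) 1) :
    hermitePot t b z - hermitePot t a z = ∫ β in a..b, Real.log (jouk (t * β) z) := by
  have h0 : (0 : ℝ) ∈ Set.Icc (0 : ℝ) 1 := by simp
  exact intervalIntegral.integral_interval_sub_left (intervalIntegrable_log_jouk ht z h0 hb)
    (intervalIntegrable_log_jouk ht z h0 ha)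

lemma continuousOn_hermitePot {t : ℝ} (ht : 0 < t) (z : ℂ) :
    ContinuousOn (fun α => hermitePot t α z) (Set.Icc 0 1) := by
  have h := intervalIntegral.continuousOn_primitive_interval' (a := (0 : ℝ))
    (intervalIntegrable_log_jouk ht z (a := 0) (b := 1) (by simp) (by simp)) (by simp)
  rwa [Set.uIcc_of_le zero_le_one] at h

/-- The modulus of continuity of `z ↦ hermitePot t α z`, uniform in `α`. -/
def hermitePotDist (t : ℝ) (z z' : ℂ) : ℝ :=
  ∫ β in (0 : ℝ)..1, |Real.log (jouk (t * β) z) - Real.log (jouk (t * β) z')|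

lemma abs_hermitePot_sub_le {t : ℝ} (ht : 0 < t) (z z' : ℂ) {α : ℝ} (hα : α ∈ Set.Icc (0 : ℝ) 1) :
    |hermitePot t α z - hermitePot t α z'| ≤ hermitePotDist t z z' := by
  have h0 : (0 : ℝ) ∈ Set.Icc (0 : ℝ) 1 := by simp
  have h1 : (1 : ℝ) ∈ Set.Icc (0 : ℝ) 1 := by simp
  unfold hermitePot hermitePotDist
  rw [← intervalIntegral.integral_sub (intervalIntegrable_log_jouk ht z h0 hα)
    (intervalIntegrable_log_jouk ht z' h0 hα)]
  refine (intervalIntegral.abs_integral_le_integral_abs hα.1).trans ?_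
  refine intervalIntegral.integral_mono_interval le_rfl hα.1 hα.2
    (ae_of_all _ fun _ => abs_nonneg _) ?_
  exact ((intervalIntegrable_log_jouk ht z h0 h1).sub (intervalIntegrable_log_jouk ht z' h0 h1)).abs

lemma tendsto_hermitePotDist {t : ℝ} (ht : 0 < t) (z : ℂ) :
    Tendsto (fun z' => hermitePotDist t z' z) (𝓝 z) (𝓝 0) := by
  have key : Tendsto (fun z' => hermitePotDist t z' z) (𝓝 z) (𝓝 (∫ _ in (0 : ℝ)..1, (0 : ℝ))) := by
    unfold hermitePotDist
    refine intervalIntegral.tendsto_integral_filter_of_dominated_convergence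
      (fun β => (|Real.log β| + (|Real.log t| + (‖z‖ + 1 + 2 * √t))) +
        (|Real.log β| + (|Real.log t| + (‖z‖ + 2 * √t)))) ?_ ?_ ?_ ?_
    · exact Eventually.of_forall fun z' =>
        ((measurable_log_jouk t z').sub (measurable_log_jouk t z)).abs.aestronglyMeasurable
    · filter_upwards [Metric.ball_mem_nhds z one_pos] with z' hz'
      refine ae_of_all _ fun β hβ => ?_
      rw [Set.uIoc_of_le zero_le_one] at hβ
      have e1 := abs_log_jouk_le ht hβ.1 hβ.2 z'
      have e2 := abs_log_jouk_le ht hβ.1 hβ.2 z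
      have e3 : ‖z'‖ ≤ ‖z‖ + 1 := by
        rw [Metric.mem_ball, dist_eq_norm] at hz'
        linarith [norm_le_norm_add_norm_sub' z' z]
      rw [Real.norm_eq_abs, abs_abs]
      refine (abs_sub _ _).trans ?_
      linarith
    · exact (intervalIntegrable_logBound _ _ _).add (intervalIntegrable_logBound _ _ _)
    · refine ae_of_all _ fun β hβ => ?_
      rw [Set.uIoc_of_le zero_le_one] at hβ
      have hpos := jouk_pos (mul_pos ht hβ.1) z
      have hc : Tendsto (fun z' => jouk (t * β) z') (𝓝 z) (𝓝 (jouk (t * β) z)) :=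
        (continuous_jouk.comp (Continuous.prodMk_right (t * β))).tendsto z
      have := ((hc.log hpos.ne').sub_const (Real.log (jouk (t * β) z))).abs
      simpa using this
  simpa using key

/-- The limiting potential `U(z) = max_{α ∈ [0,1]} (g(α) + ∫_0^α log (jouk (t β) z) dβ)`. -/
def limitPot (t : ℝ) (g : ℝ → ℝ) (z : ℂ) : ℝ :=
  sSup ((fun α => g α + hermitePot t α z) '' Set.Icc 0 1)

section

variable {t : ℝ} {g : ℝ → ℝ}

lemma exists_limitPot_eq (ht : 0 < t) (hg : ContinuousOn g (Set.Icc 0 1)) (z : ℂ) :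
    ∃ α ∈ Set.Icc (0 : ℝ) 1, limitPot t g z = g α + hermitePot t α z := by
  obtain ⟨α, hα, h⟩ := isCompact_Icc.exists_sSup_image_eq (Set.nonempty_Icc.2 zero_le_one)
    (hg.add (continuousOn_hermitePot ht z))
  exact ⟨α, hα, h⟩

lemma le_limitPot (ht : 0 < t) (hg : ContinuousOn g (Set.Icc 0 1)) (z : ℂ) {α : ℝ}
    (hα : α ∈ Set.Icc (0 : ℝ) 1) : g α + hermitePot t α z ≤ limitPot t g z :=
  le_csSup (isCompact_Icc.image_of_continuousOn
    (hg.add (continuousOn_hermitePot ht z))).bddAbove (Set.mem_image_of_mem _ hα)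

lemma abs_limitPot_sub_le (ht : 0 < t) (hg : ContinuousOn g (Set.Icc 0 1)) (z z' : ℂ) :
    |limitPot t g z - limitPot t g z'| ≤ hermitePotDist t z z' := by
  obtain ⟨α, hα, h⟩ := exists_limitPot_eq ht hg z
  obtain ⟨α', hα', h'⟩ := exists_limitPot_eq ht hg z'
  have h1 := le_limitPot ht hg z' hα
  have h2 := le_limitPot ht hg z hα'
  have h3 := abs_le.1 (abs_hermitePot_sub_le ht z z' hα)
  have h4 := abs_le.1 (abs_hermitePot_sub_le ht z z' hα')
  rw [abs_le]
  constructor <;> linarith [h3.1, h3.2, h4.1, h4.2]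

lemma continuous_limitPot (ht : 0 < t) (hg : ContinuousOn g (Set.Icc 0 1)) :
    Continuous (limitPot t g) := by
  rw [continuous_iff_continuousAt]
  intro z
  rw [ContinuousAt, tendsto_iff_dist_tendsto_zero]
  refine squeeze_zero (fun _ => dist_nonneg) (fun z' => ?_) (tendsto_hermitePotDist ht z)
  rw [Real.dist_eq]
  exact abs_limitPot_sub_le ht hg z' z

lemma continuous_hermitePot (ht : 0 < t) {α : ℝ} (hα : α ∈ Set.Icc (0 : ℝ) 1) :
    Continuous (hermitePot t α) := by
  rw [continuous_iff_continuousAt]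
  intro z
  rw [ContinuousAt, tendsto_iff_dist_tendsto_zero]
  refine squeeze_zero (fun _ => dist_nonneg) (fun z' => ?_) (tendsto_hermitePotDist ht z)
  rw [Real.dist_eq]
  exact abs_hermitePot_sub_le ht z' z hα

lemma log_norm_le_limitPot (ht : 0 < t) (hg : ContinuousOn g (Set.Icc 0 1)) {z : ℂ}
    (hz : z ≠ 0) : g 1 + Real.log (‖z‖ / 2) ≤ limitPot t g z := by
  refine le_trans ?_ (le_limitPot ht hg z (α := 1) (by simp))
  gcongr
  have h : ∫ _ in (0 : ℝ)..1, Real.log (‖z‖ / 2) ≤ hermitePot t 1 z := by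
    refine intervalIntegral.integral_mono_on zero_le_one intervalIntegrable_const
      (intervalIntegrable_log_jouk ht z (by simp) (by simp)) fun β hβ => ?_
    exact Real.log_le_log (by positivity) (half_norm_le_jouk _ z)
  simpa using h

lemma exists_log_sub_le_limitPot (ht : 0 < t) (hg : ContinuousOn g (Set.Icc 0 1)) {S : Set ℂ}
    (hS : Dense S) :
    ∃ C : ℝ, ∀ ρ : ℝ, 1 < ρ → ∃ z ∈ S, ‖z‖ ≤ ρ ∧ Real.log ρ - C ≤ limitPot t g z := by
  refine ⟨Real.log 4 - g 1, fun ρ hρ => ?_⟩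
  have ho : IsOpen {z : ℂ | ρ / 2 < ‖z‖ ∧ ‖z‖ < ρ} :=
    (isOpen_lt continuous_const continuous_norm).inter (isOpen_lt continuous_norm continuous_const)
  obtain ⟨z, ⟨h1, h2⟩, hz⟩ := hS.inter_open_nonempty _ ho ⟨((3 / 4 * ρ : ℝ) : ℂ), by
    rw [Set.mem_ofPred_eq, Complex.norm_real, Real.norm_of_nonneg (by positivity)]
    constructor <;> linarith⟩
  refine ⟨z, hz, h2.le, ?_⟩
  have hz0 : z ≠ 0 := by
    rintro rfl
    rw [norm_zero] at h1
    linarith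
  refine le_trans ?_ (log_norm_le_limitPot ht hg hz0)
  have : Real.log (ρ / 4) ≤ Real.log (‖z‖ / 2) := Real.log_le_log (by positivity) (by linarith)
  rw [Real.log_div (by positivity) (by norm_num)] at this
  linarith

/-! ### The collapse time -/

/-- By concavity, chords ending at `1` have slope at least the left derivative there. Its finiteness
is what makes `t_Wig` finite. -/
lemma exists_slope_bound (hconc : ConcaveOn ℝ (Set.Icc 0 1) g)
    (hd : DifferentiableWithinAt ℝ g (Set.Iio 1) 1) :
    ∃ D : ℝ, ∀ α ∈ Set.Icc (0 : ℝ) 1, g α - g 1 ≤ D * (1 - α) := by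
  refine ⟨-derivWithin g (Set.Iio 1) 1, fun α hα => ?_⟩
  rcases hα.2.eq_or_lt with rfl | h
  · simp
  · have := hconc.leftDeriv_le_slope hα (by simp) h hd
    rw [slope_def_field, le_div_iff₀ (by linarith)] at this
    linarith

lemma bddAbove_wignerTimeFun (hconc : ConcaveOn ℝ (Set.Icc 0 1) g)
    (hd : DifferentiableWithinAt ℝ g (Set.Iio 1) 1) :
    BddAbove (wignerTimeFun g '' Set.Ioo 0 1) := by
  obtain ⟨D, hD⟩ := exists_slope_bound hconc hd
  refine ⟨Real.exp (2 * D + 1), ?_⟩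
  rintro _ ⟨α, ⟨h0, h1⟩, rfl⟩
  unfold wignerTimeFun
  refine Real.exp_le_exp.2 ?_
  have e1 : (g α - g 1) / (1 - α) ≤ D := by
    rw [div_le_iff₀ (by linarith)]
    exact hD α ⟨h0.le, h1.le⟩
  have e2 : α / (1 - α) * Real.log α ≤ 0 :=
    mul_nonpos_of_nonneg_of_nonpos (div_nonneg h0.le (by linarith))
      (Real.log_nonpos h0.le h1.le)
  linarith

/-- The minimal increment of the Hermite potential between `α` and `1`. -/
def minIncrement (t α : ℝ) : ℝ := ((1 - α) * (Real.log t - 1) - α * Real.log α) / 2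

lemma integral_half_log_mul (ht : 0 < t) {α : ℝ} (h0 : 0 ≤ α) (h1 : α ≤ 1) :
    ∫ β in α..1, Real.log (t * β) / 2 = minIncrement t α := by
  have : ∫ β in α..1, Real.log (t * β) / 2 = ∫ β in α..1, (Real.log t + Real.log β) / 2 := by
    refine intervalIntegral.integral_congr_ae ?_
    refine ae_of_all _ fun β hβ => ?_
    rw [Set.uIoc_of_le h1] at hβ
    rw [Real.log_mul ht.ne' (h0.trans_lt hβ.1).ne']
  rw [this, intervalIntegral.integral_div, intervalIntegral.integral_add intervalIntegrable_const
    intervalIntegral.intervalIntegrable_log', integral_log, intervalIntegral.integral_const]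
  unfold minIncrement
  simp
  ring

/-- The bound `jouk c z ≥ √c` is attained at `z = 0`, so the origin is the point where `α = 1` has
most difficulty winning. The criterion for `t_Wig` is therefore tested at the origin alone. -/
lemma minIncrement_le (ht : 0 < t) (z : ℂ) {α : ℝ} (hα : α ∈ Set.Icc (0 : ℝ) 1) :
    minIncrement t α ≤ hermitePot t 1 z - hermitePot t α z := by
  rw [hermitePot_sub ht z hα (by simp), ← integral_half_log_mul ht hα.1 hα.2]
  have hlog : IntervalIntegrable (fun β => Real.log (jouk (t * β) 0)) volume α 1 :=
    intervalIntegrable_log_jouk ht 0 hα (by simp)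
  have heq : Set.EqOn (fun β => Real.log (jouk (t * β) 0)) (fun β => Real.log (t * β) / 2)
      (Set.uIoc α 1) := by
    intro β hβ
    rw [Set.uIoc_of_le hα.2] at hβ
    have : 0 ≤ t * β := mul_nonneg ht.le (hα.1.trans hβ.1.le)
    simp only
    rw [jouk_zero this, Real.log_sqrt this]
  refine intervalIntegral.integral_mono_on_of_le_Ioo hα.2 (hlog.congr heq)
    (intervalIntegrable_log_jouk ht z hα (by simp)) fun β hβ => ?_
  exact half_log_le_log_jouk (mul_pos ht (hα.1.trans_lt hβ.1)) z

lemma hermitePot_sub_zero (ht : 0 < t) {α : ℝ} (hα : α ∈ Set.Icc (0 : ℝ) 1) :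
    hermitePot t 1 0 - hermitePot t α 0 = minIncrement t α := by
  rw [hermitePot_sub ht 0 hα (by simp), ← integral_half_log_mul ht hα.1 hα.2]
  refine intervalIntegral.integral_congr fun β hβ => ?_
  rw [Set.uIcc_of_le hα.2] at hβ
  have : 0 ≤ t * β := mul_nonneg ht.le (hα.1.trans hβ.1)
  rw [jouk_zero this, Real.log_sqrt this]

lemma wignerTimeFun_le_iff (ht : 0 < t) {α : ℝ} (hα : α ∈ Set.Ioo (0 : ℝ) 1) :
    wignerTimeFun g α ≤ t ↔ g α - g 1 ≤ minIncrement t α := by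
  have h1 : 0 < 1 - α := by linarith [hα.2]
  unfold wignerTimeFun minIncrement
  rw [← Real.le_log_iff_exp_le ht]
  have e : 2 * ((g α - g 1) / (1 - α)) + α / (1 - α) * Real.log α + 1 =
      (2 * (g α - g 1) + α * Real.log α + (1 - α)) / (1 - α) := by
    field_simp
  rw [e, div_le_iff₀ h1, le_div_iff₀ two_pos]
  constructor <;> intro h <;> nlinarith

lemma limitPot_eq_of_wignerTime_le (ht : 0 < t) (hg : ContinuousOn g (Set.Icc 0 1))
    (hb : BddAbove (wignerTimeFun g '' Set.Ioo 0 1)) (h : wignerTime g ≤ t) (z : ℂ) :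
    limitPot t g z = g 1 + hermitePot t 1 z := by
  refine le_antisymm ?_ (le_limitPot ht hg z (by simp))
  obtain ⟨α, hα, e⟩ := exists_limitPot_eq ht hg z
  rw [e]
  set G : ℝ → ℝ := fun α => g α + hermitePot t α z with hG
  have hGc : ContinuousOn G (Set.Icc 0 1) := hg.add (continuousOn_hermitePot ht z)
  have hIoo : ∀ α ∈ Set.Ioo (0 : ℝ) 1, G α ≤ G 1 := by
    intro α hα
    have h1 : wignerTimeFun g α ≤ t := (le_csSup hb (Set.mem_image_of_mem _ hα)).trans h
    rw [wignerTimeFun_le_iff ht hα] at h1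
    have h2 := minIncrement_le ht z (Set.Ioo_subset_Icc_self hα)
    simp only [hG]
    linarith
  -- The collapse time only constrains interior `α`; the endpoints follow by continuity.
  have hcl : closure (Set.Ioo (0 : ℝ) 1) = Set.Icc 0 1 := closure_Ioo zero_ne_one
  have := ContinuousWithinAt.closure_le (f := G) (g := fun _ => G 1) (s := Set.Ioo (0 : ℝ) 1)
    (x := α) (by rw [hcl]; exact hα)
    ((hGc α hα).mono Set.Ioo_subset_Icc_self) continuousWithinAt_const hIoo
  exact this

/-- Some `α` beats `1` strictly at the origin. The strict inequality is open, so it persists at a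
nearby point of the upper half-plane. -/
lemma exists_lt_limitPot_of_lt_wignerTime (ht : 0 < t) (hg : ContinuousOn g (Set.Icc 0 1))
    (h : t < wignerTime g) :
    ∃ z : ℂ, 0 < z.im ∧ g 1 + hermitePot t 1 z < limitPot t g z := by
  obtain ⟨_, ⟨α, hα, rfl⟩, hlt⟩ := exists_lt_of_lt_csSup
    (Set.Nonempty.image _ (Set.nonempty_Ioo.2 zero_lt_one)) h
  rw [← not_le, wignerTimeFun_le_iff ht hα, not_le] at hlt
  have hα' := Set.Ioo_subset_Icc_self hα
  have h0 : g 1 + hermitePot t 1 0 < limitPot t g 0 := by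
    have h1 := hermitePot_sub_zero ht hα'
    have h2 := le_limitPot ht hg 0 hα'
    linarith
  have hopen : IsOpen {z : ℂ | g 1 + hermitePot t 1 z < limitPot t g z} :=
    isOpen_lt (continuous_const.add (continuous_hermitePot ht (by simp)))
      (continuous_limitPot ht hg)
  obtain ⟨ε, hε, hball⟩ := Metric.isOpen_iff.1 hopen 0 h0
  refine ⟨((ε / 2 : ℝ) : ℂ) * Complex.I, by simpa using hε, hball ?_⟩
  rw [mem_ball_zero_iff, norm_mul, Complex.norm_I, mul_one, Complex.norm_real,
    Real.norm_of_nonneg (by positivity)]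
  linarith

/-- At height `exp D` the Hermite potential has slope at least `D` in `α`, which compensates any
gain `g α - g 1 ≤ D (1 - α)`. -/
lemma exists_limitPot_eq_of_im_large (ht : 0 < t) (hg : ContinuousOn g (Set.Icc 0 1))
    (hconc : ConcaveOn ℝ (Set.Icc 0 1) g) (hd : DifferentiableWithinAt ℝ g (Set.Iio 1) 1) :
    ∃ z : ℂ, 0 < z.im ∧ limitPot t g z = g 1 + hermitePot t 1 z := by
  obtain ⟨D, hD⟩ := exists_slope_bound hconc hd
  set y := Real.exp D with hy
  have hy0 : 0 < y := Real.exp_pos _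
  refine ⟨(y : ℂ) * Complex.I, by simpa using hy0, ?_⟩
  refine le_antisymm ?_ (le_limitPot ht hg _ (by simp))
  obtain ⟨α, hα, e⟩ := exists_limitPot_eq ht hg ((y : ℂ) * Complex.I)
  rw [e]
  have h1 := hD α hα
  have h2 : D * (1 - α) ≤ hermitePot t 1 ((y : ℂ) * Complex.I) -
      hermitePot t α ((y : ℂ) * Complex.I) := by
    rw [hermitePot_sub ht _ hα (by simp)]
    have : ∫ _ in α..1, D = D * (1 - α) := by simp; ring
    rw [← this]
    refine intervalIntegral.integral_mono_on hα.2 intervalIntegrable_const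
      (intervalIntegrable_log_jouk ht _ hα (by simp)) fun β hβ => ?_
    rw [Real.le_log_iff_exp_le (hy0.trans_le (le_jouk_of_re_eq_zero hy0.le))]
    exact le_jouk_of_re_eq_zero hy0.le
  linarith

end

end
end HeatZeros

namespace HeatZeros
noncomputable section

/-! ### Littlewood–Offord counting -/

section Counting

variable {ι : Type*} [Fintype ι] [DecidableEq ι]

/-- The signed sum of `a`, with a minus sign on the indices in `A`. -/
def signedSum (a : ι → ℝ) (A : Finset ι) : ℝ := ∑ i, if i ∈ A then -a i else a i

/-- The indices in `K` whose contribution to `signedSum a A` is non-negative. -/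
def positivePart (a : ι → ℝ) (K : Finset ι) (A : Finset ι) : Finset K :=
  Finset.univ.filter fun i => ((i : ι) ∈ A ↔ a i < 0)

/-- Enlarging the positive part raises the signed sum by at least `2 |a i| > 4r`, more than the
length of `[-2r, 2r]`. The positive parts thus form an antichain, as Erdős observed. -/
lemma not_positivePart_lt {a : ι → ℝ} {K A B : Finset ι} {r : ℝ} (hK : ∀ i ∈ K, 2 * r < |a i|)
    (hAB : A \ K = B \ K) (hA : |signedSum a A| ≤ 2 * r) (hB : |signedSum a B| ≤ 2 * r) :
    ¬ positivePart a K A ⊂ positivePart a K B := by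
  intro h
  have hsub := h.subset
  obtain ⟨⟨i, hiK⟩, hiB, hiA⟩ := Finset.exists_of_ssubset h
  set f : ι → ℝ := fun i => (if i ∈ B then -a i else a i) - (if i ∈ A then -a i else a i) with hf
  have hnn : ∀ j ∈ Finset.univ, 0 ≤ f j := by
    intro j _
    by_cases hj : j ∈ K
    · have h1 := @hsub ⟨j, hj⟩
      simp only [positivePart, Finset.mem_filter, Finset.mem_univ, true_and] at h1
      rw [hf]
      rcases lt_or_ge (a j) 0 with h0 | h0
      · by_cases hA' : j ∈ A <;> by_cases hB' : j ∈ B <;> simp_all <;> linarith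
      · have h0' : ¬ a j < 0 := not_lt.2 h0
        by_cases hA' : j ∈ A <;> by_cases hB' : j ∈ B <;> simp_all
    · have h1 : j ∈ A ↔ j ∈ B := by
        have := Finset.ext_iff.1 hAB j
        simpa [hj] using this
      simp [hf, h1]
  have h1 : f i ≤ ∑ j, f j := Finset.single_le_sum hnn (Finset.mem_univ i)
  have h2 : ∑ j, f j = signedSum a B - signedSum a A := by
    simp only [hf, signedSum, Finset.sum_sub_distrib]
  have h3 : f i = 2 * |a i| := by
    simp only [positivePart, Finset.mem_filter, Finset.mem_univ, true_and] at hiB hiA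
    rw [hf]
    rcases lt_or_ge (a i) 0 with h0 | h0
    · rw [abs_of_neg h0]
      simp only [h0, iff_true] at hiA hiB
      simp only [hiA, hiB, if_true, if_false]
      ring
    · rw [abs_of_nonneg h0]
      have h0' : ¬ a i < 0 := not_lt.2 h0
      simp only [h0', iff_false, not_not] at hiA hiB
      simp only [hiA, hiB, if_true, if_false]
      ring
  have h4 := hK i hiK
  have h5 := abs_le.1 hA
  have h6 := abs_le.1 hB
  linarith [h5.1, h6.2]

/-- The signs outside `K` are fixed in each of the `2 ^ (|ι| - |K|)` ways, and Sperner's theorem is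
applied on `K`. -/
lemma card_signedSum_le {a : ι → ℝ} {K : Finset ι} {r : ℝ} (hK : ∀ i ∈ K, 2 * r < |a i|) :
    (Finset.univ.filter fun A : Finset ι => |signedSum a A| ≤ 2 * r).card ≤
      K.card.choose (K.card / 2) * 2 ^ (Fintype.card ι - K.card) := by
  have hcard : (Kᶜ.powerset).card = 2 ^ (Fintype.card ι - K.card) := by
    rw [Finset.card_powerset, Finset.card_compl]
  rw [← hcard]
  refine Finset.card_le_mul_card_image_of_maps_to (f := fun A => A \ K) ?_ _ ?_
  · intro A _
    rw [Finset.mem_powerset]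
    intro i hi
    exact Finset.mem_compl.2 (Finset.mem_sdiff.1 hi).2
  · intro D _
    set 𝒜 := (Finset.univ.filter fun A : Finset ι => |signedSum a A| ≤ 2 * r).filter
      (fun A => A \ K = D) with h𝒜
    have hmem : ∀ A ∈ 𝒜, |signedSum a A| ≤ 2 * r ∧ A \ K = D := by
      intro A hA
      simpa [h𝒜] using hA
    have hinj : Set.InjOn (positivePart a K) (𝒜 : Set (Finset ι)) := by
      intro A hA B hB h
      ext i
      by_cases hi : i ∈ K
      · have := Finset.ext_iff.1 h ⟨i, hi⟩
        simp only [positivePart, Finset.mem_filter, Finset.mem_univ, true_and] at this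
        tauto
      · have := Finset.ext_iff.1 ((hmem A hA).2.trans (hmem B hB).2.symm) i
        simpa [hi] using this
    rw [← Finset.card_image_of_injOn hinj]
    have hanti : IsAntichain (· ⊆ ·) ((𝒜.image (positivePart a K) : Finset (Finset K)) :
        Set (Finset K)) := by
      intro S hS T hT hne hsub
      simp only [Finset.coe_image, Set.mem_image, Finset.mem_coe] at hS hT
      obtain ⟨A, hA, rfl⟩ := hS
      obtain ⟨B, hB, rfl⟩ := hT
      exact not_positivePart_lt hK ((hmem A hA).2.trans (hmem B hB).2.symm) (hmem A hA).1
        (hmem B hB).1 (lt_of_le_of_ne hsub hne)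
    have := hanti.sperner
    rwa [Fintype.card_coe] at this

end Counting

/-- An elementary substitute for Stirling's formula; the induction rests on `(2m+1)(2m+3) ≤
4(m+1)²`. -/
lemma centralBinom_sq_mul_le (m : ℕ) : m.centralBinom ^ 2 * (2 * m + 1) ≤ 16 ^ m := by
  induction m with
  | zero => simp
  | succ m ih =>
    have h := Nat.succ_mul_centralBinom_succ m
    have key : (m + 1) ^ 2 * ((m + 1).centralBinom ^ 2 * (2 * (m + 1) + 1)) ≤
        (m + 1) ^ 2 * 16 ^ (m + 1) := by
      calc (m + 1) ^ 2 * ((m + 1).centralBinom ^ 2 * (2 * (m + 1) + 1))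
          = ((m + 1) * (m + 1).centralBinom) ^ 2 * (2 * (m + 1) + 1) := by ring
        _ = (m.centralBinom ^ 2 * (2 * m + 1)) * (4 * ((2 * m + 1) * (2 * m + 3))) := by
            rw [h]; ring
        _ ≤ 16 ^ m * (16 * (m + 1) ^ 2) := by
            refine Nat.mul_le_mul ih ?_
            nlinarith
        _ = (m + 1) ^ 2 * 16 ^ (m + 1) := by ring
    exact Nat.le_of_mul_le_mul_left key (by positivity)

lemma tendsto_centralBinom_div : Tendsto (fun m : ℕ => (m.centralBinom : ℝ) / 4 ^ m) atTop (𝓝 0) := by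
  have h : ∀ m : ℕ, (m.centralBinom : ℝ) / 4 ^ m ≤ √(1 / (2 * m + 1)) := by
    intro m
    refine Real.le_sqrt_of_sq_le ?_
    rw [div_pow, div_le_div_iff₀ (by positivity) (by positivity)]
    have := centralBinom_sq_mul_le m
    have h2 : ((m.centralBinom : ℝ)) ^ 2 * (2 * m + 1) ≤ 16 ^ m := by exact_mod_cast this
    rw [← pow_mul, mul_comm m 2, pow_mul]
    norm_num
    exact h2
  refine squeeze_zero (fun m => by positivity) h ?_
  have : Tendsto (fun m : ℕ => (1 : ℝ) / (2 * m + 1)) atTop (𝓝 0) := by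
    refine tendsto_const_nhds.div_atTop ?_
    exact tendsto_atTop_add_const_right _ _
      (tendsto_natCast_atTop_atTop.const_mul_atTop two_pos)
  simpa using this.sqrt

/-! ### Anti-concentration of sums of independent variables -/

section AntiConcentration

variable {ι α : Type*} [Fintype ι] [DecidableEq ι] [MeasurableSpace α]

/-- Exchange the two components at the indices in `A`. -/
def swapAt (A : Finset ι) (w : ι → α × α) : ι → α × α :=
  fun i => if i ∈ A then (w i).swap else w i

lemma measurePreserving_swapAt (μ : Measure α) [IsProbabilityMeasure μ] (A : Finset ι) :
    MeasurePreserving (swapAt A) (Measure.pi fun _ : ι => μ.prod μ)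
      (Measure.pi fun _ : ι => μ.prod μ) := by
  refine measurePreserving_pi (fun _ : ι => μ.prod μ) (fun _ : ι => μ.prod μ)
    (f := fun i x => if i ∈ A then x.swap else x) fun i => ?_
  by_cases h : i ∈ A
  · simpa [h] using Measure.measurePreserving_swap
  · simp only [h, if_false]
    exact MeasurePreserving.id (μ.prod μ)

/-- The difference vector of two samples. -/
def diffVec (f : ι → α → ℝ) (w : ι → α × α) (i : ι) : ℝ := f i (w i).1 - f i (w i).2

lemma sum_diffVec_swapAt (f : ι → α → ℝ) (w : ι → α × α) (A : Finset ι) :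
    ∑ i, diffVec f (swapAt A w) i = signedSum (diffVec f w) A := by
  unfold signedSum
  refine Finset.sum_congr rfl fun i _ => ?_
  by_cases h : i ∈ A <;> simp [diffVec, swapAt, h]

open Classical in
/-- Half-weights on the indices where the two samples differ much. -/
def halfWeight (f : ι → α → ℝ) (J : Finset ι) (r : ℝ) (i : ι) (x : α × α) : ℝ :=
  if i ∈ J ∧ 2 * r < |f i x.1 - f i x.2| then 1 / 2 else 1

/-- Either at least `2m` indices of `J` have well-separated samples, and the Littlewood–Offord count
gives the first term, or fewer do. In that case `4 ^ m` times the product of half-weights is at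
least `1` and the bound is trivial. -/
lemma card_swap_le (f : ι → α → ℝ) (J : Finset ι) (r : ℝ) (m : ℕ) (w : ι → α × α) :
    ((Finset.univ.filter fun A : Finset ι => |∑ i, diffVec f (swapAt A w) i| ≤ 2 * r).card : ℝ) ≤
      2 ^ Fintype.card ι * ((m.centralBinom : ℝ) / 4 ^ m +
        4 ^ m * ∏ i, halfWeight f J r i (w i)) := by
  classical
  simp_rw [sum_diffVec_swapAt]
  set K := J.filter fun i => 2 * r < |diffVec f w i| with hK
  have hprod : ∏ i, halfWeight f J r i (w i) = (1 / 2) ^ K.card := by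
    have : ∀ i, halfWeight f J r i (w i) = if i ∈ K then 1 / 2 else 1 := by
      intro i
      unfold halfWeight
      by_cases h : i ∈ J ∧ 2 * r < |f i (w i).1 - f i (w i).2|
      · rw [if_pos h, if_pos (Finset.mem_filter.2 h)]
      · rw [if_neg h, if_neg fun h' => h (Finset.mem_filter.1 h')]
    simp_rw [this]
    rw [Finset.prod_ite_mem, Finset.univ_inter, Finset.prod_const]
  have hpos : 0 ≤ ∏ i, halfWeight f J r i (w i) := by rw [hprod]; positivity
  rcases le_or_gt (2 * m) K.card with h | h
  · obtain ⟨K', hK', hcard⟩ := Finset.exists_subset_card_eq h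
    have h1 := card_signedSum_le (a := diffVec f w) (K := K') (r := r) fun i hi =>
      (Finset.mem_filter.1 (hK' hi)).2
    rw [hcard, Nat.mul_div_cancel_left _ two_pos] at h1
    have hle : 2 * m ≤ Fintype.card ι := hcard ▸ K'.card_le_univ
    have h2 : ((m.centralBinom : ℝ) * 2 ^ (Fintype.card ι - 2 * m)) =
        2 ^ Fintype.card ι * ((m.centralBinom : ℝ) / 4 ^ m) := by
      have e : (2 : ℝ) ^ Fintype.card ι = 2 ^ (Fintype.card ι - 2 * m) * 4 ^ m := by
        rw [show (4 : ℝ) = 2 ^ 2 by norm_num, ← pow_mul, ← pow_add, Nat.sub_add_cancel hle]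
      rw [e]
      field_simp
    calc ((Finset.univ.filter fun A : Finset ι =>
          |signedSum (diffVec f w) A| ≤ 2 * r).card : ℝ)
        ≤ (m.centralBinom : ℝ) * 2 ^ (Fintype.card ι - 2 * m) := by exact_mod_cast h1
      _ = 2 ^ Fintype.card ι * ((m.centralBinom : ℝ) / 4 ^ m) := h2
      _ ≤ _ := by
          gcongr
          exact le_add_of_nonneg_right (by positivity)
  · have h1 : ((Finset.univ.filter fun A : Finset ι =>
        |signedSum (diffVec f w) A| ≤ 2 * r).card : ℝ) ≤ 2 ^ Fintype.card ι := by
      have := Finset.card_le_univ (Finset.univ.filter fun A : Finset ι =>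
        |signedSum (diffVec f w) A| ≤ 2 * r)
      rw [Fintype.card_finset] at this
      exact_mod_cast this
    refine h1.trans (le_mul_of_one_le_right (by positivity) ?_)
    have h2 : 1 ≤ 4 ^ m * ∏ i, halfWeight f J r i (w i) := by
      rw [hprod]
      calc (1 : ℝ) = 4 ^ m * (1 / 2) ^ (2 * m) := by
            rw [pow_mul, ← mul_pow]; norm_num
        _ ≤ 4 ^ m * (1 / 2) ^ K.card := by
            refine mul_le_mul_of_nonneg_left ?_ (by positivity)
            exact pow_le_pow_of_le_one (by norm_num) (by norm_num) h.le
    have : (0 : ℝ) ≤ (m.centralBinom : ℝ) / 4 ^ m := by positivity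
    linarith

lemma measurable_halfWeight {f : ι → α → ℝ} (hf : ∀ i, Measurable (f i)) (J : Finset ι) (r : ℝ)
    (i : ι) : Measurable (halfWeight f J r i) := by
  classical
  unfold halfWeight
  refine Measurable.ite ?_ measurable_const measurable_const
  by_cases h : i ∈ J
  · simp only [h, true_and]
    exact measurableSet_lt measurable_const
      (((hf i).comp measurable_fst).sub ((hf i).comp measurable_snd)).abs
  · simp [h]

lemma halfWeight_mem (f : ι → α → ℝ) (J : Finset ι) (r : ℝ) (i : ι) (x : α × α) :
    halfWeight f J r i x ∈ Set.Icc (0 : ℝ) 1 := by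
  unfold halfWeight
  split_ifs <;> constructor <;> norm_num

lemma integral_halfWeight_le (μ : Measure α) [IsProbabilityMeasure μ] {f : ι → α → ℝ}
    (hf : ∀ i, Measurable (f i)) {J : Finset ι} {r p : ℝ}
    (hp : ∀ j ∈ J, p ≤ (μ.prod μ).real {x | 2 * r < |f j x.1 - f j x.2|}) (i : ι) :
    ∫ x, halfWeight f J r i x ∂(μ.prod μ) ≤ if i ∈ J then 1 - p / 2 else 1 := by
  split_ifs with h
  · have hm : MeasurableSet {x : α × α | 2 * r < |f i x.1 - f i x.2|} :=
      measurableSet_lt measurable_const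
        (((hf i).comp measurable_fst).sub ((hf i).comp measurable_snd)).abs
    have e : ∀ x, halfWeight f J r i x =
        1 - 1 / 2 * ({x : α × α | 2 * r < |f i x.1 - f i x.2|}).indicator 1 x := by
      intro x
      by_cases hx : 2 * r < |f i x.1 - f i x.2|
      · simp [halfWeight, h, hx]; norm_num
      · simp [halfWeight, h, hx]
    simp_rw [e]
    rw [integral_sub (integrable_const _) (((integrable_const _).indicator hm).const_mul _),
      integral_const_mul, integral_indicator_one hm]
    have := hp i h
    simp
    linarith
  · have e : ∀ x, halfWeight f J r i x = 1 := by
      intro x; simp [halfWeight, h]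
    simp_rw [e]
    simp

/-- Symmetrisation: if two independent copies of the sum are both small, so is their difference. -/
lemma measureReal_sum_sq_le (μ : Measure α) [IsProbabilityMeasure μ] {f : ι → α → ℝ}
    (hf : ∀ i, Measurable (f i)) (r : ℝ) :
    ((Measure.pi fun _ : ι => μ).real {x | |∑ i, f i (x i)| ≤ r}) ^ 2 ≤
      (Measure.pi fun _ : ι => μ.prod μ).real {w | |∑ i, diffVec f w i| ≤ 2 * r} := by
  set E : Set (ι → α) := {x | |∑ i, f i (x i)| ≤ r} with hE
  have hmp := measurePreserving_arrowProdEquivProdArrow α α ι (fun _ => μ) (fun _ => μ)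
  have hEm : MeasurableSet E := measurableSet_le (Finset.measurable_sum _ fun i _ =>
    (hf i).comp (measurable_pi_apply i)).abs measurable_const
  rw [sq, ← measureReal_prod_prod, ← hmp.measureReal_preimage (hEm.prod hEm).nullMeasurableSet]
  refine measureReal_mono (fun w hw => ?_)
  obtain ⟨h1, h2⟩ := hw
  simp only [hE, Set.mem_ofPred_eq] at h1 h2 ⊢
  have : ∑ i, diffVec f w i = ∑ i, f i (w i).1 - ∑ i, f i (w i).2 := by
    simp [diffVec, Finset.sum_sub_distrib]
  rw [this]
  refine (abs_sub _ _).trans ?_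
  have h1' : |∑ i, f i (w i).1| ≤ r := h1
  have h2' : |∑ i, f i (w i).2| ≤ r := h2
  linarith

lemma measurable_sum_diffVec {f : ι → α → ℝ} (hf : ∀ i, Measurable (f i)) :
    Measurable fun w : ι → α × α => ∑ i, diffVec f w i := by
  refine Finset.measurable_sum _ fun i _ => ?_
  exact ((hf i).comp (measurable_fst.comp (measurable_pi_apply i))).sub
    ((hf i).comp (measurable_snd.comp (measurable_pi_apply i)))

/-- The law of the paired samples is invariant under swaps, so the probability equals its average
over all swap sets `A`. For fixed samples this average is a count of signs, and the half-weights
factorise by independence. -/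
theorem measureReal_diff_le (μ : Measure α) [IsProbabilityMeasure μ] {f : ι → α → ℝ}
    (hf : ∀ i, Measurable (f i)) {J : Finset ι} {r p : ℝ}
    (hp : ∀ j ∈ J, p ≤ (μ.prod μ).real {x | 2 * r < |f j x.1 - f j x.2|}) (m : ℕ) :
    (Measure.pi fun _ : ι => μ.prod μ).real {w | |∑ i, diffVec f w i| ≤ 2 * r} ≤
      (m.centralBinom : ℝ) / 4 ^ m + 4 ^ m * (1 - p / 2) ^ J.card := by
  classical
  set Q := Measure.pi fun _ : ι => μ.prod μ with hQ
  set F : Set (ι → α × α) := {w | |∑ i, diffVec f w i| ≤ 2 * r} with hF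
  have hFm : MeasurableSet F := measurableSet_le (measurable_sum_diffVec hf).abs measurable_const
  have h1 : ∀ A : Finset ι, ∫ w, F.indicator (1 : (ι → α × α) → ℝ) (swapAt A w) ∂Q = Q.real F := by
    intro A
    have := (measurePreserving_swapAt μ A).measureReal_preimage hFm.nullMeasurableSet
    rw [← this, ← integral_indicator_one ((measurePreserving_swapAt μ A).measurable hFm)]
    rfl
  have hint : ∀ A : Finset ι, Integrable (fun w => F.indicator (1 : (ι → α × α) → ℝ) (swapAt A w)) Q :=
    fun A => (measurePreserving_swapAt μ A).integrable_comp_of_integrable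
      ((integrable_const (1 : ℝ)).indicator hFm)
  have h2 : (2 : ℝ) ^ Fintype.card ι * Q.real F =
      ∫ w, ∑ A : Finset ι, F.indicator (1 : (ι → α × α) → ℝ) (swapAt A w) ∂Q := by
    rw [integral_finsetSum _ fun A _ => hint A]
    simp_rw [h1]
    rw [Finset.sum_const, Finset.card_univ, Fintype.card_finset, nsmul_eq_mul]
    push_cast
    rfl
  have h3 : ∀ w, ∑ A : Finset ι, F.indicator (1 : (ι → α × α) → ℝ) (swapAt A w) ≤
      2 ^ Fintype.card ι * ((m.centralBinom : ℝ) / 4 ^ m +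
        4 ^ m * ∏ i, halfWeight f J r i (w i)) := by
    intro w
    refine le_trans (le_of_eq ?_) (card_swap_le f J r m w)
    rw [Finset.card_filter]
    push_cast
    refine Finset.sum_congr rfl fun A _ => ?_
    simp [Set.indicator_apply, hF]
  have hwint : Integrable (fun w : ι → α × α => ∏ i, halfWeight f J r i (w i)) Q := by
    refine Integrable.of_bound (C := 1) ?_ (ae_of_all _ fun w => ?_)
    · exact (Finset.measurable_prod _ fun i _ =>
        (measurable_halfWeight hf J r i).comp (measurable_pi_apply i)).aestronglyMeasurable
    · rw [Real.norm_eq_abs, abs_of_nonneg (Finset.prod_nonneg fun i _ => (halfWeight_mem ..).1)]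
      exact Finset.prod_le_one (fun i _ => (halfWeight_mem ..).1) fun i _ => (halfWeight_mem ..).2
  have h4 : ∫ w : ι → α × α, ∏ i, halfWeight f J r i (w i) ∂Q ≤ (1 - p / 2) ^ J.card := by
    rw [hQ, integral_fintype_prod_eq_prod]
    calc ∏ i, ∫ x, halfWeight f J r i x ∂(μ.prod μ) ≤ ∏ i, (if i ∈ J then 1 - p / 2 else 1) :=
          Finset.prod_le_prod (fun i _ => integral_nonneg fun x => (halfWeight_mem ..).1)
            fun i _ => integral_halfWeight_le μ hf hp i
      _ = _ := by rw [Finset.prod_ite_mem, Finset.univ_inter, Finset.prod_const]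
  have h5 : (2 : ℝ) ^ Fintype.card ι * Q.real F ≤ 2 ^ Fintype.card ι *
      ((m.centralBinom : ℝ) / 4 ^ m + 4 ^ m * (1 - p / 2) ^ J.card) := by
    rw [h2]
    refine (integral_mono (integrable_finsetSum _ fun A _ => hint A) ?_ h3).trans ?_
    · exact ((integrable_const _).add (hwint.const_mul _)).const_mul _
    · rw [integral_const_mul, integral_add (integrable_const _) (hwint.const_mul _),
        integral_const_mul, integral_const]
      simp only [probReal_univ, one_smul]
      gcongr
  exact le_of_mul_le_mul_left h5 (by positivity)

end AntiConcentration

lemma exists_spread (μ : Measure ℂ) [IsProbabilityMeasure μ]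
    (hμ : ¬ ∃ c : ℂ, ∀ᵐ x ∂μ, x = c) :
    ∃ δ : ℝ, 0 < δ ∧ 0 < (μ.prod μ).real {x : ℂ × ℂ | δ < ‖x.1 - x.2‖} := by
  by_contra! h
  have h0 : ∀ k : ℕ, ∀ᵐ x ∂(μ.prod μ), ‖x.1 - x.2‖ ≤ 1 / ((k : ℝ) + 1) := by
    intro k
    have h1 : (μ.prod μ).real {x : ℂ × ℂ | 1 / ((k : ℝ) + 1) < ‖x.1 - x.2‖} = 0 :=
      le_antisymm (h _ (by positivity)) measureReal_nonneg
    rw [measureReal_eq_zero_iff] at h1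
    rw [ae_iff]
    simpa only [not_le] using h1
  have h1 : ∀ᵐ x ∂(μ.prod μ), x.1 = x.2 := by
    filter_upwards [ae_all_iff.2 h0] with x hx
    have : ‖x.1 - x.2‖ ≤ 0 := ge_of_tendsto' tendsto_one_div_add_atTop_nhds_zero_nat hx
    exact sub_eq_zero.1 (norm_le_zero_iff.1 this)
  obtain ⟨x, hx⟩ := (Measure.ae_ae_of_ae_prod h1).exists
  exact hμ ⟨x, hx.mono fun y hy => hy.symm⟩

lemma measureReal_norm_sum_le {ι : Type*} [Fintype ι] (μ : Measure ℂ) [IsProbabilityMeasure μ]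
    (φ : ℂ →L[ℝ] ℝ) (hφ : ∀ z, |φ z| ≤ ‖z‖) (b : ι → ℂ) {J : Finset ι} {r p : ℝ} (hp0 : 0 ≤ p)
    (hp1 : p ≤ 1) (hp : ∀ j ∈ J, p ≤ (μ.prod μ).real {x | 2 * r < |φ ((x.1 - x.2) * b j)|})
    (m : ℕ) {M : ℕ} (hM : M ≤ J.card) :
    ((Measure.pi fun _ : ι => μ).real {x | ‖∑ i, x i * b i‖ ≤ r}) ^ 2 ≤
      (m.centralBinom : ℝ) / 4 ^ m + 4 ^ m * (1 - p / 2) ^ M := by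
  classical
  set f : ι → ℂ → ℝ := fun i x => φ (x * b i) with hf
  have hfm : ∀ i, Measurable (f i) := fun i =>
    (φ.continuous.comp (continuous_id.mul continuous_const)).measurable
  have h1 : (Measure.pi fun _ : ι => μ).real {x | ‖∑ i, x i * b i‖ ≤ r} ≤
      (Measure.pi fun _ : ι => μ).real {x | |∑ i, f i (x i)| ≤ r} := by
    refine measureReal_mono fun x hx => ?_
    simp only [Set.mem_ofPred_eq] at hx ⊢
    simp only [hf]
    rw [← map_sum]
    exact (hφ _).trans hx
  have h2 := measureReal_sum_sq_le (ι := ι) μ hfm r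
  have h3 := measureReal_diff_le (ι := ι) (r := r) (J := J) (p := p) μ hfm
    (by simpa only [hf, ← map_sub, ← sub_mul] using hp) m
  calc _ ≤ ((Measure.pi fun _ : ι => μ).real {x | |∑ i, f i (x i)| ≤ r}) ^ 2 := by gcongr
    _ ≤ _ := h2
    _ ≤ _ := h3
    _ ≤ _ := by
      have := pow_le_pow_of_le_one (a := 1 - p / 2) (by linarith) (by linarith) hM
      gcongr

/-- The bound depends only on how many coefficients are large, not on `n` or on the remaining
coefficients. -/
theorem IsAdmissibleNoise.exists_anticoncentration {Ω : Type*} [MeasurableSpace Ω] {P : Measure Ω}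
    [IsProbabilityMeasure P] {ξ : ℕ → Ω → ℂ} (hξ : IsAdmissibleNoise P ξ) :
    ∃ c : ℝ, 0 < c ∧ ∀ ε : ℝ, 0 < ε → ∃ M : ℕ, ∀ (n : ℕ) (b : Fin n → ℂ) (B : ℝ)
      (J : Finset (Fin n)), 0 < B → M ≤ J.card → (∀ j ∈ J, B ≤ ‖b j‖) →
      P.real {ω | ‖∑ i : Fin n, ξ i ω * b i‖ ≤ c * B} ≤ ε := by
  classical
  set μ := P.map (ξ 0) with hμ
  have hμp : IsProbabilityMeasure μ :=
    Measure.isProbabilityMeasure_map (hξ.measurable 0).aemeasurable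
  have hnd : ¬ ∃ c : ℂ, ∀ᵐ x ∂μ, x = c := by
    rintro ⟨c, hc⟩
    exact hξ.nondegenerate ⟨c, ae_of_ae_map (hξ.measurable 0).aemeasurable hc⟩
  obtain ⟨δ, hδ, hp⟩ := exists_spread μ hnd
  set p := (μ.prod μ).real {x : ℂ × ℂ | δ < ‖x.1 - x.2‖} with hpdef
  have hp1 : p ≤ 1 := measureReal_le_one
  -- With `r = δ/4 * B`, a product of modulus above `δ B = 4r` has real or imaginary part above `2r`
  -- in modulus.
  refine ⟨δ / 4, by positivity, fun ε hε => ?_⟩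
  have hε2 : 0 < ε ^ 2 / 2 := by positivity
  obtain ⟨m, hm⟩ := (tendsto_centralBinom_div.eventually_lt_const hε2).exists
  have hlim : Tendsto (fun M : ℕ => (4 : ℝ) ^ m * (1 - p / 2 / 2) ^ M) atTop (𝓝 (4 ^ m * 0)) :=
    (tendsto_pow_atTop_nhds_zero_of_lt_one (by linarith) (by linarith)).const_mul _
  rw [mul_zero] at hlim
  obtain ⟨M, hM⟩ := (hlim.eventually_lt_const hε2).exists
  -- Each index of `J` is spread in its real or its imaginary part, so among `2 * M` indices at
  -- least `M` share the same type.
  refine ⟨2 * M, fun n b B J hB hJ hb => ?_⟩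
  set r := δ / 4 * B with hr
  have hlaw : P.map (fun ω (i : Fin n) => ξ i ω) = Measure.pi fun _ : Fin n => μ := by
    have hind : iIndepFun (fun i : Fin n => ξ i) P := hξ.indep.precomp Fin.val_injective
    rw [(iIndepFun_iff_map_fun_eq_pi_map fun i => (hξ.measurable _).aemeasurable).1 hind]
    congr 1
    ext1 i
    exact (hξ.identDistrib i).map_eq
  have hmeas : MeasurableSet {x : Fin n → ℂ | ‖∑ i, x i * b i‖ ≤ r} := by
    refine measurableSet_le (Continuous.measurable ?_) measurable_const
    fun_prop
  have hprob : P.real {ω | ‖∑ i : Fin n, ξ i ω * b i‖ ≤ r} =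
      (Measure.pi fun _ : Fin n => μ).real {x | ‖∑ i, x i * b i‖ ≤ r} := by
    rw [← hlaw, map_measureReal_apply (measurable_pi_lambda (fun ω (i : Fin n) => ξ i ω)
      fun i => hξ.measurable i) hmeas]
    rfl
  set S : (ℂ →L[ℝ] ℝ) → Fin n → Set (ℂ × ℂ) := fun φ j =>
    {x | 2 * r < |φ ((x.1 - x.2) * b j)|} with hS
  have hcover : ∀ j ∈ J, p / 2 ≤ (μ.prod μ).real (S Complex.reCLM j) ∨
      p / 2 ≤ (μ.prod μ).real (S Complex.imCLM j) := by
    intro j hj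
    have hsub : {x : ℂ × ℂ | δ < ‖x.1 - x.2‖} ⊆ S Complex.reCLM j ∪ S Complex.imCLM j := by
      intro x hx
      by_contra hcon
      simp only [hS, Set.mem_union, Set.mem_ofPred_eq, Complex.reCLM_apply, Complex.imCLM_apply,
        not_or, not_lt] at hcon
      have h1 := Complex.norm_le_abs_re_add_abs_im ((x.1 - x.2) * b j)
      rw [norm_mul] at h1
      have h2 : δ * B < ‖x.1 - x.2‖ * ‖b j‖ :=
        mul_lt_mul hx (hb j hj) hB (norm_nonneg _)
      have h3 : 4 * r = δ * B := by rw [hr]; ring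
      linarith [hcon.1, hcon.2]
    have h1 : p ≤ (μ.prod μ).real (S Complex.reCLM j ∪ S Complex.imCLM j) := measureReal_mono hsub
    have h2 := h1.trans (measureReal_union_le _ _)
    by_contra! h
    linarith [h.1, h.2]
  set J1 := J.filter fun j => p / 2 ≤ (μ.prod μ).real (S Complex.reCLM j)
  set J2 := J.filter fun j => p / 2 ≤ (μ.prod μ).real (S Complex.imCLM j)
  have hJ12 : J ⊆ J1 ∪ J2 := by
    intro j hj
    rcases hcover j hj with h | h
    · exact Finset.mem_union_left _ (Finset.mem_filter.2 ⟨hj, h⟩)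
    · exact Finset.mem_union_right _ (Finset.mem_filter.2 ⟨hj, h⟩)
  have hcard := (Finset.card_le_card hJ12).trans (Finset.card_union_le _ _)
  have hsq : ((Measure.pi fun _ : Fin n => μ).real {x | ‖∑ i, x i * b i‖ ≤ r}) ^ 2 ≤ ε ^ 2 := by
    have hfin : (m.centralBinom : ℝ) / 4 ^ m + 4 ^ m * (1 - p / 2 / 2) ^ M ≤ ε ^ 2 := by linarith
    rcases (by omega : M ≤ J1.card ∨ M ≤ J2.card) with h | h
    · exact (measureReal_norm_sum_le μ Complex.reCLM (fun z => Complex.abs_re_le_norm z) b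
        (by positivity) (by linarith) (fun j hj => (Finset.mem_filter.1 hj).2) m h).trans hfin
    · exact (measureReal_norm_sum_le μ Complex.imCLM (fun z => Complex.abs_im_le_norm z) b
        (by positivity) (by linarith) (fun j hj => (Finset.mem_filter.1 hj).2) m h).trans hfin
  rw [hprob]
  exact le_of_sq_le_sq hsq hε.le

end
end HeatZeros

namespace HeatZeros
noncomputable section

/-! ### The semicircle distribution -/

lemma integral_semicircle_eq_sqrt {t : ℝ} (ht : 0 < t) {F : ℂ → ℝ} (hF : Continuous F) :
    ∫ w, F w ∂(semicircle t) = (4 * Real.pi * t)⁻¹ * ∫ x : ℝ, 2 * √(4 * t - x ^ 2) * F x := by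
  have hd : Continuous fun x : ℝ => √(4 * t - x ^ 2) / (2 * Real.pi * t) := by fun_prop
  rw [semicircle, integral_map (by fun_prop) hF.aestronglyMeasurable,
    integral_withDensity_eq_integral_toReal_smul (by fun_prop)
      (ae_of_all _ fun x => ENNReal.ofReal_lt_top), ← integral_const_mul,
    setIntegral_eq_integral_of_forall_compl_eq_zero]
  · refine integral_congr_ae (ae_of_all _ fun x => ?_)
    simp only [smul_eq_mul]
    rw [ENNReal.toReal_ofReal (by positivity)]
    field_simp
    ring
  · intro x hx
    have : √(4 * t - x ^ 2) = 0 := by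
      refine Real.sqrt_eq_zero_of_nonpos ?_
      by_contra! h
      refine hx ?_
      have h2 : x ^ 2 < (2 * √t) ^ 2 := by
        rw [mul_pow, Real.sq_sqrt ht.le]; linarith
      have := abs_lt_of_sq_lt_sq' h2 (by positivity)
      exact ⟨by linarith [this.1], this.2.le⟩
    simp [this]

/-- Up to normalisation, the semicircle law is the projection to the real axis of the uniform law on
the disc of radius `2√t`. -/
lemma integral_disc_eq_sqrt (t : ℝ) {F : ℂ → ℝ} (hF : Continuous F) :
    ∫ p : ℝ × ℝ, Set.indicator {p : ℝ × ℝ | p.1 ^ 2 + p.2 ^ 2 < 4 * t} (fun p => F p.1) p =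
      ∫ x : ℝ, 2 * √(4 * t - x ^ 2) * F x := by
  have hopen : IsOpen {p : ℝ × ℝ | p.1 ^ 2 + p.2 ^ 2 < 4 * t} :=
    isOpen_lt (by fun_prop) continuous_const
  have hint : Integrable (Set.indicator {p : ℝ × ℝ | p.1 ^ 2 + p.2 ^ 2 < 4 * t}
      (fun p : ℝ × ℝ => F p.1)) := by
    rw [integrable_indicator_iff hopen.measurableSet]
    refine IntegrableOn.mono_set (t := Set.Icc (-(2 * √t)) (2 * √t) ×ˢ Set.Icc (-(2 * √t)) (2 * √t))
      ?_ ?_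
    · exact ContinuousOn.integrableOn_compact (isCompact_Icc.prod isCompact_Icc)
        (by fun_prop)
    · rintro ⟨x, y⟩ h
      simp only [Set.mem_ofPred_eq] at h
      have ht : 0 < t := by nlinarith [sq_nonneg x, sq_nonneg y]
      have h4 : (2 * √t) ^ 2 = 4 * t := by rw [mul_pow, Real.sq_sqrt ht.le]; ring
      have hx := abs_le_of_sq_le_sq' (a := x) (b := 2 * √t) (by nlinarith [sq_nonneg y]) (by positivity)
      have hy := abs_le_of_sq_le_sq' (a := y) (b := 2 * √t) (by nlinarith [sq_nonneg x]) (by positivity)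
      exact ⟨hx, hy⟩
  rw [Measure.volume_eq_prod] at hint ⊢
  rw [integral_prod _ hint]
  refine integral_congr_ae (ae_of_all _ fun x => ?_)
  have e : ∀ y : ℝ, Set.indicator {p : ℝ × ℝ | p.1 ^ 2 + p.2 ^ 2 < 4 * t}
      (fun p : ℝ × ℝ => F p.1) (x, y) =
      Set.indicator (Set.Ioo (-√(4 * t - x ^ 2)) (√(4 * t - x ^ 2))) (fun _ => F x) y := by
    intro y
    simp only [Set.indicator, Set.mem_ofPred_eq, Set.mem_Ioo, ← Real.sq_lt]
    congr 1
    exact propext ⟨fun h => by linarith, fun h => by linarith⟩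
  simp only [e]
  rw [integral_indicator measurableSet_Ioo, setIntegral_const, Measure.real, Real.volume_Ioo,
    ENNReal.toReal_ofReal (by linarith [Real.sqrt_nonneg (4 * t - x ^ 2)]), smul_eq_mul]
  ring

lemma circleAverage_re (F : ℂ → ℝ) (ρ : ℝ) :
    ∫ θ in Set.Ioo (-Real.pi) Real.pi, F ((ρ * Real.cos θ : ℝ) : ℂ) =
      2 * Real.pi * Real.circleAverage (fun ζ => F ((ρ * ζ.re : ℝ) : ℂ)) 0 1 := by
  have hper : Function.Periodic (fun θ : ℝ => F ((ρ * Real.cos θ : ℝ) : ℂ)) (2 * Real.pi) :=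
    fun θ => by simp [Real.cos_add_two_pi]
  rw [← integral_Ioc_eq_integral_Ioo, ← intervalIntegral.integral_of_le (by linarith [Real.pi_pos])]
  have := hper.intervalIntegral_add_eq (-Real.pi) 0
  rw [show -Real.pi + 2 * Real.pi = Real.pi by ring, zero_add] at this
  rw [this, Real.circleAverage]
  have hre : ∀ θ : ℝ, (circleMap 0 1 θ).re = Real.cos θ := fun θ => by
    simp [circleMap, Complex.exp_ofReal_mul_I_re]
  simp only [hre, smul_eq_mul]
  field_simp

lemma integral_disc_eq_circleAverage {t : ℝ} (ht : 0 < t) {F : ℂ → ℝ} (hF : Continuous F) :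
    ∫ p : ℝ × ℝ, Set.indicator {p : ℝ × ℝ | p.1 ^ 2 + p.2 ^ 2 < 4 * t} (fun p => F p.1) p =
      ∫ ρ in Set.Ioo 0 (2 * √t),
        2 * Real.pi * ρ * Real.circleAverage (fun ζ => F ((ρ * ζ.re : ℝ) : ℂ)) 0 1 := by
  have hsq : ∀ ρ : ℝ, 0 < ρ → (ρ ^ 2 < 4 * t ↔ ρ < 2 * √t) := by
    intro ρ hρ
    rw [show (4 : ℝ) * t = (2 * √t) ^ 2 by rw [mul_pow, Real.sq_sqrt ht.le]; ring]
    exact pow_lt_pow_iff_left₀ hρ.le (by positivity) two_ne_zero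
  have hval : ∀ p : ℝ × ℝ, Set.indicator {p : ℝ × ℝ | p.1 ^ 2 + p.2 ^ 2 < 4 * t}
      (fun p : ℝ × ℝ => F p.1) (polarCoord.symm p) =
      if p.1 ^ 2 < 4 * t then F ((p.1 * Real.cos p.2 : ℝ) : ℂ) else 0 := by
    intro p
    simp only [Set.indicator, polarCoord_symm_apply, Set.mem_ofPred_eq]
    congr 1
    rw [show (p.1 * Real.cos p.2) ^ 2 + (p.1 * Real.sin p.2) ^ 2 = p.1 ^ 2 by
      nlinarith [Real.sin_sq_add_cos_sq p.2]]
  rw [← integral_comp_polarCoord_symm, polarCoord_target]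
  rw [setIntegral_eq_of_subset_of_forall_sdiff_eq_zero
    (s := Set.Ioo 0 (2 * √t) ×ˢ Set.Ioo (-Real.pi) Real.pi)
    (measurableSet_Ioi.prod measurableSet_Ioo)
    (Set.prod_mono Set.Ioo_subset_Ioi_self subset_rfl)]
  · rw [setIntegral_congr_fun (g := fun p : ℝ × ℝ => p.1 * F ((p.1 * Real.cos p.2 : ℝ) : ℂ))
      (measurableSet_Ioo.prod measurableSet_Ioo), Measure.volume_eq_prod, setIntegral_prod]
    · refine setIntegral_congr_fun measurableSet_Ioo fun ρ _ => ?_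
      simp only
      rw [integral_const_mul, circleAverage_re]
      ring
    · refine IntegrableOn.mono_set (t := Set.Icc 0 (2 * √t) ×ˢ Set.Icc (-Real.pi) Real.pi) ?_
        (Set.prod_mono Set.Ioo_subset_Icc_self Set.Ioo_subset_Icc_self)
      exact ContinuousOn.integrableOn_compact (isCompact_Icc.prod isCompact_Icc)
        (Continuous.continuousOn (by fun_prop))
    · rintro ⟨ρ, θ⟩ ⟨hρ, -⟩
      simp only [hval, smul_eq_mul]
      rw [if_pos ((hsq ρ hρ.1).2 hρ.2)]
  · rintro ⟨ρ, θ⟩ ⟨⟨hρ, hθ⟩, h⟩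
    simp only [hval, smul_eq_mul]
    rw [if_neg, mul_zero]
    intro h'
    exact h ⟨⟨hρ, (hsq ρ hρ).1 h'⟩, hθ⟩

/-- Polar coordinates on the disc exhibit the semicircle law as a mixture, with density `ρ / (2t)`,
of the arcsine laws of `ρ cos θ`. -/
lemma integral_semicircle {t : ℝ} (ht : 0 < t) {F : ℂ → ℝ} (hF : Continuous F) :
    ∫ w, F w ∂(semicircle t) = ∫ ρ in Set.Ioo 0 (2 * √t),
      ρ / (2 * t) * Real.circleAverage (fun ζ => F ((ρ * ζ.re : ℝ) : ℂ)) 0 1 := by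
  rw [integral_semicircle_eq_sqrt ht hF, ← integral_disc_eq_sqrt t hF,
    integral_disc_eq_circleAverage ht hF, ← integral_const_mul]
  refine integral_congr_ae (ae_of_all _ fun ρ => ?_)
  have := Real.pi_pos
  simp only
  field_simp
  norm_num

lemma isFiniteMeasure_semicircle (t : ℝ) : IsFiniteMeasure (semicircle t) := by
  have : IsFiniteMeasure ((volume.restrict (Set.Icc (-2 * √t) (2 * √t))).withDensity fun x =>
      ENNReal.ofReal (√(4 * t - x ^ 2) / (2 * Real.pi * t))) := by
    refine isFiniteMeasure_withDensity_ofReal (Integrable.hasFiniteIntegral ?_)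
    exact (Continuous.continuousOn (by fun_prop)).integrableOn_compact isCompact_Icc
  rw [semicircle]
  infer_instance

lemma isProbabilityMeasure_semicircle {t : ℝ} (ht : 0 < t) :
    IsProbabilityMeasure (semicircle t) := by
  have := isFiniteMeasure_semicircle t
  have h := integral_semicircle ht (F := fun _ => 1) continuous_const
  have h2 : ∫ ρ in Set.Ioo 0 (2 * √t), ρ / (2 * t) *
      Real.circleAverage (fun _ => (1 : ℝ)) 0 1 = 1 := by
    simp only [Real.circleAverage_const, mul_one]
    rw [← integral_Ioc_eq_integral_Ioo, ← intervalIntegral.integral_of_le (by positivity),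
      intervalIntegral.integral_div, integral_id, mul_pow, Real.sq_sqrt ht.le]
    field_simp
    ring
  rw [h2, integral_const, smul_eq_mul, mul_one] at h
  exact ⟨by simpa [Measure.real, ENNReal.toReal_eq_one_iff] using h⟩

lemma semicircle_im_ne_zero (t : ℝ) : semicircle t {z : ℂ | z.im ≠ 0} = 0 := by
  rw [semicircle, Measure.map_apply (by fun_prop)]
  · simp
  · exact (isOpen_ne_fun Complex.continuous_im continuous_const).measurableSet

/-- The substitution `β = ρ² / (4t)` produces the same mixing density as for the arcsine laws. -/
lemma hermitePot_one_eq {t : ℝ} (ht : 0 < t) (z : ℂ) :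
    hermitePot t 1 z = ∫ ρ in Set.Ioo 0 (2 * √t), ρ / (2 * t) * Real.log (jouk (ρ ^ 2 / 4) z) := by
  have himg : (fun ρ : ℝ => ρ ^ 2 / (4 * t)) '' Set.Ioo 0 (2 * √t) = Set.Ioo 0 1 := by
    ext β
    constructor
    · rintro ⟨ρ, hρ, rfl⟩
      refine ⟨by have := hρ.1; positivity, ?_⟩
      rw [div_lt_one (by positivity)]
      calc ρ ^ 2 < (2 * √t) ^ 2 := pow_lt_pow_left₀ hρ.2 hρ.1.le two_ne_zero
        _ = 4 * t := by rw [mul_pow, Real.sq_sqrt ht.le]; ring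
    · intro h
      refine ⟨2 * √(t * β), ⟨?_, ?_⟩, ?_⟩
      · have := Real.sqrt_pos.2 (mul_pos ht h.1); positivity
      · have := Real.sqrt_lt_sqrt (mul_pos ht h.1).le (mul_lt_of_lt_one_right ht h.2)
        linarith
      · simp only [mul_pow, Real.sq_sqrt (mul_pos ht h.1).le]
        field_simp
        ring
  have hinj : Set.InjOn (fun ρ : ℝ => ρ ^ 2 / (4 * t)) (Set.Ioo 0 (2 * √t)) := by
    intro a ha b hb h
    simp only at h
    have h' : a ^ 2 = b ^ 2 := by field_simp at h; exact h
    exact (pow_left_inj₀ ha.1.le hb.1.le two_ne_zero).1 h'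
  rw [hermitePot, intervalIntegral.integral_of_le zero_le_one, integral_Ioc_eq_integral_Ioo, ← himg,
    integral_image_eq_integral_abs_deriv_smul (f' := fun ρ => ρ / (2 * t)) measurableSet_Ioo
      (fun ρ _ => ?_) hinj]
  · refine setIntegral_congr_fun measurableSet_Ioo fun ρ hρ => ?_
    simp only [smul_eq_mul]
    rw [abs_of_nonneg (by have := hρ.1; positivity), show t * (ρ ^ 2 / (4 * t)) = ρ ^ 2 / 4 by
      field_simp]
  · refine HasDerivAt.hasDerivWithinAt ?_
    have := ((hasDerivAt_id ρ).pow 2).div_const (4 * t)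
    simp only [id_eq] at this
    refine (this.congr_deriv ?_)
    field_simp
    push_cast
    ring

/-- The potential of an arcsine law. On the unit circle `z - ρ Re ζ = -(ρ/2)(ζ - u)(ζ - u⁻¹)/ζ` with
`|u| ≥ 1`, and Jensen's formula leaves `log (ρ |u| / 2)`, the logarithm of the larger root's
modulus. -/
lemma circleAverage_log_jouk {ρ : ℝ} (hρ : 0 < ρ) (z : ℂ) {r : ℕ → ℝ} (hr0 : ∀ k, 0 < r k)
    (hr1 : ∀ k, r k ≤ 1) (hr : Tendsto r atTop (𝓝 0)) :
    Tendsto (fun k => Real.circleAverage (fun ζ => logKer (r k) (z - (ρ * ζ.re : ℝ))) 0 1) atTop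
      (𝓝 (Real.log (jouk (ρ ^ 2 / 4) z))) := by
  obtain ⟨w, hw0, hw, rfl⟩ := exists_jouk_root (c := ρ ^ 2 / 4) (by positivity) z
  have hw' : ρ / 2 ≤ ‖w‖ := by
    exact (sq_le_sq₀ (by positivity) (norm_nonneg _)).1 (hw.trans_eq' (by ring))
  have hρ' : (ρ : ℂ) ≠ 0 := by exact_mod_cast hρ.ne'
  set u : ℂ := 2 * w / ρ with hu
  have hun : 1 ≤ ‖u‖ := by
    rw [hu, norm_div, norm_mul, Complex.norm_real, Real.norm_of_nonneg hρ.le, Complex.norm_ofNat,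
      le_div_iff₀ hρ]
    linarith
  have hu0 : u ≠ 0 := norm_pos_iff.1 (by linarith)
  have hwu : w = ρ * u / 2 := by rw [hu]; field_simp
  have hfac : ∀ ζ : ℂ, ‖ζ‖ = 1 → w + ((ρ ^ 2 / 4 : ℝ) : ℂ) / w - (ρ * ζ.re : ℝ) =
      -(ρ / 2 * ((ζ - u) * (ζ - u⁻¹)) * ζ⁻¹) := by
    intro ζ hζ
    have hζ0 : ζ ≠ 0 := norm_pos_iff.1 (by rw [hζ]; norm_num)
    have hre : (ζ.re : ℂ) = (ζ + ζ⁻¹) / 2 := by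
      rw [Complex.re_eq_add_conj, Complex.inv_def, Complex.normSq_eq_norm_sq, hζ]
      simp
    push_cast
    rw [hre, hwu]
    field_simp
    ring
  set z : ℂ := w + ((ρ ^ 2 / 4 : ℝ) : ℂ) / w with hz
  have hval : Real.log (jouk (ρ ^ 2 / 4) z) =
      Real.circleAverage (fun ζ => Real.log (ρ / 2) + Real.log ‖ζ - u‖ + Real.log ‖ζ - u⁻¹‖) 0 1 := by
    rw [Real.circleAverage_fun_add (f₁ := fun ζ => Real.log (ρ / 2) + Real.log ‖ζ - u‖)
        ((circleIntegrable_const _ _ _).add (circleIntegrable_log_norm_sub_const 1)) (circleIntegrable_log_norm_sub_const 1),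
      Real.circleAverage_fun_add (circleIntegrable_const _ _ _)
        (circleIntegrable_log_norm_sub_const 1), Real.circleAverage_const,
      circleAverage_log_norm_sub one_pos, circleAverage_log_norm_sub one_pos,
      logKer_of_le (by simpa using hun),
      logKer_of_ge (by simpa using inv_le_one_of_one_le₀ hun), Real.log_one, add_zero,
      zero_sub, norm_neg, ← Real.log_mul (by positivity) (by positivity),
      hz, jouk_eq_norm (by positivity) hw0 hw, hwu]
    congr 1
    simp only [norm_div, norm_mul, Complex.norm_real, Real.norm_of_nonneg hρ.le, Complex.norm_ofNat]
    ring
  have hcont : ∀ s : ℝ, 0 < s → Continuous fun ζ : ℂ => logKer s (z - (ρ * ζ.re : ℝ)) :=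
    fun s hs => (continuous_logKer hs).comp (by fun_prop)
  have hlog : ∀ᵐ θ : ℝ, z - (ρ * (circleMap 0 1 θ).re : ℝ) ≠ 0 ∧
      Real.log ‖z - (ρ * (circleMap 0 1 θ).re : ℝ)‖ = Real.log (ρ / 2) +
        Real.log ‖circleMap 0 1 θ - u‖ + Real.log ‖circleMap 0 1 θ - u⁻¹‖ := by
    filter_upwards [ae_circleMap_notMem (Set.countable_singleton u) 0 one_ne_zero,
      ae_circleMap_notMem (Set.countable_singleton u⁻¹) 0 one_ne_zero] with θ h1 h2
    have hn : ‖circleMap 0 1 θ‖ = 1 := by simp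
    have h1' := sub_ne_zero.2 h1
    have h2' := sub_ne_zero.2 h2
    have h0 : circleMap 0 1 θ ≠ 0 := norm_pos_iff.1 (by rw [hn]; norm_num)
    rw [hfac _ hn]
    refine ⟨?_, ?_⟩
    · exact neg_ne_zero.2 (mul_ne_zero (mul_ne_zero (div_ne_zero hρ' two_ne_zero)
        (mul_ne_zero h1' h2')) (inv_ne_zero h0))
    · rw [norm_neg, norm_mul, norm_mul, norm_mul, norm_inv, hn, inv_one, mul_one, norm_div,
        Complex.norm_real, Real.norm_of_nonneg hρ.le, Complex.norm_ofNat,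
        Real.log_mul (by positivity) (mul_ne_zero (norm_ne_zero_iff.2 h1') (norm_ne_zero_iff.2 h2')),
        Real.log_mul (norm_ne_zero_iff.2 h1') (norm_ne_zero_iff.2 h2'), add_assoc]
  rw [hval]
  have hci : ∀ v : ℂ, CircleIntegrable (fun ζ => |Real.log ‖ζ - v‖|) 0 1 := fun v =>
    (circleIntegrable_log_norm_sub_const 1).abs
  refine tendsto_circleAverage_of_dominated
    (b := fun ζ => |Real.log (ρ / 2)| + |Real.log ‖ζ - u‖| + |Real.log ‖ζ - u⁻¹‖| +
      |logKer 1 (z - (ρ * ζ.re : ℝ))|) (fun k => ?_) ?_ (fun k => ?_) ?_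
  · exact circleIntegrable_of_continuous (hcont _ (hr0 k)) _ _
  · exact (((circleIntegrable_const _ _ _).add (hci u)).add (hci u⁻¹)).add
      (circleIntegrable_of_continuous (hcont 1 one_pos).abs _ _)
  · filter_upwards [hlog] with θ hθ
    have h1 := log_norm_le_logKer (r := r k) hθ.1
    have h2 := logKer_mono (hr0 k) (hr1 k) (z - (ρ * (circleMap 0 1 θ).re : ℝ))
    rw [hθ.2] at h1
    rw [abs_le]
    constructor
    · linarith [neg_abs_le (Real.log (ρ / 2)), neg_abs_le (Real.log ‖circleMap 0 1 θ - u‖),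
        neg_abs_le (Real.log ‖circleMap 0 1 θ - u⁻¹‖),
        abs_nonneg (logKer 1 (z - (ρ * (circleMap 0 1 θ).re : ℝ)))]
    · linarith [le_abs_self (logKer 1 (z - (ρ * (circleMap 0 1 θ).re : ℝ))),
        abs_nonneg (Real.log (ρ / 2)), abs_nonneg (Real.log ‖circleMap 0 1 θ - u‖),
        abs_nonneg (Real.log ‖circleMap 0 1 θ - u⁻¹‖)]
  · filter_upwards [hlog] with θ hθ
    rw [← hθ.2]
    exact tendsto_logKer_nhdsGT hθ.1 hr

lemma continuous_circleAverage_re {F : ℂ → ℝ} (hF : Continuous F) :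
    Continuous fun ρ : ℝ => Real.circleAverage (fun ζ => F ((ρ * ζ.re : ℝ) : ℂ)) 0 1 := by
  unfold Real.circleAverage
  refine Continuous.const_smul
    (intervalIntegral.continuous_parametric_intervalIntegral_of_continuous'
      (μ := volume) (f := fun (ρ : ℝ) θ => F ((ρ * (circleMap 0 1 θ).re : ℝ) : ℂ)) ?_ 0 (2 * Real.pi)) ((2 * Real.pi)⁻¹)
  exact hF.comp (by
    simp only [circleMap]
    fun_prop)

theorem exists_isRieszMeasure_semicircle {t : ℝ} (ht : 0 < t) :
    ∃ L, IsRieszMeasure (hermitePot t 1) (semicircle t) L := by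
  have := isProbabilityMeasure_semicircle ht
  set A : (ℂ → ℝ) → ℝ → ℝ := fun F ρ =>
    Real.circleAverage (fun ζ => F ((ρ * ζ.re : ℝ) : ℂ)) 0 1 with hA
  have hAc : ∀ F, Continuous F → Continuous (A F) := fun F hF => continuous_circleAverage_re hF
  have hci : ∀ F : ℂ → ℝ, Continuous F → ∀ ρ : ℝ,
      CircleIntegrable (fun ζ : ℂ => F ((ρ * ζ.re : ℝ) : ℂ)) 0 1 := fun F hF ρ =>
    circleIntegrable_of_continuous (by fun_prop) _ _
  have hi : ∀ F, Continuous F →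
      IntegrableOn (fun ρ => ρ / (2 * t) * A F ρ) (Set.Ioo 0 (2 * √t)) := by
    intro F hF
    have h1 := hAc F hF
    refine IntegrableOn.mono_set (t := Set.Icc 0 (2 * √t)) ?_ Set.Ioo_subset_Icc_self
    exact ContinuousOn.integrableOn_compact isCompact_Icc (Continuous.continuousOn (by fun_prop))
  have hk : ∀ s : ℝ, 0 < s → ∀ z : ℂ, Continuous fun w => logKer s (z - w) := fun s hs z =>
    (continuous_logKer hs).comp (by fun_prop)
  set L : ℝ := ∫ ρ in Set.Ioo 0 (2 * √t), ρ / (2 * t) * A (logKer 1) ρ with hL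
  refine ⟨L, isRieszMeasure_of_tendsto (continuous_hermitePot ht ⟨zero_le_one, le_rfl⟩) fun z => ?_⟩
  set r : ℕ → ℝ := fun k => 1 / ((k : ℝ) + 1) with hrdef
  have hr0 : ∀ k, 0 < r k := fun k => by positivity
  have hr1 : ∀ k, r k ≤ 1 := fun k => by
    rw [hrdef]; exact (div_le_one (by positivity)).2 (by linarith [(Nat.cast_nonneg k : (0:ℝ) ≤ k)])
  have hranti : Antitone r := fun a b hab => by
    simp only [hrdef]; gcongr
  have hr : Tendsto r atTop (𝓝 0) := tendsto_one_div_add_atTop_nhds_zero_nat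
  have e : ∀ k, L + truncPotential (semicircle t) (r k) z =
      ∫ ρ in Set.Ioo 0 (2 * √t), ρ / (2 * t) * A (fun w => logKer (r k) (z - w)) ρ := by
    intro k
    rw [truncPotential, integral_semicircle ht (F := fun w => logKer (r k) (z - w) - logKer 1 w)
        ((hk _ (hr0 k) z).sub (continuous_logKer one_pos)),
      ← eq_sub_iff_add_eq', hL, ← integral_sub (hi _ (hk _ (hr0 k) z))
        (hi _ (continuous_logKer one_pos))]
    refine integral_congr_ae (ae_of_all _ fun ρ => ?_)
    simp only [hA]
    rw [Real.circleAverage_fun_sub (hci _ (hk _ (hr0 k) z) ρ)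
      (hci _ (continuous_logKer one_pos) ρ), mul_sub]
  change Tendsto (fun k => L + truncPotential (semicircle t) (r k) z) atTop _
  simp_rw [e, hermitePot_one_eq ht]
  have hlim : ∀ ρ : ℝ, 0 < ρ → Tendsto (fun k => A (fun w => logKer (r k) (z - w)) ρ) atTop
      (𝓝 (Real.log (jouk (ρ ^ 2 / 4) z))) := fun ρ hρ => circleAverage_log_jouk hρ z hr0 hr1 hr
  have hanti : ∀ ρ, ∀ s s', 0 < s → s ≤ s' →
      A (fun w => logKer s (z - w)) ρ ≤ A (fun w => logKer s' (z - w)) ρ :=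
    fun ρ s s' hs hss => Real.circleAverage_mono (hci _ (hk _ hs z) ρ)
      (hci _ (hk _ (hs.trans_le hss) z) ρ) fun ζ _ => logKer_mono hs hss _
  -- The averages are bounded below only by `log (ρ / 2)`, singular at `0`, but the weight `ρ` turns
  -- this into the continuous function `ρ log (ρ / 2)`.
  refine tendsto_integral_of_dominated_convergence
    (fun ρ => (2 * t)⁻¹ * (2 * |ρ / 2 * Real.log (ρ / 2)| +
      |ρ * A (fun w => logKer 1 (z - w)) ρ|)) (fun k => (hi _ (hk _ (hr0 k) z)).1) ?_
    (fun k => ?_) ?_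
  · refine IntegrableOn.mono_set (t := Set.Icc 0 (2 * √t)) ?_ Set.Ioo_subset_Icc_self
    refine ContinuousOn.integrableOn_compact isCompact_Icc (Continuous.continuousOn ?_)
    have h1 := hAc _ (hk 1 one_pos z)
    have h2 : Continuous fun ρ : ℝ => ρ / 2 * Real.log (ρ / 2) :=
      Real.continuous_mul_log.comp (f := fun ρ : ℝ => ρ / 2) (by fun_prop)
    fun_prop
  · refine (ae_restrict_iff' measurableSet_Ioo).2 (ae_of_all _ fun ρ hρ => ?_)
    have hρ0 : 0 < ρ := hρ.1
    have h1 : Real.log (ρ / 2) ≤ A (fun w => logKer (r k) (z - w)) ρ := by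
      have hh := half_log_le_log_jouk (c := ρ ^ 2 / 4) (by positivity) z
      rw [show ρ ^ 2 / 4 = (ρ / 2) ^ 2 by ring, Real.log_pow] at hh
      refine le_trans ?_ (le_of_tendsto (hlim ρ hρ0) ?_)
      · rw [show ρ ^ 2 / 4 = (ρ / 2) ^ 2 by ring]
        push_cast at hh
        linarith
      · filter_upwards [eventually_ge_atTop k] with j hj
        exact hanti ρ _ _ (hr0 j) (hranti hj)
    have h2 := hanti ρ _ _ (hr0 k) (hr1 k)
    have h3 : |A (fun w => logKer (r k) (z - w)) ρ| ≤
        |Real.log (ρ / 2)| + |A (fun w => logKer 1 (z - w)) ρ| := by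
      rw [abs_le]
      constructor
      · linarith [neg_abs_le (Real.log (ρ / 2)), abs_nonneg (A (fun w => logKer 1 (z - w)) ρ)]
      · linarith [le_abs_self (A (fun w => logKer 1 (z - w)) ρ), abs_nonneg (Real.log (ρ / 2))]
    rw [Real.norm_eq_abs, abs_mul, abs_mul, abs_mul, abs_of_pos (show 0 < ρ / (2 * t) by positivity),
      abs_of_pos (show 0 < ρ / 2 by positivity), abs_of_pos hρ0]
    calc ρ / (2 * t) * |A (fun w => logKer (r k) (z - w)) ρ|
        ≤ ρ / (2 * t) * (|Real.log (ρ / 2)| + |A (fun w => logKer 1 (z - w)) ρ|) := by gcongr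
      _ = _ := by field_simp
  · refine (ae_restrict_iff' measurableSet_Ioo).2 (ae_of_all _ fun ρ hρ => ?_)
    exact (hlim ρ hρ.1).const_mul _

end
end HeatZeros

namespace HeatZeros
noncomputable section

/-! ### Bounds for the evolved polynomials -/

/-- The polynomial with coefficients `x k * a n k`, evolved by the heat flow up to time `t / n`. -/
def flowPoly (a : ℕ → ℕ → ℂ) (t : ℝ) (n : ℕ) (x : ℕ → ℂ) : ℂ[X] :=
  heatFlow ((t : ℂ) / (n : ℂ)) (∑ k ∈ Finset.range (n + 1), C (x k * a n k) * X ^ k)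

/-- The value at `z` of the `k`-th summand of `flowPoly`, up to the noise. -/
def flowCoeff (a : ℕ → ℕ → ℂ) (t : ℝ) (n : ℕ) (z : ℂ) (k : ℕ) : ℂ :=
  a n k * (hermitePoly ((t / n : ℝ) : ℂ) k).eval z

lemma eval_flowPoly (a : ℕ → ℕ → ℂ) (t : ℝ) (n : ℕ) (x : ℕ → ℂ) (z : ℂ) :
    (flowPoly a t n x).eval z = ∑ k ∈ Finset.range (n + 1), x k * flowCoeff a t n z k := by
  rw [flowPoly, heatFlow_sum, eval_finsetSum]
  refine Finset.sum_congr rfl fun k _ => ?_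
  rw [eval_mul, eval_C, flowCoeff]
  push_cast
  ring

lemma natDegree_flowPoly_le (a : ℕ → ℕ → ℂ) (t : ℝ) (n : ℕ) (x : ℕ → ℂ) :
    (flowPoly a t n x).natDegree ≤ n :=
  (natDegree_heatFlow_le _ _).trans (natDegree_sum_C_mul_X_pow_le _ _)

lemma eventually_add_one_le_exp {ε : ℝ} (hε : 0 < ε) :
    ∀ᶠ n : ℕ in atTop, (n : ℝ) + 1 ≤ Real.exp (n * ε) := by
  have h := (tendsto_natCast_atTop_atTop (R := ℝ)).eventually_ge_atTop (2 / ε ^ 2)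
  filter_upwards [h] with n hn
  have h1 := Real.quadratic_le_exp_of_nonneg (x := n * ε) (by positivity)
  have h2 : 2 ≤ n * ε ^ 2 := by rwa [div_le_iff₀ (by positivity)] at hn
  have h3 : (n : ℝ) ≤ (n * ε) ^ 2 / 2 := by
    nlinarith [mul_le_mul_of_nonneg_left h2 (Nat.cast_nonneg (α := ℝ) n)]
  nlinarith [mul_nonneg (Nat.cast_nonneg (α := ℝ) n) hε.le]

variable {a : ℕ → ℕ → ℂ} {g : ℝ → ℝ} {t : ℝ}

lemma natCast_div_mem_Icc {n k : ℕ} (hk : k ≤ n) : (k : ℝ) / n ∈ Set.Icc (0 : ℝ) 1 :=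
  ⟨by positivity, div_le_one_of_le₀ (by exact_mod_cast hk) (by positivity)⟩

lemma eventually_flowCoeff_close (ha : HasExponentialProfile a g) (ht : 0 < t) {z : ℂ}
    (hz : z.im ≠ 0) {ε : ℝ} (hε : 0 < ε) : ∀ᶠ n : ℕ in atTop, ∀ k ≤ n,
      Real.exp (n * (g (k / n) + hermitePot t (k / n) z - ε)) ≤ ‖flowCoeff a t n z k‖ ∧
      ‖flowCoeff a t n z k‖ ≤ Real.exp (n * (g (k / n) + hermitePot t (k / n) z + ε)) := by
  filter_upwards [ha.profile (ε / 2) (half_pos hε), eventually_hermite_close hz ht (half_pos hε),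
    eventually_gt_atTop 0] with n h1 h2 hn k hk
  have hn' : (0 : ℝ) < n := by exact_mod_cast hn
  obtain ⟨ha0, h1⟩ := h1 k hk
  obtain ⟨hh0, h2⟩ := h2 k hk
  rw [abs_le] at h1 h2
  have h0 : 0 < ‖flowCoeff a t n z k‖ := norm_pos_iff.2 (mul_ne_zero ha0 hh0)
  have hlog : Real.log ‖flowCoeff a t n z k‖ = n * (1 / (n : ℝ) * Real.log ‖a n k‖ +
      1 / (n : ℝ) * Real.log ‖(hermitePoly ((t / n : ℝ) : ℂ) k).eval z‖) := by
    rw [flowCoeff, norm_mul, Real.log_mul (norm_ne_zero_iff.2 ha0) (norm_ne_zero_iff.2 hh0)]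
    field_simp
  rw [← Real.le_log_iff_exp_le h0, ← Real.log_le_iff_le_exp h0, hlog]
  constructor <;> refine mul_le_mul_of_nonneg_left ?_ hn'.le <;> linarith [h1.1, h1.2, h2.1, h2.2]

lemma eventually_norm_eval_flowPoly_le (ha : HasExponentialProfile a g) (ht : 0 < t) {z : ℂ}
    (hz : z.im ≠ 0) {ε : ℝ} (hε : 0 < ε) : ∀ᶠ n : ℕ in atTop, ∀ x : ℕ → ℂ,
      (∀ k ≤ n, ‖x k‖ ≤ Real.exp (n * (ε / 3))) →
        ‖(flowPoly a t n x).eval z‖ ≤ Real.exp (n * (limitPot t g z + ε)) := by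
  -- One third each for the noise, the deterministic coefficients and the number `n + 1` of terms.
  have hε3 : 0 < ε / 3 := by positivity
  filter_upwards [eventually_flowCoeff_close ha ht hz hε3, eventually_add_one_le_exp hε3]
    with n h1 h2 x hx
  rw [eval_flowPoly]
  calc ‖∑ k ∈ Finset.range (n + 1), x k * flowCoeff a t n z k‖
      ≤ ∑ k ∈ Finset.range (n + 1),
          Real.exp (n * (ε / 3)) * Real.exp (n * (limitPot t g z + ε / 3)) := by
        refine norm_sum_le_of_le _ fun k hk => ?_
        have hk' : k ≤ n := Nat.lt_succ_iff.1 (Finset.mem_range.1 hk)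
        rw [norm_mul]
        refine mul_le_mul (hx k hk') ((h1 k hk').2.trans ?_) (norm_nonneg _) (Real.exp_pos _).le
        gcongr
        exact le_limitPot ht ha.continuousOn z (natCast_div_mem_Icc hk')
    _ = ((n : ℝ) + 1) * (Real.exp (n * (ε / 3)) * Real.exp (n * (limitPot t g z + ε / 3))) := by
        simp
    _ ≤ Real.exp (n * (ε / 3)) *
          (Real.exp (n * (ε / 3)) * Real.exp (n * (limitPot t g z + ε / 3))) := by gcongr
    _ = Real.exp (n * (limitPot t g z + ε)) := by
        rw [← Real.exp_add, ← Real.exp_add]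
        ring_nf

lemma exists_norm_eval_flowPoly_le (ha : HasExponentialProfile a g) (ht : 0 < t) (ρ : ℝ) :
    ∃ C : ℝ, ∀ᶠ n : ℕ in atTop, ∀ x : ℕ → ℂ, (∀ k ≤ n, ‖x k‖ ≤ Real.exp n) →
      ∀ z : ℂ, ‖z‖ ≤ ρ → ‖(flowPoly a t n x).eval z‖ ≤ Real.exp (n * C) := by
  obtain ⟨A, hA⟩ := (isCompact_Icc.image_of_continuousOn ha.continuousOn).bddAbove
  refine ⟨3 + A + Real.log (|ρ| + t + 1), ?_⟩
  filter_upwards [ha.profile 1 one_pos, eventually_add_one_le_exp one_pos, eventually_gt_atTop 0]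
    with n h1 h2 hn x hx z hz
  have hn' : (0 : ℝ) < n := by exact_mod_cast hn
  have hρ : 1 ≤ |ρ| + t + 1 := by linarith [abs_nonneg ρ]
  rw [eval_flowPoly]
  calc ‖∑ k ∈ Finset.range (n + 1), x k * flowCoeff a t n z k‖
      ≤ ∑ k ∈ Finset.range (n + 1), Real.exp n *
          (Real.exp (n * (A + 1)) * Real.exp (n * Real.log (|ρ| + t + 1))) := by
        refine norm_sum_le_of_le _ fun k hk => ?_
        have hk' : k ≤ n := Nat.lt_succ_iff.1 (Finset.mem_range.1 hk)
        rw [norm_mul, flowCoeff, norm_mul]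
        have e1 : ‖a n k‖ ≤ Real.exp (n * (A + 1)) := by
          obtain ⟨h0, h3⟩ := h1 k hk'
          rw [← Real.log_le_iff_le_exp (norm_pos_iff.2 h0)]
          have h4 := (abs_le.1 h3).2
          have h5 := hA (Set.mem_image_of_mem g (natCast_div_mem_Icc hk'))
          calc Real.log ‖a n k‖ = n * (1 / (n : ℝ) * Real.log ‖a n k‖) := by field_simp
            _ ≤ n * (A + 1) := by gcongr; linarith
        have e2 : ‖(hermitePoly ((t / n : ℝ) : ℂ) k).eval z‖ ≤
            Real.exp (n * Real.log (|ρ| + t + 1)) := by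
          refine (norm_hermitePoly_eval_le (t := t) (by positivity) z n
            (by rw [div_mul_cancel₀ _ hn'.ne']) k hk').trans ?_
          rw [mul_comm, Real.exp_mul, Real.exp_log (by linarith), Real.rpow_natCast]
          calc (‖z‖ + t + 1) ^ k ≤ (|ρ| + t + 1) ^ k := by
                gcongr
                exact hz.trans (le_abs_self ρ)
            _ ≤ _ := pow_le_pow_right₀ hρ hk'
        have := hx k hk'
        gcongr
    _ = ((n : ℝ) + 1) * (Real.exp n *
          (Real.exp (n * (A + 1)) * Real.exp (n * Real.log (|ρ| + t + 1)))) := by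
        simp
    _ ≤ Real.exp (n * 1) * (Real.exp n *
          (Real.exp (n * (A + 1)) * Real.exp (n * Real.log (|ρ| + t + 1)))) := by gcongr
    _ = _ := by
        rw [← Real.exp_add, ← Real.exp_add, ← Real.exp_add]
        ring_nf

lemma ae_circleMap_im_ne_zero (z : ℂ) {R : ℝ} (hR : R ≠ 0) :
    ∀ᵐ θ : ℝ, (circleMap z R θ).im ≠ 0 := by
  set s := √(R ^ 2 - z.im ^ 2) with hs
  have hc : ({((z.re + s : ℝ) : ℂ), ((z.re - s : ℝ) : ℂ)} : Set ℂ).Countable :=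
    (Set.toFinite _).countable
  filter_upwards [ae_circleMap_notMem hc z hR] with θ hθ h0
  apply hθ
  set ζ := circleMap z R θ with hζ
  have hn : ‖ζ - z‖ = |R| := by simp [hζ, circleMap]
  have h1 : (ζ.re - z.re) ^ 2 = R ^ 2 - z.im ^ 2 := by
    have := Complex.sq_norm (ζ - z)
    rw [hn, sq_abs, Complex.normSq_apply, Complex.sub_re, Complex.sub_im, h0] at this
    linarith
  have h2 : (ζ.re - z.re) ^ 2 = s ^ 2 := by
    rw [hs, Real.sq_sqrt (by rw [← h1]; positivity), h1]
  rcases sq_eq_sq_iff_eq_or_eq_neg.1 h2 with h | h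
  · left
    apply Complex.ext
    · rw [Complex.ofReal_re]; linarith
    · simpa using h0
  · right
    apply Complex.ext
    · rw [Complex.ofReal_re]; linarith
    · simpa using h0

/-- The pointwise upper bound is available off the real line only, which still covers almost every
point of a circle. The uniform crude bound `K` then allows dominated convergence. -/
lemma eventually_circleAverage_flowPoly_le (ha : HasExponentialProfile a g) (ht : 0 < t)
    {N : ℕ → ℕ} (hN : Tendsto N atTop atTop) {x : ℕ → ℕ → ℂ}
    (hx : ∀ ε : ℝ, 0 < ε → ∀ᶠ m in atTop, ∀ k ≤ N m, ‖x m k‖ ≤ Real.exp (N m * ε))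
    (hne : ∀ᶠ m in atTop, flowPoly a t (N m) (x m) ≠ 0) (z : ℂ) {R : ℝ} (hR : 0 < R) {ε : ℝ}
    (hε : 0 < ε) : ∀ᶠ m in atTop,
      Real.circleAverage (fun ζ => Real.log ‖(flowPoly a t (N m) (x m)).eval ζ‖) z R ≤
        N m * (Real.circleAverage (limitPot t g) z R + ε) := by
  set U := limitPot t g with hU
  have hUc : Continuous U := continuous_limitPot ht ha.continuousOn
  obtain ⟨K, hK⟩ := exists_norm_eval_flowPoly_le ha ht (‖z‖ + R)
  set q : ℕ → ℂ[X] := fun m => flowPoly a t (N m) (x m) with hq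
  -- Clipping below by `U` removes the singularities at the zeros and is harmless, since only an
  -- upper bound is sought. Clipping above by `K` eventually changes nothing on the circle, outside
  -- the zeros.
  set f : ℕ → ℂ → ℝ := fun m ζ => max (min ((N m : ℝ)⁻¹ * Real.log ‖(q m).eval ζ‖) K) (U ζ) with hf
  have hUi : CircleIntegrable U z R := circleIntegrable_of_continuous hUc _ _
  have hqi : ∀ m, CircleIntegrable (fun ζ => (N m : ℝ)⁻¹ * Real.log ‖(q m).eval ζ‖) z R := fun m =>
    (circleIntegrable_log_norm_eval (q m) z R).const_mul _
  have hKi : CircleIntegrable (fun _ => K) z R := circleIntegrable_const _ _ _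
  have hfi : ∀ m, CircleIntegrable (f m) z R := fun m =>
    ⟨((hqi m).1.inf hKi.1).sup hUi.1, ((hqi m).2.inf hKi.2).sup hUi.2⟩
  have hroot : ∀ᵐ θ : ℝ, ∀ m, q m ≠ 0 → (q m).eval (circleMap z R θ) ≠ 0 := by
    refine ae_all_iff.2 fun m => ?_
    filter_upwards [ae_circleMap_notMem ((q m).roots.toFinset.finite_toSet.countable) z hR.ne']
      with θ hθ hm h0
    exact hθ (by simpa using ⟨hm, h0⟩)
  have hlim : Tendsto (fun m => Real.circleAverage (f m) z R) atTop
      (𝓝 (Real.circleAverage U z R)) := by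
    refine tendsto_circleAverage_of_dominated (b := fun ζ => |U ζ| + |K|) hfi ?_ (fun m => ?_) ?_
    · exact circleIntegrable_of_continuous (by fun_prop) _ _
    · refine ae_of_all _ fun θ => abs_le.2 ⟨?_, ?_⟩
      · refine le_trans ?_ (le_max_right _ _)
        linarith [neg_abs_le (U (circleMap z R θ)), abs_nonneg K]
      · refine max_le ((min_le_right _ _).trans ?_) ?_
        · linarith [le_abs_self K, abs_nonneg (U (circleMap z R θ))]
        · linarith [le_abs_self (U (circleMap z R θ)), abs_nonneg K]
    · filter_upwards [hroot, ae_circleMap_im_ne_zero z hR.ne'] with θ hθ him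
      refine tendsto_order.2 ⟨fun b hb => ?_, fun b hb => ?_⟩
      · exact Eventually.of_forall fun m => hb.trans_le (le_max_right _ _)
      · obtain ⟨δ, hδ, hδb⟩ : ∃ δ, 0 < δ ∧ U (circleMap z R θ) + δ < b :=
          ⟨(b - U (circleMap z R θ)) / 2, by linarith, by linarith⟩
        filter_upwards [hN.eventually (eventually_norm_eval_flowPoly_le ha ht him hδ),
          hx (δ / 3) (by positivity), hne, hN.eventually_gt_atTop 0] with m h1 h2 h3 h4
        have h4' : (0 : ℝ) < N m := by exact_mod_cast h4
        refine (max_le ((min_le_left _ _).trans ?_) (by linarith)).trans_lt hδb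
        rw [inv_mul_le_iff₀ h4', Real.log_le_iff_le_exp (norm_pos_iff.2 (hθ m h3))]
        exact h1 _ h2
  filter_upwards [hlim.eventually_le_const (lt_add_of_pos_right _ hε), hN.eventually hK,
    hx 1 one_pos, hN.eventually_gt_atTop 0, hne] with m h1 h2 h3 h4 h5
  have h4' : (0 : ℝ) < N m := by exact_mod_cast h4
  have h6 : Real.circleAverage (fun ζ => (N m : ℝ)⁻¹ * Real.log ‖(q m).eval ζ‖) z R ≤
      Real.circleAverage (f m) z R := by
    unfold Real.circleAverage
    simp only [smul_eq_mul]
    refine mul_le_mul_of_nonneg_left ?_ (by positivity)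
    refine intervalIntegral.integral_mono_ae Real.two_pi_pos.le (hqi m) (hfi m) ?_
    filter_upwards [hroot] with θ hθ
    refine le_trans (le_min le_rfl ?_) (le_max_left _ _)
    rw [inv_mul_le_iff₀ h4', Real.log_le_iff_le_exp (norm_pos_iff.2 (hθ m h5))]
    refine h2 _ (by simpa using h3) _ ?_
    refine (norm_le_norm_add_norm_sub' _ z).trans ?_
    simp [circleMap, abs_of_pos hR]
  have h7 : Real.circleAverage (fun ζ => (N m : ℝ)⁻¹ * Real.log ‖(q m).eval ζ‖) z R =
      (N m : ℝ)⁻¹ * Real.circleAverage (fun ζ => Real.log ‖(q m).eval ζ‖) z R := by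
    simpa using Real.circleAverage_fun_smul (a := (N m : ℝ)⁻¹)
      (f := fun ζ => Real.log ‖(q m).eval ζ‖) (c := z) (R := R)
  rw [h7, inv_mul_le_iff₀ h4'] at h6
  exact h6.trans (by gcongr)

/-! ### Realizations with good coefficients -/

/-- The coefficients `x` are subexponential and the evolved polynomial is not too small at the first
few points of the sequence `zs`, both at precision `1 / (m + 1)`. -/
def IsGood (a : ℕ → ℕ → ℂ) (g : ℝ → ℝ) (t : ℝ) (zs : ℕ → ℂ) (m n : ℕ) (x : ℕ → ℂ) : Prop :=
  (∀ k ≤ n, ‖x k‖ ≤ Real.exp (n * (1 / ((m : ℝ) + 1)))) ∧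
    ∀ i ≤ m, Real.exp (n * (limitPot t g (zs i) - 1 / ((m : ℝ) + 1))) ≤
      ‖(flowPoly a t n x).eval (zs i)‖

lemma exists_limit_of_isGood (ha : HasExponentialProfile a g) (ht : 0 < t) {zs : ℕ → ℂ}
    (hzs : DenseRange zs) {N : ℕ → ℕ} (hN : Tendsto N atTop atTop) {x : ℕ → ℕ → ℂ}
    (hx : ∀ m, IsGood a g t zs m (N m) (x m)) (F : Ultrafilter ℕ) (hF : (F : Filter ℕ) ≤ atTop) :
    ∃ ν : ProbabilityMeasure ℂ, (∃ L, IsRieszMeasure (limitPot t g) (ν : Measure ℂ) L) ∧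
      ∀ f : ℂ →ᵇ ℝ, Tendsto (fun m => ∫ z, f z ∂(zeroDistribution (flowPoly a t (N m) (x m)))) F
        (𝓝 (∫ z, f z ∂(ν : Measure ℂ))) := by
  have hsmall : ∀ ε : ℝ, 0 < ε → ∀ᶠ m : ℕ in atTop, 1 / ((m : ℝ) + 1) < ε := fun ε hε =>
    tendsto_one_div_add_atTop_nhds_zero_nat.eventually_lt_const hε
  have hne : ∀ᶠ m in atTop, flowPoly a t (N m) (x m) ≠ 0 := by
    refine Eventually.of_forall fun m h0 => ?_
    have := (Real.exp_pos _).trans_le ((hx m).2 0 (Nat.zero_le _))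
    simp [h0] at this
  refine exists_limit_isRieszMeasure (continuous_limitPot ht ha.continuousOn) hzs hN
    (fun m => natDegree_flowPoly_le a t _ _) ?_ ?_
    (exists_log_sub_le_limitPot ht ha.continuousOn hzs) F hF
  · rintro _ ⟨i, rfl⟩ ε hε
    filter_upwards [hsmall ε hε, eventually_ge_atTop i] with m hm hi
    refine le_trans ?_ ((hx m).2 i hi)
    gcongr
  · intro z R hR ε hε
    refine eventually_circleAverage_flowPoly_le ha ht hN (fun δ hδ => ?_) hne z hR hε
    filter_upwards [hsmall δ hδ] with m hm k hk
    refine ((hx m).1 k hk).trans ?_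
    gcongr

end
end HeatZeros

namespace HeatZeros
noncomputable section

/-! ### Realizations are good with high probability -/

/-- Integrability gives slightly more than Markov's inequality. The factor `n + 1` pays for the
union bound over all coefficients. -/
lemma tendsto_mul_measureReal_gt {Ω : Type*} [MeasurableSpace Ω] {P : Measure Ω}
    [IsProbabilityMeasure P] {Y : Ω → ℝ} (hY : Measurable Y) (hi : Integrable Y P)
    {c : ℝ} (hc : 0 < c) :
    Tendsto (fun n : ℕ => ((n : ℝ) + 1) * P.real {ω | n * c < Y ω}) atTop (𝓝 0) := by
  have hms : ∀ n : ℕ, MeasurableSet {ω | n * c < Y ω} := fun n =>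
    measurableSet_lt measurable_const hY
  have hlim : Tendsto (fun n : ℕ => ∫ ω, Set.indicator {ω | n * c < Y ω} (fun ω => |Y ω| + c) ω ∂P)
      atTop (𝓝 (∫ _, (0 : ℝ) ∂P)) := by
    refine tendsto_integral_of_dominated_convergence (fun ω => |Y ω| + c) (fun n => ?_)
      (hi.abs.add (integrable_const c)) (fun n => ae_of_all _ fun ω => ?_)
      (ae_of_all _ fun ω => ?_)
    · exact ((hY.abs.add_const c).indicator (hms n)).aestronglyMeasurable
    · refine (norm_indicator_le_norm_self _ _).trans ?_
      rw [Real.norm_of_nonneg (by positivity)]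
    · refine tendsto_const_nhds.congr' ?_
      have h := (tendsto_natCast_atTop_atTop (R := ℝ)).eventually_ge_atTop (Y ω / c)
      filter_upwards [h] with n hn
      rw [Set.indicator_of_notMem]
      simp only [Set.mem_ofPred_eq, not_lt]
      rwa [div_le_iff₀ hc] at hn
  rw [integral_zero] at hlim
  have hlim' := hlim.const_mul c⁻¹
  rw [mul_zero] at hlim'
  refine squeeze_zero (fun n => by positivity) (fun n => ?_) hlim'
  rw [le_inv_mul_iff₀ hc]
  calc c * (((n : ℝ) + 1) * P.real {ω | n * c < Y ω})
      = ∫ ω, Set.indicator {ω | n * c < Y ω} (fun _ => n * c + c) ω ∂P := by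
        rw [integral_indicator (hms n), setIntegral_const, smul_eq_mul]
        ring
    _ ≤ _ := by
        refine integral_mono ((integrable_const _).indicator (hms n))
          ((hi.abs.add (integrable_const c)).indicator (hms n)) fun ω => ?_
        refine Set.indicator_le_indicator' fun hω => ?_
        have : n * c < Y ω := hω
        linarith [le_abs_self (Y ω)]

variable {Ω : Type*} [MeasurableSpace Ω] {P : Measure Ω} [IsProbabilityMeasure P]
  {ξ : ℕ → Ω → ℂ} {a : ℕ → ℕ → ℂ} {g : ℝ → ℝ} {t : ℝ}

lemma IsAdmissibleNoise.tendsto_measureReal_exists_large (hξ : IsAdmissibleNoise P ξ) {c : ℝ}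
    (hc : 0 < c) :
    Tendsto (fun n : ℕ => P.real {ω | ∃ k ≤ n, Real.exp (n * c) < ‖ξ k ω‖}) atTop (𝓝 0) := by
  have hm : Measurable fun w : ℂ => Real.log (1 + ‖w‖) := by fun_prop
  refine squeeze_zero (fun n => measureReal_nonneg) (fun n => ?_)
    (tendsto_mul_measureReal_gt (hm.comp (hξ.measurable 0)) hξ.integrable_log hc)
  have hk : ∀ k, P.real {ω | Real.exp (n * c) < ‖ξ k ω‖} ≤
      P.real {ω | n * c < Real.log (1 + ‖ξ 0 ω‖)} := by
    intro k
    have h1 := (hξ.identDistrib k).measure_mem_eq (s := {w : ℂ | Real.exp (n * c) < ‖w‖})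
      (measurableSet_lt measurable_const measurable_norm)
    have h2 : P.real {ω | Real.exp (n * c) < ‖ξ k ω‖} = P.real {ω | Real.exp (n * c) < ‖ξ 0 ω‖} :=
      congrArg ENNReal.toReal h1
    rw [h2]
    refine measureReal_mono fun ω hω => ?_
    have hω' : Real.exp (n * c) < ‖ξ 0 ω‖ := hω
    exact (Real.lt_log_iff_exp_lt (by positivity)).2 (by linarith)
  calc P.real {ω | ∃ k ≤ n, Real.exp (n * c) < ‖ξ k ω‖}
      ≤ P.real (⋃ k ∈ Finset.range (n + 1), {ω | Real.exp (n * c) < ‖ξ k ω‖}) := by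
        refine measureReal_mono ?_ (measure_ne_top _ _)
        rintro ω ⟨k, hk, h⟩
        simp only [Set.mem_iUnion, Finset.mem_range]
        exact ⟨k, Nat.lt_succ_of_le hk, h⟩
    _ ≤ ∑ k ∈ Finset.range (n + 1), P.real {ω | Real.exp (n * c) < ‖ξ k ω‖} :=
        measureReal_biUnion_finset_le _ _
    _ ≤ ∑ _k ∈ Finset.range (n + 1), P.real {ω | n * c < Real.log (1 + ‖ξ 0 ω‖)} :=
        Finset.sum_le_sum fun k _ => hk k
    _ = _ := by simp

lemma eventually_card_Icc_ge {p q : ℝ} (hp : 0 ≤ p) (hpq : p < q) (hq : q ≤ 1) (M : ℕ) :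
    ∀ᶠ n : ℕ in atTop,
      M ≤ (Finset.univ.filter fun j : Fin (n + 1) => (j : ℝ) / n ∈ Set.Icc p q).card := by
  have h := (tendsto_natCast_atTop_atTop (R := ℝ)).eventually_ge_atTop ((M + 1) / (q - p))
  filter_upwards [h, eventually_gt_atTop 0] with n hn hn0
  have hn' : (0 : ℝ) < n := by exact_mod_cast hn0
  rw [div_le_iff₀ (by linarith)] at hn
  have hc1 := Nat.le_ceil (p * n)
  have hc2 := Nat.ceil_lt_add_one (a := p * n) (by positivity)
  have hle : ∀ i < M, ((⌈p * n⌉₊ + i : ℕ) : ℝ) ≤ q * n := by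
    intro i hi
    have hi' : (i : ℝ) ≤ M := by exact_mod_cast hi.le
    push_cast
    nlinarith
  have hlt : ∀ i < M, ⌈p * n⌉₊ + i < n + 1 := by
    intro i hi
    have h1 : ((⌈p * n⌉₊ + i : ℕ) : ℝ) ≤ n := (hle i hi).trans (by nlinarith)
    exact Nat.lt_succ_of_le (by exact_mod_cast h1)
  conv_lhs => rw [← Finset.card_range M]
  refine Finset.card_le_card_of_injOn (fun i => Fin.ofNat (n + 1) (⌈p * n⌉₊ + i)) ?_ ?_
  · intro i hi
    have hi' : i < M := by simpa using hi
    have hv : ((Fin.ofNat (n + 1) (⌈p * n⌉₊ + i) : Fin (n + 1)) : ℕ) = ⌈p * n⌉₊ + i := by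
      simp [Fin.ofNat, Nat.mod_eq_of_lt (hlt i hi')]
    simp only [Finset.coe_filter, Finset.mem_univ, true_and, Set.mem_ofPred_eq, hv]
    refine ⟨(le_div_iff₀ hn').2 ?_, (div_le_iff₀ hn').2 (hle i hi')⟩
    push_cast
    linarith [(Nat.cast_nonneg i : (0 : ℝ) ≤ i)]
  · intro i hi j hj hij
    have hi' : i < M := by simpa using hi
    have hj' : j < M := by simpa using hj
    have := congrArg Fin.val hij
    simp only [Fin.ofNat, Nat.mod_eq_of_lt (hlt i hi'), Nat.mod_eq_of_lt (hlt j hj')] at this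
    omega

/-- A whole interval of near-maximisers makes arbitrarily many coefficients almost as large as the
maximum, as anti-concentration requires. -/
lemma exists_Icc_lt_add_hermitePot (hg : ContinuousOn g (Set.Icc 0 1)) (ht : 0 < t) (z : ℂ) {ε : ℝ}
    (hε : 0 < ε) : ∃ p q : ℝ, 0 ≤ p ∧ p < q ∧ q ≤ 1 ∧
      ∀ β ∈ Set.Icc p q, limitPot t g z - ε ≤ g β + hermitePot t β z := by
  obtain ⟨α, hα, h⟩ := exists_limitPot_eq ht hg z
  obtain ⟨η, hη, hc⟩ := Metric.continuousOn_iff.1 (hg.add (continuousOn_hermitePot ht z)) α hα ε hε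
  refine ⟨max 0 (α - η / 2), min 1 (α + η / 2), le_max_left _ _, ?_, min_le_left _ _,
    fun β hβ => ?_⟩
  · obtain ⟨h0, h1⟩ := hα
    rw [max_lt_iff, lt_min_iff, lt_min_iff]
    exact ⟨⟨one_pos, by linarith⟩, by linarith, by linarith⟩
  · have h1 : 0 ≤ β := (le_max_left _ _).trans hβ.1
    have h2 : α - η / 2 ≤ β := (le_max_right _ _).trans hβ.1
    have h3 : β ≤ 1 := hβ.2.trans (min_le_left _ _)
    have h4 : β ≤ α + η / 2 := hβ.2.trans (min_le_right _ _)
    have h5 := hc β ⟨h1, h3⟩ (by rw [Real.dist_eq, abs_lt]; constructor <;> linarith)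
    rw [Real.dist_eq, abs_lt] at h5
    simp only [Pi.add_apply] at h5
    linarith [h5.1]

/-- Anti-concentration at scale `B = exp(n (U - 2ε/3))`: two thirds of `ε` are lost on
near-maximality and on the coefficient asymptotics, and the last third absorbs the constant `c`. -/
lemma IsAdmissibleNoise.tendsto_measureReal_eval_flowPoly_small (hξ : IsAdmissibleNoise P ξ)
    (ha : HasExponentialProfile a g) (ht : 0 < t) {z : ℂ} (hz : z.im ≠ 0) {ε : ℝ} (hε : 0 < ε) :
    Tendsto (fun n : ℕ => P.real {ω | ‖(flowPoly a t n fun k => ξ k ω).eval z‖ <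
      Real.exp (n * (limitPot t g z - ε))}) atTop (𝓝 0) := by
  obtain ⟨c, hc, hanti⟩ := hξ.exists_anticoncentration
  obtain ⟨p, q, hp, hpq, hq, hβ⟩ :=
    exists_Icc_lt_add_hermitePot ha.continuousOn ht z (ε := ε / 3) (by positivity)
  refine tendsto_order.2 ⟨fun b hb => Eventually.of_forall fun n => hb.trans_le measureReal_nonneg,
    fun b hb => ?_⟩
  obtain ⟨M, hM⟩ := hanti (b / 2) (by positivity)
  have hcε : ∀ᶠ n : ℕ in atTop, Real.exp (-(n * (ε / 3))) ≤ c := by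
    have h : Tendsto (fun n : ℕ => Real.exp (-(n * (ε / 3)))) atTop (𝓝 0) :=
      Real.tendsto_exp_neg_atTop_nhds_zero.comp
        ((tendsto_natCast_atTop_atTop (R := ℝ)).atTop_mul_const (by positivity))
    exact h.eventually_le_const hc
  filter_upwards [hcε, eventually_card_Icc_ge hp hpq hq M,
    eventually_flowCoeff_close ha ht hz (ε := ε / 3) (by positivity)] with n h1 h2 h3
  refine lt_of_le_of_lt ?_ (half_lt_self hb)
  refine le_trans (measureReal_mono ?_)
    (hM (n + 1) (fun j => flowCoeff a t n z j) (Real.exp (n * (limitPot t g z - 2 * (ε / 3)))) _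
      (Real.exp_pos _) h2 fun j hj => ?_)
  · intro ω hω
    have hω' : ‖(flowPoly a t n fun k => ξ k ω).eval z‖ <
      Real.exp (n * (limitPot t g z - ε)) := hω
    rw [eval_flowPoly, Finset.sum_range] at hω'
    refine hω'.le.trans ?_
    rw [show n * (limitPot t g z - ε) = -(n * (ε / 3)) + n * (limitPot t g z - 2 * (ε / 3)) by ring,
      Real.exp_add]
    gcongr
  · refine le_trans ?_ (h3 j (Nat.lt_succ_iff.1 j.2)).1
    have := hβ _ (Finset.mem_filter.1 hj).2
    exact Real.exp_le_exp.2 (mul_le_mul_of_nonneg_left (by linarith) (Nat.cast_nonneg n))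

lemma IsAdmissibleNoise.tendsto_measureReal_not_isGood (hξ : IsAdmissibleNoise P ξ)
    (ha : HasExponentialProfile a g) (ht : 0 < t) {zs : ℕ → ℂ} (hz : ∀ i, (zs i).im ≠ 0) (m : ℕ) :
    Tendsto (fun n : ℕ => P.real {ω | ¬ IsGood a g t zs m n fun k => ξ k ω}) atTop (𝓝 0) := by
  have hm : (0 : ℝ) < 1 / ((m : ℝ) + 1) := by positivity
  have hlim := (hξ.tendsto_measureReal_exists_large hm).add
    (tendsto_finsetSum (Finset.range (m + 1)) fun i _ =>
      hξ.tendsto_measureReal_eval_flowPoly_small ha ht (hz i) hm)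
  rw [Finset.sum_const_zero, add_zero] at hlim
  refine squeeze_zero (fun n => measureReal_nonneg) (fun n => ?_) hlim
  refine le_trans ?_ (add_le_add le_rfl (measureReal_biUnion_finset_le _ _))
  refine le_trans (measureReal_mono ?_) (measureReal_union_le _ _)
  intro ω hω
  by_contra! h
  apply hω
  simp only [Set.mem_union, Set.mem_iUnion, Finset.mem_range, Set.mem_ofPred_eq, not_or,
    not_exists, not_and, not_lt] at h
  exact ⟨fun k hk => h.1 k hk, fun i hi => h.2 i (Nat.lt_succ_of_le hi)⟩

end
end HeatZeros

namespace HeatZeros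
noncomputable section

/-! ### Potentials of measures carried by the real line -/

/-- When `R ≤ z.im`, every point of the support is at distance at least `R` from `z`. The truncation
is inactive, so the average does not depend on `R`. -/
lemma IsRieszMeasure.circleAverage_eq_self {U : ℂ → ℝ} (hU : Continuous U) {ν : Measure ℂ} {L : ℝ}
    (h : IsRieszMeasure U ν L) (hν : ν {w : ℂ | w.im ≠ 0} = 0) {z : ℂ} {R : ℝ} (hR : 0 < R)
    (hRz : R ≤ z.im) : Real.circleAverage U z R = U z := by
  have hae : ∀ᵐ w ∂ν, w.im = 0 := by
    rw [ae_iff]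
    exact hν
  have hval : ∀ r : ℝ, 0 < r → r ≤ z.im →
      Real.circleAverage U z r = L + ∫ w, (Real.log ‖z - w‖ - logKer 1 w) ∂ν := by
    intro r hr hrz
    rw [h z r hr, truncPotential]
    congr 1
    refine integral_congr_ae ?_
    filter_upwards [hae] with w hw
    rw [logKer_of_le]
    calc r ≤ z.im := hrz
      _ = (z - w).im := by rw [Complex.sub_im, hw, sub_zero]
      _ ≤ |(z - w).im| := le_abs_self _
      _ ≤ ‖z - w‖ := Complex.abs_im_le_norm _
  refine tendsto_nhds_unique (tendsto_const_nhds.congr' ?_) (tendsto_circleAverage_radius_zero hU z)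
  filter_upwards [tendsto_one_div_add_atTop_nhds_zero_nat.eventually_lt_const (hR.trans_le hRz)]
    with k hk
  rw [hval R hR hRz, hval _ (by positivity) hk.le]

lemma eq_zero_on_sphere_of_circleAverage_eq_zero {h : ℂ → ℝ} (hc : Continuous h) (h0 : ∀ z, 0 ≤ h z)
    {z : ℂ} {R : ℝ} (hR : 0 ≤ R) (hz : Real.circleAverage h z R = 0) {ζ : ℂ} (hζ : ‖ζ - z‖ = R) :
    h ζ = 0 := by
  have hmem : ζ ∈ Metric.sphere z |R| := by rw [abs_of_nonneg hR, mem_sphere_iff_norm, hζ]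
  rw [← image_circleMap_Ioc] at hmem
  obtain ⟨θ, hθ, rfl⟩ := hmem
  by_contra hne
  have hpos := intervalIntegral.integral_pos (f := fun θ => h (circleMap z R θ)) Real.two_pi_pos
    (hc.comp (continuous_circleMap z R)).continuousOn (fun _ _ => h0 _)
    ⟨θ, Set.Ioc_subset_Icc_self hθ, (h0 _).lt_of_ne' hne⟩
  rw [Real.circleAverage, smul_eq_mul] at hz
  have : (0 : ℝ) < (2 * Real.pi)⁻¹ := by positivity
  nlinarith [mul_pos this hpos]

/-- Two potentials, one below the other, whose Riesz measures are carried by the real line agree on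
the upper half-plane as soon as they agree at one of its points. -/
lemma eq_of_isRieszMeasure_of_le {U V : ℂ → ℝ} (hU : Continuous U) (hV : Continuous V)
    (hle : ∀ z, V z ≤ U z) {μ ν : Measure ℂ} {L L' : ℝ} (hμ : IsRieszMeasure U μ L)
    (hν : IsRieszMeasure V ν L') (hμ0 : μ {w : ℂ | w.im ≠ 0} = 0) (hν0 : ν {w : ℂ | w.im ≠ 0} = 0)
    {z₀ : ℂ} (hz₀ : 0 < z₀.im) (h₀ : U z₀ = V z₀) {z : ℂ} (hz : 0 < z.im) : U z = V z := by
  set h : ℂ → ℝ := fun z => U z - V z with hh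
  have hc : Continuous h := hU.sub hV
  have hmean : ∀ z R, 0 < R → R ≤ z.im → Real.circleAverage h z R = h z := by
    intro z R hR hRz
    rw [hh, Real.circleAverage_fun_sub (circleIntegrable_of_continuous hU _ _)
      (circleIntegrable_of_continuous hV _ _), hμ.circleAverage_eq_self hU hμ0 hR hRz,
      hν.circleAverage_eq_self hV hν0 hR hRz]
  -- The strong minimum principle: a zero of the non-negative function `h` forces zero mean, hence
  -- vanishing, on every circle around it of radius below its height.
  have hopen : IsOpen {z : ℂ | 0 < z.im ∧ h z = 0} := by
    rw [Metric.isOpen_iff]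
    rintro z ⟨hz, h0⟩
    have hzero : ∀ ζ ∈ Metric.ball z z.im, h ζ = 0 := by
      intro ζ hζ
      rcases eq_or_ne ζ z with rfl | hne
      · exact h0
      · rw [mem_ball_iff_norm] at hζ
        refine eq_zero_on_sphere_of_circleAverage_eq_zero (z := z) hc
          (fun z => sub_nonneg.2 (hle z)) (norm_nonneg _) ?_ rfl
        rw [hmean z _ (norm_pos_iff.2 (sub_ne_zero.2 hne)) hζ.le, h0]
    refine ⟨z.im, hz, fun ζ hζ => ⟨?_, hzero ζ hζ⟩⟩
    rw [mem_ball_iff_norm] at hζ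
    have := (abs_le.1 (Complex.abs_im_le_norm (ζ - z))).1
    rw [Complex.sub_im] at this
    linarith
  have hpre : IsPreconnected {z : ℂ | 0 < z.im} := (convex_halfSpace_im_gt 0).isPreconnected
  have hsub := hpre.subset_left_of_subset_union hopen (isOpen_ne_fun hc continuous_const)
    (Set.disjoint_left.2 fun z h1 h2 => h2 h1.2)
    (fun z hz => (em (h z = 0)).imp (fun h1 => ⟨hz, h1⟩) id)
    ⟨z₀, hz₀, hz₀, sub_eq_zero.2 h₀⟩
  exact sub_eq_zero.1 (hsub hz).2

/-! ### The limiting zero distribution -/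

lemma exists_denseRange_im_ne_zero : ∃ zs : ℕ → ℂ, DenseRange zs ∧ ∀ i, (zs i).im ≠ 0 := by
  have hd : Dense {z : ℂ | z.im ≠ 0} :=
    (dense_compl_singleton (0 : ℝ)).preimage Complex.isOpenMap_im
  obtain ⟨s, hs, hsc, hsd⟩ := hd.exists_countable_dense_subset
  obtain ⟨zs, rfl⟩ := hsc.exists_eq_range hsd.nonempty
  exact ⟨zs, hsd, fun i => hs ⟨i, rfl⟩⟩

variable {Ω : Type*} [MeasurableSpace Ω] {P : Measure Ω} [IsProbabilityMeasure P]
  {ξ : ℕ → Ω → ℂ} {a : ℕ → ℕ → ℂ} {g : ℝ → ℝ} {t : ℝ}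

/-- The limit measure is built from one deterministic sequence of good coefficients. Uniqueness of
the measure with potential `U` then makes convergence uniform over all good realisations, whose
probability tends to `1`. -/
theorem exists_isLimitingZeroDistribution (hξ : IsAdmissibleNoise P ξ)
    (ha : HasExponentialProfile a g) (ht : 0 < t) :
    ∃ ν : ProbabilityMeasure ℂ, IsLimitingZeroDistribution P ξ a t ν ∧
      ∃ L, IsRieszMeasure (limitPot t g) (ν : Measure ℂ) L := by
  obtain ⟨zs, hzs, him⟩ := exists_denseRange_im_ne_zero
  have hgood := hξ.tendsto_measureReal_not_isGood ha ht him
  have hF : ((hyperfilter ℕ : Ultrafilter ℕ) : Filter ℕ) ≤ atTop :=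
    Nat.cofinite_eq_atTop ▸ hyperfilter_le_cofinite
  -- Good coefficients exist because the exceptional event has probability below `1`.
  have hex : ∀ m, ∃ n x, m ≤ n ∧ IsGood a g t zs m n x := by
    intro m
    obtain ⟨n, hn, hmn⟩ :=
      (((hgood m).eventually_lt_const one_pos).and (eventually_ge_atTop m)).exists
    by_contra! h
    have : {ω | ¬ IsGood a g t zs m n fun k => ξ k ω} = Set.univ :=
      Set.eq_univ_of_forall fun ω => h n _ hmn
    rw [this, probReal_univ] at hn
    exact lt_irrefl _ hn
  choose N x hN hx using hex
  obtain ⟨ν, ⟨L, hL⟩, -⟩ := exists_limit_of_isGood ha ht hzs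
    (tendsto_atTop_mono hN tendsto_id) hx (hyperfilter ℕ) hF
  refine ⟨ν, fun f => ?_, L, hL⟩
  -- Otherwise good coefficients far from `ν` could be chosen with `n → ∞`. Their ultrafilter limit
  -- would have the same potential, hence be `ν`.
  have key : ∀ η : ℝ, 0 < η → ∃ m, ∀ n, m ≤ n → ∀ x, IsGood a g t zs m n x →
      |∫ z, f z ∂(zeroDistribution (flowPoly a t n x)) - ∫ z, f z ∂(ν : Measure ℂ)| < η := by
    intro η hη
    by_contra! h
    choose N hN x hx hfar using h
    obtain ⟨ν', ⟨L', hL'⟩, hlim⟩ := exists_limit_of_isGood ha ht hzs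
      (x := x) (tendsto_atTop_mono hN tendsto_id) hx (hyperfilter ℕ) hF
    rw [hL'.unique hL] at hlim
    obtain ⟨m, hm⟩ := ((hlim f).eventually (Metric.ball_mem_nhds _ hη)).exists
    rw [Real.dist_eq] at hm
    exact (hfar m).not_gt hm
  rw [tendstoInMeasure_iff_measureReal_norm]
  intro η hη
  obtain ⟨m, hm⟩ := key η hη
  refine squeeze_zero' (Eventually.of_forall fun n => measureReal_nonneg) ?_ (hgood m)
  filter_upwards [eventually_ge_atTop m] with n hn
  refine measureReal_mono fun ω hω hg => ?_
  have hω' : η ≤ ‖_‖ := hω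
  exact hω'.not_gt (hm n hn _ hg)

lemma IsLimitingZeroDistribution.unique {μ ν : ProbabilityMeasure ℂ}
    (hμ : IsLimitingZeroDistribution P ξ a t μ) (hν : IsLimitingZeroDistribution P ξ a t ν) :
    μ = ν := by
  have h : (μ : Measure ℂ) = ν := ext_of_forall_integral_eq_of_IsFiniteMeasure fun f => by
    obtain ⟨_, hω⟩ := (tendstoInMeasure_ae_unique (hμ f) (hν f)).exists
    exact hω
  exact Subtype.ext h

lemma IsRieszMeasure.const_add {U : ℂ → ℝ} (hU : Continuous U) {ν : Measure ℂ} {L : ℝ}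
    (h : IsRieszMeasure U ν L) (c : ℝ) : IsRieszMeasure (fun z => c + U z) ν (c + L) := by
  intro z R hR
  rw [Real.circleAverage_fun_add (circleIntegrable_const _ _ _)
    (circleIntegrable_of_continuous hU _ _), Real.circleAverage_const, h z R hR, add_assoc]

end
end HeatZeros

theorem theorem2p10 {Ω : Type*} [MeasurableSpace Ω] (P : Measure Ω) [IsProbabilityMeasure P]
    (ξ : ℕ → Ω → ℂ) (a : ℕ → ℕ → ℂ) (g : ℝ → ℝ)
    (hξ : HeatZeros.IsAdmissibleNoise P ξ) (ha : HeatZeros.HasExponentialProfile a g)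
    (t : ℝ) (ht : 0 < t) :
    BddAbove (HeatZeros.wignerTimeFun g '' Set.Ioo 0 1) ∧
    ∃ ν : ProbabilityMeasure ℂ,
      (∀ ν' : ProbabilityMeasure ℂ,
        HeatZeros.IsLimitingZeroDistribution P ξ a t ν' ↔ ν' = ν) ∧
      ((ν : Measure ℂ) = HeatZeros.semicircle t ↔ HeatZeros.wignerTime g ≤ t) ∧
      (t < HeatZeros.wignerTime g → 0 < (ν : Measure ℂ) {z : ℂ | z.im ≠ 0}) := by
  have hb := HeatZeros.bddAbove_wignerTimeFun ha.concaveOn ha.leftDeriv_one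
  obtain ⟨ν, hν, L, hL⟩ := HeatZeros.exists_isLimitingZeroDistribution hξ ha ht
  have hsc := HeatZeros.isProbabilityMeasure_semicircle ht
  have hVc := HeatZeros.continuous_hermitePot ht (α := 1) (by simp)
  obtain ⟨L', hL'⟩ := HeatZeros.exists_isRieszMeasure_semicircle ht
  have hV := hL'.const_add hVc (g 1)
  have hpos : t < HeatZeros.wignerTime g → 0 < (ν : Measure ℂ) {z : ℂ | z.im ≠ 0} := by
    intro hlt
    rw [pos_iff_ne_zero]
    intro h0
    obtain ⟨z₀, hz₀, e₀⟩ := HeatZeros.exists_limitPot_eq_of_im_large ht ha.continuousOn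
      ha.concaveOn ha.leftDeriv_one
    obtain ⟨z, hz, hzlt⟩ := HeatZeros.exists_lt_limitPot_of_lt_wignerTime ht ha.continuousOn hlt
    -- If `ν` were carried by the real line, equality at `z₀` would propagate to the point `z` of
    -- strict inequality.
    exact hzlt.ne' (HeatZeros.eq_of_isRieszMeasure_of_le
      (HeatZeros.continuous_limitPot ht ha.continuousOn) (continuous_const.add hVc)
      (fun z => HeatZeros.le_limitPot ht ha.continuousOn z (by simp)) hL hV h0
      (HeatZeros.semicircle_im_ne_zero t) hz₀ e₀ hz)
  refine ⟨hb, ν, fun ν' => ⟨fun h => h.unique hν, fun h => h ▸ hν⟩, ⟨fun h => ?_, fun h => ?_⟩, hpos⟩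
  · by_contra! hlt
    have := hpos hlt
    rw [h, HeatZeros.semicircle_im_ne_zero] at this
    exact lt_irrefl _ this
  -- The potentials of `ν` and of the semicircle law now differ by the constant `g 1` only.
  · rw [← funext (HeatZeros.limitPot_eq_of_wignerTime_le ht ha.continuousOn hb h)] at hV
    exact hL.unique hV
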